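/- **Theorem A.1 (BKS inequality).** Let $p\ge 1$ and let $A,B$ be nonnegative self-adjoint (possibly unbounded) operators on a separable complex Hilbert space $H$. For a self-adjoint operator $X$ write $X_\pm=(|X|\pm X)/2$ (closures understood), and for a nonnegative self-adjoint operator $T$ write $Q(T)=\operatorname{dom}T^{1/2}$ and $t[u]=\|T^{1/2}u\|^2$ for its form domain and quadratic form, with $t[u]=\infty$ if $u\notin Q(T)$. Differences are understood in the sense of quadratic forms: a self-adjoint operator $X$ is said to be the difference $T-S$ of two nonnegative self-adjoint operators if $Q(S)\cap Q(T)$ is a form core of $X$ (a subspace of $\operatorname{dom}|X|^{1/2}$ that is dense in it for the form norm) and there $x_+[u]-x_-[u]=t[u]-s[u]$, where $x_\pm$ is the form of $X_\pm$. (For bounded $S,T$ this just says $X=T-S$.) Suppose that $Q(A^p)\subseteq Q(B^p)$, that the self-adjoint operator $B^p-A^p$ exists in this sense, and that $(B^p-A^p)_+^{1/p}$ is trace class. Then $Q(A)\subseteq Q(B)$, and $(B-A)_+$ is trace class with $$\operatorname{tr}\,(B-A)_+\;\le\;\operatorname{tr}\,(B^p-A^p)_+^{1/p}.$$ Here the last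 assertion means the following: it holds for every self-adjoint operator $X$ that is the difference $B-A$ in the above sense; and, whether or not such an $X$ exists, there is a bounded nonnegative trace class operator $K$ with $\operatorname{tr}K\le\operatorname{tr}\,(B^p-A^p)_+^{1/p}$ and $b[u]\le a[u]+\langle u,Ku\rangle$ for all $u\in H$, where $a,b$ are the forms of $A,B$. -/

import Mathlib

open scoped ENNReal InnerProductSpace

noncomputable section

namespace UnboundedOperator

universe u

variable {H : Type u} [NormedAddCommGroup H] [InnerProductSpace ℂ H] [CompleteSpace H]

/-! ### Nonnegative self-adjoint operators and their powers -/

/-- A (possibly unbounded, densely defined) operator that is self-adjoint and nonnegative. -/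
def IsNonnegSelfAdjoint (A : H →ₗ.[ℂ] H) : Prop :=
  IsSelfAdjoint A ∧ ∀ x : A.domain, 0 ≤ (⟪(x : H), A x⟫_ℂ).re

/-- `R` is the bounded everywhere defined inverse of `1 + A`. -/
def IsInvOneAdd (A : H →ₗ.[ℂ] H) (R : H →L[ℂ] H) : Prop :=
  (∀ y : H, ∃ h : R y ∈ A.domain, R y + A ⟨R y, h⟩ = y) ∧
    ∀ x : A.domain, R ((x : H) + A x) = x

theorem norm_le_norm_add {A : H →ₗ.[ℂ] H} (hA : IsNonnegSelfAdjoint A) (x : A.domain) :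
    ‖(x : H)‖ ≤ ‖(x : H) + A x‖ := by
  have h1 : ‖(x : H)‖ * ‖(x : H)‖ ≤ ‖(x : H)‖ * ‖(x : H) + A x‖ := by
    refine le_trans ?_ (re_inner_le_norm (𝕜 := ℂ) (x : H) ((x : H) + A x))
    rw [inner_add_right, map_add, inner_self_eq_norm_mul_norm]
    exact le_add_of_nonneg_right (hA.2 x)
  rcases eq_or_lt_of_le (norm_nonneg (x : H)) with h | h
  · rw [← h]; exact norm_nonneg _
  · exact le_of_mul_le_mul_left h1 h

/-- A nonnegative self-adjoint operator `A` has a bounded inverse `(1 + A)⁻¹`. -/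
theorem exists_isInvOneAdd {A : H →ₗ.[ℂ] H} (hA : IsNonnegSelfAdjoint A) :
    ∃ R : H →L[ℂ] H, IsInvOneAdd A R := by
  have hd : Dense (A.domain : Set H) := hA.1.dense_domain
  let M : A.domain →ₗ[ℂ] H := A.domain.subtype + A.toFun
  have hM : ∀ x : A.domain, M x = (x : H) + A x := fun x => rfl
  have hinj : Function.Injective M := by
    rw [injective_iff_map_eq_zero]
    intro x hx
    have h := norm_le_norm_add hA x
    rw [← hM, hx, norm_zero] at h
    exact Subtype.ext (norm_le_zero_iff.1 h)
  have hclosed : IsClosed (LinearMap.range M : Set H) := by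
    refine IsSeqClosed.isClosed ?_
    intro y z hy hyz
    choose x hx using hy
    have hc : CauchySeq fun n => (x n : H) := by
      refine Metric.cauchySeq_iff.2 fun ε hε => ?_
      obtain ⟨N, hN⟩ := Metric.cauchySeq_iff.1 hyz.cauchySeq ε hε
      refine ⟨N, fun m hm n hn => lt_of_le_of_lt ?_ (hN m hm n hn)⟩
      rw [dist_eq_norm, dist_eq_norm, ← hx, ← hx, ← map_sub, hM]
      exact norm_le_norm_add hA (x m - x n)
    obtain ⟨w, hw⟩ := cauchySeq_tendsto_of_complete hc
    have hA' : Filter.Tendsto (fun n => A (x n)) Filter.atTop (nhds (z - w)) := by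
      refine (hyz.sub hw).congr fun n => ?_
      rw [← hx, hM, add_sub_cancel_left]
    have hg : (w, z - w) ∈ A.graph := by
      have : _root_.IsClosed (A.graph : Set (H × H)) := hA.1.isClosed
      exact this.mem_of_tendsto (hw.prodMk_nhds hA')
        (Filter.Eventually.of_forall fun n => A.mem_graph (x n))
    obtain ⟨v, hv1, hv2⟩ := (LinearPMap.mem_graph_iff A).1 hg
    refine ⟨v, ?_⟩
    rw [hM, hv2, hv1, add_sub_cancel]
  have hsurj : LinearMap.range M = ⊤ := by
    have : CompleteSpace (LinearMap.range M) := hclosed.completeSpace_coe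
    rw [← Submodule.orthogonal_eq_bot_iff, Submodule.eq_bot_iff]
    intro y hy
    have hy' : ∀ x : A.domain, ⟪-y, (x : H)⟫_ℂ = ⟪y, A x⟫_ℂ := by
      intro x
      have := (Submodule.mem_orthogonal' _ _).1 hy (M x) ⟨x, rfl⟩
      rw [hM, inner_add_right] at this
      rw [inner_neg_left]
      linear_combination -this
    have hmem : y ∈ A.adjoint.domain := LinearPMap.mem_adjoint_domain_of_exists y ⟨-y, hy'⟩
    have hval := LinearPMap.adjoint_apply_eq hd ⟨y, hmem⟩ hy'
    have key : ∀ B : H →ₗ.[ℂ] H, B = A → ∀ h : y ∈ B.domain, B ⟨y, h⟩ = -y → y = 0 := by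
      rintro B rfl h hB
      have h0 := hA.2 ⟨y, h⟩
      rw [hB, inner_neg_right, Complex.neg_re] at h0
      have h1 : (⟪y, y⟫_ℂ).re = ‖y‖ * ‖y‖ := inner_self_eq_norm_mul_norm (𝕜 := ℂ) y
      have h2 : ‖y‖ * ‖y‖ ≤ 0 := by rw [← h1]; linarith
      exact norm_eq_zero.1 (mul_self_eq_zero.1 (le_antisymm h2 (mul_self_nonneg _)))
    exact key _ hA.1 hmem hval
  let e : A.domain ≃ₗ[ℂ] H := LinearEquiv.ofBijective M ⟨hinj, LinearMap.range_eq_top.1 hsurj⟩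
  have he : ∀ y, (e.symm y : H) + A (e.symm y) = y := fun y => e.apply_symm_apply y
  refine ⟨LinearMap.mkContinuous (A.domain.subtype ∘ₗ e.symm.toLinearMap) 1 fun y => ?_,
    fun y => ⟨(e.symm y).2, he y⟩, fun x => ?_⟩
  · have := norm_le_norm_add hA (e.symm y)
    rw [he] at this
    simpa using this
  · exact congrArg Subtype.val (e.symm_apply_apply x)

open Classical in
/-- The bounded operator `(1 + A)⁻¹`, for `A` nonnegative and self-adjoint. -/
def invOneAdd (A : H →ₗ.[ℂ] H) : H →L[ℂ] H :=
  if h : ∃ R : H →L[ℂ] H, IsInvOneAdd A R then h.choose else 0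

/-- The power `A ^ p` (for `p > 0`) of a nonnegative self-adjoint operator `A`, in the sense of the
functional calculus. With `r = (1 + a)⁻¹ ∈ [0, 1]`, one has
`(1 + a ^ p)⁻¹ = r ^ p / (r ^ p + (1 - r) ^ p)`, a continuous function of `r ∈ [0, 1]`. Hence
`A ^ p = T⁻¹ - 1`, where `T` is obtained by applying this function to `(1 + A)⁻¹` in the continuous
functional calculus of bounded self-adjoint operators. -/
def rpow (A : H →ₗ.[ℂ] H) (p : ℝ) : H →ₗ.[ℂ] H :=
  (((cfc (fun r : ℝ => r ^ p / (r ^ p + (1 - r) ^ p)) (invOneAdd A) : H →L[ℂ] H) :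
      H →ₗ[ℂ] H).toPMap ⊤).inverse - LinearMap.id.toPMap ⊤

/-! ### Absolute value, positive and negative part of a self-adjoint operator -/

/-- The square `X ∘ X` on its natural domain `{x ∈ dom X | X x ∈ dom X}`. -/
def square (X : H →ₗ.[ℂ] H) : H →ₗ.[ℂ] H where
  domain := (X.domain.comap X.toFun).map X.domain.subtype
  toFun :=
    { toFun := fun x =>
        X ⟨X ⟨(x : H), by obtain ⟨y, -, hy⟩ := x.2; exact hy ▸ y.2⟩, by
          obtain ⟨y, hy, hyx⟩ := x.2
          have : (⟨(x : H), hyx ▸ y.2⟩ : X.domain) = y := Subtype.ext hyx.symm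
          rw [this]; exact hy⟩
      map_add' := fun x y => by
        rw [← LinearPMap.map_add]
        congr 1
        apply Subtype.ext
        simp only [Submodule.coe_add]
        rw [← LinearPMap.map_add]
        rfl
      map_smul' := fun c x => by
        rw [RingHom.id_apply, ← LinearPMap.map_smul]
        congr 1
        apply Subtype.ext
        simp only [Submodule.coe_smul]
        rw [← LinearPMap.map_smul]
        rfl }

/-- The absolute value `|X| = (X ^ 2) ^ (1 / 2)` of a self-adjoint operator. -/
def absOp (X : H →ₗ.[ℂ] H) : H →ₗ.[ℂ] H := rpow (square X) (1 / 2)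

/-- The positive part `X₊ = (|X| + X) / 2` of a self-adjoint operator. The expression on the right
has domain `dom X`; the self-adjoint operator `X₊` is its closure. -/
def positivePart (X : H →ₗ.[ℂ] H) : H →ₗ.[ℂ] H := ((1 / 2 : ℂ) • (absOp X + X)).closure

/-- The negative part `X₋ = (|X| - X) / 2 = (-X)₊` of a self-adjoint operator. -/
def negativePart (X : H →ₗ.[ℂ] H) : H →ₗ.[ℂ] H := positivePart (-X)

/-! ### Trace class operators and the trace -/

variable (H) in
/-- The index set of a fixed orthonormal basis of `H`. -/
def basisIndex : Set H := (exists_hilbertBasis ℂ H).choose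

variable (H) in
/-- A fixed orthonormal basis of `H`. The notions defined with its help do not depend on it. -/
def basis : HilbertBasis (basisIndex H) ℂ H := (exists_hilbertBasis ℂ H).choose_spec.choose

/-- A bounded operator `T` is trace class if `∑ ⟨e, |T| e⟩ < ∞` for an orthonormal basis. -/
def IsTraceClassBounded (T : H →L[ℂ] H) : Prop :=
  Summable fun i => (⟪basis H i, CFC.abs T (basis H i)⟫_ℂ).re

/-- The trace `∑ ⟨e, T e⟩` of a bounded operator. -/
def traceBounded (T : H →L[ℂ] H) : ℂ := ∑' i, ⟪basis H i, T (basis H i)⟫_ℂ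

/-- A partially defined operator is trace class if it is (defined everywhere and equal to) a bounded
trace class operator. -/
def IsTraceClass (T : H →ₗ.[ℂ] H) : Prop :=
  ∃ S : H →L[ℂ] H, T = (S : H →ₗ[ℂ] H).toPMap ⊤ ∧ IsTraceClassBounded S

open Classical in
/-- The trace of a trace class operator, as a partially defined operator (`0` if it is not trace
class). -/
def trace (T : H →ₗ.[ℂ] H) : ℂ :=
  if h : IsTraceClass T then traceBounded h.choose else 0

/-! ### Quadratic forms of self-adjoint operators -/

open Classical in
/-- The quadratic form `u ↦ ‖A ^ (1 / 2) u‖ ^ 2` of a nonnegative self-adjoint operator `A`, with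
the value `∞` outside of the form domain `dom (A ^ (1 / 2))`. -/
def form (A : H →ₗ.[ℂ] H) (u : H) : ℝ≥0∞ :=
  if h : u ∈ (rpow A (1 / 2)).domain then ‖rpow A (1 / 2) ⟨u, h⟩‖ₑ ^ 2 else ∞

/-- The form domain `dom (A ^ (1 / 2))` of a nonnegative self-adjoint operator. -/
def formDomain (A : H →ₗ.[ℂ] H) : Submodule ℂ H := (rpow A (1 / 2)).domain

/-- A subspace `V` is a form core of the self-adjoint operator `X` (of any sign) if it is contained
in the form domain `dom (|X| ^ (1 / 2))` and dense in it for the form norm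
`(‖u‖ ^ 2 + ‖|X| ^ (1 / 2) u‖ ^ 2) ^ (1 / 2)`. -/
def IsFormCore (X : H →ₗ.[ℂ] H) (V : Submodule ℂ H) : Prop :=
  V ≤ formDomain (absOp X) ∧
    ∀ u ∈ formDomain (absOp X), ∀ ε : ℝ≥0∞, 0 < ε →
      ∃ v ∈ V, ‖u - v‖ₑ ^ 2 + form (absOp X) (u - v) < ε

/-- The self-adjoint operator `X` is the difference `B - A` of two nonnegative self-adjoint
operators in the sense of quadratic forms: the common form domain of `A` and `B` is a form core of
`X`, and there the form of `X`, which is the form of `X₊` minus the form of `X₋`, equals the form of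
`B` minus the form of `A`. (All terms are finite, and the equation is written without
subtractions.) If `A` and `B` are bounded, this says that `X = B - A`. -/
def IsFormDifference (X B A : H →ₗ.[ℂ] H) : Prop :=
  IsSelfAdjoint X ∧ IsFormCore X (formDomain A ⊓ formDomain B) ∧
    ∀ u ∈ formDomain A ⊓ formDomain B,
      form (positivePart X) u + form A u = form (negativePart X) u + form B u

end UnboundedOperator

end

open scoped ENNReal InnerProductSpace
open MeasureTheory Filter Topology

noncomputable section

namespace UnboundedOperator

universe u

set_option linter.unusedSectionVars false

variable {H : Type u} [NormedAddCommGroup H] [InnerProductSpace ℂ H] [CompleteSpace H]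

/-! Put s = 1/p and Y = (B^p - A^p)₊. Discarding the negative part gives B^p ≤ A^p + Y as forms. The
core of the proof is a statement about such pairs, written A', B' for A^p, B^p: if B' ≤ A' + Y and
Y^s has finite trace, then B'^s ≤ A'^s + K for some K ≥ 0 with tr K ≤ tr Y^s
(`exists_etrace_le_of_le_one`). For s = 1 one takes K = Y.

For 0 < s < 1 the tool is c t^s = ∫₀^∞ l^(s-1) t/(l+t) dl, where t/(l+t) = 1 - l/(l+t). It turns
B'^s - A'^s into an integral of l^s ((A'+l)⁻¹ - (B'+l)⁻¹). Let V = √Y, G = (A'+l)⁻¹ and W = VGV.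
Resolvents reverse the order of forms, so this difference is at most D_l = G - (A'+V²+l)⁻¹ =
GV(1+W)⁻¹VG (`IsRes.le_resolvAt`), and K = c⁻¹ ∫ l^s D_l dl does the job. For the trace, cyclicity
and l G² ≤ G give l tr D_l ≤ tr(1-(1+W)⁻¹). Since W ≤ Y/l, this is at most tr Y/(l+Y)
(`IsRes.etrace_resDiff_le`). Integrating against l^(s-1) returns tr Y^s by the same formula
(`exists_etrace_le`).

It remains to pass from B ≤ A + K to a self-adjoint X = B - A. On a form core x₊ ≤ x₋ + k, hence on
the whole form domain of |X| (`IsTransform.form_le_of_isFormCore`). Testing with vectors cut off to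
the positive spectral subspace kills x₋. Compression by the cutoff does not increase tr K, and
removing the cutoff by monotone convergence gives tr X₊ ≤ tr K
(`IsTransform.tsum_form_positivePart_le`); the same test shows that X₊ is bounded.

Unbounded operators enter only through bounded ones. A nonnegative A is encoded by R = (1+A)⁻¹, and
the form of A^q is the integral of ((1-r)/r)^q against the spectral measure of R
(`IsRes.form_rpow`). A self-adjoint X is encoded by F = X(1+|X|)⁻¹ (`exists_isTransform`). -/

/-! ### Spectral measures of bounded self-adjoint operators -/

theorem isSelfAdjoint_cfc (f : ℝ → ℝ) (T : H →L[ℂ] H) : IsSelfAdjoint (cfc f T) :=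
  cfc_predicate f T

theorem inner_cfc_left (f : ℝ → ℝ) (T : H →L[ℂ] H) (u v : H) :
    ⟪cfc f T u, v⟫_ℂ = ⟪u, cfc f T v⟫_ℂ :=
  (isSelfAdjoint_cfc f T).isSymmetric u v

theorem norm_cfc_apply_sq {T : H →L[ℂ] H} {f : ℝ → ℝ}
    (hf : ContinuousOn f (spectrum ℝ T)) (u : H) :
    ‖cfc f T u‖ ^ 2 = (⟪u, cfc (fun x => f x ^ 2) T u⟫_ℂ).re := by
  have h : cfc (fun x => f x ^ 2) T = cfc f T * cfc f T := by
    rw [← cfc_mul f f T hf hf]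
    simp only [sq]
  rw [h, mul_apply_eq_comp, ← inner_cfc_left]
  exact (inner_self_eq_norm_sq (𝕜 := ℂ) _).symm

theorem re_inner_cfc_nonneg {T : H →L[ℂ] H} {f : ℝ → ℝ}
    (h0 : ∀ x ∈ spectrum ℝ T, 0 ≤ f x) (u : H) : 0 ≤ (⟪u, cfc f T u⟫_ℂ).re := by
  have h : (0 : H →L[ℂ] H) ≤ cfc f T := cfc_nonneg h0
  exact ((ContinuousLinearMap.nonneg_iff_isPositive _).1 h).re_inner_nonneg_right u

/-- The functional f ↦ ⟨u, f(T)u⟩ on C(σ(T)) is positive, so the Riesz–Markov theorem represents it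
by a measure on the compact spectrum, which is then pushed forward to ℝ. -/
theorem exists_specMeasure {T : H →L[ℂ] H} (hT : IsSelfAdjoint T) (u : H) :
    ∃ μ : Measure ℝ, IsFiniteMeasure μ ∧ μ (spectrum ℝ T)ᶜ = 0 ∧
      ∀ f : ℝ → ℝ, ContinuousOn f (spectrum ℝ T) → ∫ x, f x ∂μ = (⟪u, cfc f T u⟫_ℂ).re := by
  have hK : IsCompact (spectrum ℝ T) := ContinuousFunctionalCalculus.isCompact_spectrum T
  have : CompactSpace (spectrum ℝ T) := isCompact_iff_compactSpace.1 hK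
  let Λ₀ : CompactlySupportedContinuousMap (spectrum ℝ T) ℝ →ₗ[ℝ] ℝ :=
    { toFun := fun f => (⟪u, cfcHom (R := ℝ) hT f.toContinuousMap u⟫_ℂ).re
      map_add' := fun f g => by
        have : (f + g).toContinuousMap = f.toContinuousMap + g.toContinuousMap := rfl
        rw [this, map_add, add_apply, inner_add_right, Complex.add_re]
      map_smul' := fun c f => by
        have : (c • f).toContinuousMap = c • f.toContinuousMap := rfl
        rw [this, map_smul, smul_apply, RCLike.real_smul_eq_coe_smul (K := ℂ), inner_smul_right]
        simp }
  let Λ : CompactlySupportedContinuousMap (spectrum ℝ T) ℝ →ₚ[ℝ] ℝ :=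
    PositiveLinearMap.mk₀ Λ₀ fun f hf => by
      have h : (0 : H →L[ℂ] H) ≤ cfcHom (R := ℝ) hT f.toContinuousMap := by
        apply cfcHom_nonneg_iff hT |>.2
        exact hf
      exact ((ContinuousLinearMap.nonneg_iff_isPositive _).1 h).re_inner_nonneg_right u
  let ν := RealRMK.rieszMeasure Λ
  have hν : ∀ f : C(spectrum ℝ T, ℝ), ∫ x, f x ∂ν = (⟪u, cfcHom (R := ℝ) hT f u⟫_ℂ).re := fun f =>
    RealRMK.integral_rieszMeasure Λ (CompactlySupportedContinuousMap.continuousMapEquiv f)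
  have hms : MeasurableSet (spectrum ℝ T) := hK.isClosed.measurableSet
  have hemb := MeasurableEmbedding.subtype_coe hms
  refine ⟨ν.map Subtype.val, inferInstance, ?_, fun f hf => ?_⟩
  · rw [hemb.map_apply]
    simp
  · rw [hemb.integral_map, cfc_apply f T hT hf]
    exact hν ⟨_, hf.domRestrict⟩

open Classical in
/-- The spectral measure of a bounded self-adjoint operator `T` with respect to the vector `u`. -/
def specMeasure (T : H →L[ℂ] H) (u : H) : Measure ℝ :=
  if h : IsSelfAdjoint T then (exists_specMeasure h u).choose else 0

instance isFiniteMeasure_specMeasure (T : H →L[ℂ] H) (u : H) :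
    IsFiniteMeasure (specMeasure T u) := by
  rw [specMeasure]
  split_ifs with h
  · exact (exists_specMeasure h u).choose_spec.1
  · infer_instance

section

variable {T : H →L[ℂ] H}

theorem ae_mem_spectrum (hT : IsSelfAdjoint T) (u : H) :
    ∀ᵐ x ∂(specMeasure T u), x ∈ spectrum ℝ T := by
  rw [specMeasure, dif_pos hT]
  exact (exists_specMeasure hT u).choose_spec.2.1

theorem integral_specMeasure (hT : IsSelfAdjoint T) {f : ℝ → ℝ}
    (hf : ContinuousOn f (spectrum ℝ T)) (u : H) :
    ∫ x, f x ∂(specMeasure T u) = (⟪u, cfc f T u⟫_ℂ).re := by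
  rw [specMeasure, dif_pos hT]
  exact (exists_specMeasure hT u).choose_spec.2.2 f hf

theorem measurableSet_spectrum (T : H →L[ℂ] H) : MeasurableSet (spectrum ℝ T) :=
  (ContinuousFunctionalCalculus.isCompact_spectrum (R := ℝ) (p := IsSelfAdjoint) T).isClosed.measurableSet

theorem restrict_specMeasure (hT : IsSelfAdjoint T) (u : H) :
    (specMeasure T u).restrict (spectrum ℝ T) = specMeasure T u :=
  Measure.restrict_eq_self_of_ae_mem (ae_mem_spectrum hT u)

theorem aemeasurable_specMeasure (hT : IsSelfAdjoint T) {f : ℝ → ℝ}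
    (hf : ContinuousOn f (spectrum ℝ T)) (u : H) : AEMeasurable f (specMeasure T u) := by
  rw [← restrict_specMeasure hT u]
  exact hf.aemeasurable (measurableSet_spectrum T)

theorem integrable_specMeasure (hT : IsSelfAdjoint T) {f : ℝ → ℝ}
    (hf : ContinuousOn f (spectrum ℝ T)) (u : H) : Integrable f (specMeasure T u) := by
  rw [← restrict_specMeasure hT u]
  exact hf.integrableOn_compact (ContinuousFunctionalCalculus.isCompact_spectrum T)

theorem lintegral_specMeasure (hT : IsSelfAdjoint T) {f : ℝ → ℝ}
    (hf : ContinuousOn f (spectrum ℝ T)) (h0 : ∀ x ∈ spectrum ℝ T, 0 ≤ f x) (u : H) :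
    ∫⁻ x, ENNReal.ofReal (f x) ∂(specMeasure T u) = ENNReal.ofReal (⟪u, cfc f T u⟫_ℂ).re := by
  rw [← integral_specMeasure hT hf u, ofReal_integral_eq_lintegral_ofReal
    (integrable_specMeasure hT hf u)]
  filter_upwards [ae_mem_spectrum hT u] with x hx using h0 x hx

theorem lintegral_specMeasure_sq (hT : IsSelfAdjoint T) {f : ℝ → ℝ}
    (hf : ContinuousOn f (spectrum ℝ T)) (u : H) :
    ∫⁻ x, ENNReal.ofReal (f x ^ 2) ∂(specMeasure T u) = ‖cfc f T u‖ₑ ^ 2 := by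
  rw [lintegral_specMeasure hT (f := fun x => f x ^ 2) (hf.pow 2) (fun x _ => sq_nonneg _), ← norm_cfc_apply_sq hf,
    ENNReal.ofReal_pow (norm_nonneg _), ofReal_norm]

theorem specMeasure_eq_of_integral (hT : IsSelfAdjoint T) (u : H) {μ : Measure ℝ}
    [IsFiniteMeasure μ] (h : ∀ f : ℝ → ℝ, Continuous f → (⟪u, cfc f T u⟫_ℂ).re = ∫ x, f x ∂μ) :
    specMeasure T u = μ := by
  refine ext_of_forall_integral_eq_of_IsFiniteMeasure fun f => ?_
  rw [integral_specMeasure hT f.continuous.continuousOn, h _ f.continuous]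

/-- The spectral measure of `f(T)` is the push-forward of the spectral measure of `T`. -/
theorem specMeasure_cfc (hT : IsSelfAdjoint T) {f : ℝ → ℝ}
    (hf : ContinuousOn f (spectrum ℝ T)) (u : H) :
    specMeasure (cfc f T) u = (specMeasure T u).map f := by
  refine specMeasure_eq_of_integral (isSelfAdjoint_cfc f T) u fun h hh => ?_
  rw [integral_map (aemeasurable_specMeasure hT hf u) hh.aestronglyMeasurable,
    integral_specMeasure hT (f := fun x => h (f x)) (hh.comp_continuousOn hf), cfc_comp' h f T hh.continuousOn hf hT]

theorem lintegral_specMeasure_cfc (hT : IsSelfAdjoint T) {f : ℝ → ℝ}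
    (hf : ContinuousOn f (spectrum ℝ T)) (u : H) {h : ℝ → ℝ≥0∞} (hh : Measurable h) :
    ∫⁻ x, h x ∂(specMeasure (cfc f T) u) = ∫⁻ x, h (f x) ∂(specMeasure T u) := by
  rw [specMeasure_cfc hT hf, lintegral_map' hh.aemeasurable (aemeasurable_specMeasure hT hf u)]

/-- The spectral measure with respect to `f(T) u` has density `f ^ 2`. -/
theorem specMeasure_cfc_apply (hT : IsSelfAdjoint T) {f : ℝ → ℝ}
    (hf : ContinuousOn f (spectrum ℝ T)) (u : H) :
    specMeasure T (cfc f T u) = (specMeasure T u).withDensity fun x => ENNReal.ofReal (f x ^ 2) := by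
  have hi := integrable_specMeasure hT (f := fun x => f x ^ 2) (hf.pow 2) u
  have : IsFiniteMeasure ((specMeasure T u).withDensity fun x => ENNReal.ofReal (f x ^ 2)) :=
    isFiniteMeasure_withDensity_ofReal hi.2
  refine specMeasure_eq_of_integral hT _ fun h hh => ?_
  have hm : AEMeasurable (fun x => ENNReal.ofReal (f x ^ 2)) (specMeasure T u) :=
    hi.1.aemeasurable.ennreal_ofReal
  rw [integral_withDensity_eq_integral_toReal_smul₀ hm
    (Eventually.of_forall fun _ => ENNReal.ofReal_lt_top)]
  have hc := cfc_commute_cfc h f T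
  have : ⟪cfc f T u, cfc h T (cfc f T u)⟫_ℂ = ⟪u, cfc (fun x => f x ^ 2 * h x) T u⟫_ℂ := by
    have e : cfc (fun x => f x ^ 2 * h x) T = cfc f T * cfc h T * cfc f T := by
      rw [← cfc_mul f h T hf hh.continuousOn, ← cfc_mul (fun x => f x * h x) f T (hf.mul hh.continuousOn) hf]
      congr 1; ext x; ring
    rw [inner_cfc_left, e]
    rfl
  rw [this, ← integral_specMeasure hT (f := fun x => f x ^ 2 * h x) ((hf.pow 2).mul hh.continuousOn)]
  refine integral_congr_ae (Eventually.of_forall fun x => ?_)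
  simp only [smul_eq_mul]
  rw [ENNReal.toReal_ofReal (sq_nonneg _)]

theorem lintegral_specMeasure_cfc_apply (hT : IsSelfAdjoint T) {f : ℝ → ℝ}
    (hf : ContinuousOn f (spectrum ℝ T)) (u : H) {h : ℝ → ℝ≥0∞} (hh : Measurable h) :
    ∫⁻ x, h x ∂(specMeasure T (cfc f T u)) =
      ∫⁻ x, ENNReal.ofReal (f x ^ 2) * h x ∂(specMeasure T u) := by
  rw [specMeasure_cfc_apply hT hf, lintegral_withDensity_eq_lintegral_mul₀
    ((aemeasurable_specMeasure hT hf u).pow_const 2).ennreal_ofReal hh.aemeasurable]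
  rfl

theorem specMeasure_univ (hT : IsSelfAdjoint T) (u : H) :
    specMeasure T u Set.univ = ‖u‖ₑ ^ 2 := by
  have := lintegral_specMeasure_sq hT (f := fun _ => 1) continuousOn_const u
  rw [cfc_const_one ℝ T hT] at this
  simpa using this

theorem norm_cfc_apply_le {f : ℝ → ℝ} {c : ℝ} (hc : 0 ≤ c)
    (h : ∀ x ∈ spectrum ℝ T, |f x| ≤ c) (u : H) : ‖cfc f T u‖ ≤ c * ‖u‖ :=
  (cfc f T).le_of_opNorm_le (norm_cfc_le hc fun x hx => by simpa using h x hx) u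

theorem dense_range_of_injective (hT : IsSelfAdjoint T) (hi : Function.Injective T) :
    DenseRange T := by
  have h1 := ContinuousLinearMap.orthogonal_range T
  have h2 : ContinuousLinearMap.adjoint T = T := hT
  rw [h2, LinearMap.ker_eq_bot.2 hi] at h1
  exact Submodule.dense_iff_topologicalClosure_eq_top.2
    ((Submodule.topologicalClosure_eq_top_iff).2 h1)

/-- The operators (1+n|T|)⁻¹ are contractions and send T y to a vector of norm at most ‖y‖/n. Since
the range of an injective self-adjoint operator is dense, they tend strongly to 0. The function
(1+n|x|)⁻¹ equals 1 at x = 0, so the mass of {0} is bounded by the squared norms of vectors tending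
to 0. -/
theorem ae_ne_zero_of_injective (hT : IsSelfAdjoint T) (hi : Function.Injective T) (u : H) :
    ∀ᵐ x ∂(specMeasure T u), x ≠ 0 := by
  have hcont : ∀ n : ℕ, Continuous fun x : ℝ => (1 + n * |x|)⁻¹ := fun n => by
    refine Continuous.inv₀ (by fun_prop) fun x => ?_
    positivity
  have key : ∀ (n : ℕ), specMeasure T u {0} ≤ ‖cfc (fun x : ℝ => (1 + n * |x|)⁻¹) T u‖ₑ ^ 2 := by
    intro n
    rw [← lintegral_specMeasure_sq hT (hcont n).continuousOn]
    calc specMeasure T u {0} = ∫⁻ x in {0}, 1 ∂(specMeasure T u) := by simp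
      _ ≤ ∫⁻ x in {0}, ENNReal.ofReal ((1 + n * |x|)⁻¹ ^ 2) ∂(specMeasure T u) := by
        refine setLIntegral_mono' (measurableSet_singleton 0) fun x hx => ?_
        rw [Set.mem_singleton_iff.1 hx]
        simp
      _ ≤ _ := setLIntegral_le_lintegral _ _
  have key2 : Tendsto (fun n : ℕ => cfc (fun x : ℝ => (1 + n * |x|)⁻¹) T u) atTop (𝓝 0) := by
    rw [tendsto_zero_iff_norm_tendsto_zero, Metric.tendsto_atTop]
    intro ε hε
    obtain ⟨y, hy⟩ := (dense_range_of_injective hT hi).exists_dist_lt u (half_pos hε)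
    obtain ⟨N, hN⟩ := exists_nat_gt (2 * ‖y‖ / ε)
    refine ⟨N + 1, fun n hn => ?_⟩
    have hn0 : (0 : ℝ) < n := by exact_mod_cast (by omega : 0 < n)
    rw [dist_zero_right, norm_norm]
    have h1 : ‖cfc (fun x : ℝ => (1 + n * |x|)⁻¹) T (u - T y)‖ ≤ 1 * ‖u - T y‖ := by
      refine norm_cfc_apply_le zero_le_one (fun x _ => ?_) _
      rw [abs_of_pos (by positivity)]
      exact inv_le_one_of_one_le₀ (le_add_of_nonneg_right (by positivity))
    have h2 : ‖cfc (fun x : ℝ => (1 + n * |x|)⁻¹) T (T y)‖ ≤ (n : ℝ)⁻¹ * ‖y‖ := by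
      have e : cfc (fun x : ℝ => (1 + n * |x|)⁻¹) T * T =
          cfc (fun x : ℝ => (1 + n * |x|)⁻¹ * x) T := by
        rw [cfc_mul _ (fun x => x) T (hcont n).continuousOn continuousOn_id, cfc_id' ℝ T hT]
      change ‖(cfc (fun x : ℝ => (1 + n * |x|)⁻¹) T * T) y‖ ≤ _
      rw [e]
      refine norm_cfc_apply_le (by positivity) (fun x _ => ?_) _
      rw [abs_mul, abs_of_pos (by positivity), inv_mul_le_iff₀ (by positivity)]
      have : (1 + n * |x|) * (n : ℝ)⁻¹ = (n : ℝ)⁻¹ + |x| := by field_simp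
      rw [this]
      exact le_add_of_nonneg_left (by positivity)
    have h3 : (n : ℝ)⁻¹ * ‖y‖ < ε / 2 := by
      rw [inv_mul_lt_iff₀ hn0]
      have : 2 * ‖y‖ / ε < n := hN.trans (by exact_mod_cast hn)
      rw [div_lt_iff₀ hε] at this
      linarith
    have h4 : ‖u - T y‖ < ε / 2 := by rwa [← dist_eq_norm]
    calc ‖cfc (fun x : ℝ => (1 + n * |x|)⁻¹) T u‖
        = ‖cfc (fun x : ℝ => (1 + n * |x|)⁻¹) T (u - T y) +
            cfc (fun x : ℝ => (1 + n * |x|)⁻¹) T (T y)‖ := by rw [← map_add, sub_add_cancel]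
      _ ≤ _ := norm_add_le _ _
      _ < ε := by linarith
  have key3 : Tendsto (fun n : ℕ => ‖cfc (fun x : ℝ => (1 + n * |x|)⁻¹) T u‖ₑ ^ 2) atTop (𝓝 0) := by
    have := ((ENNReal.continuous_pow 2).comp continuous_enorm).tendsto (0 : H) |>.comp key2
    simpa using! this
  rw [ae_iff]
  simp only [not_not, Set.ofPred_eq_eq_singleton]
  exact le_antisymm (ge_of_tendsto' key3 key) zero_le

theorem ae_cfc_ne_zero (hT : IsSelfAdjoint T) {f : ℝ → ℝ} (hf : ContinuousOn f (spectrum ℝ T))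
    (hi : Function.Injective (cfc f T : H →L[ℂ] H)) (u : H) : ∀ᵐ x ∂(specMeasure T u), f x ≠ 0 := by
  have h := ae_ne_zero_of_injective (isSelfAdjoint_cfc f T) hi u
  rw [specMeasure_cfc hT hf] at h
  exact ae_of_ae_map (aemeasurable_specMeasure hT hf u) h

end

/-! ### Nonnegative self-adjoint operators and their resolvents -/

/-- The operator `S⁻¹ - 1`, defined on the range of `S`. -/
def op (S : H →L[ℂ] H) : H →ₗ.[ℂ] H :=
  ((S : H →ₗ[ℂ] H).toPMap ⊤).inverse - LinearMap.id.toPMap ⊤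

/-- `S` is a nonnegative injective contraction, that is, `S = (1 + A)⁻¹` for some nonnegative
self-adjoint operator `A`. -/
structure IsRes (S : H →L[ℂ] H) : Prop where
  nonneg : 0 ≤ S
  le_one : S ≤ 1
  injective : Function.Injective S

theorem rpow_eq_op (A : H →ₗ.[ℂ] H) (p : ℝ) :
    rpow A p = op (cfc (fun r : ℝ => r ^ p / (r ^ p + (1 - r) ^ p)) (invOneAdd A)) := rfl

section

variable {S T : H →L[ℂ] H}

theorem IsRes.isSelfAdjoint (hS : IsRes S) : IsSelfAdjoint S :=
  ((ContinuousLinearMap.nonneg_iff_isPositive S).1 hS.nonneg).isSelfAdjoint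

theorem IsRes.spectrum_subset (hS : IsRes S) : spectrum ℝ S ⊆ Set.Icc 0 1 := by
  intro x hx
  refine ⟨spectrum_nonneg_of_nonneg hS.nonneg hx, ?_⟩
  have := (le_algebraMap_iff_spectrum_le (r := (1 : ℝ)) (a := S) hS.isSelfAdjoint).1
    (by simpa using hS.le_one)
  exact this x hx

theorem mem_op_domain {u : H} :
    u ∈ (op S).domain ↔ ∃ v, S v = u := by
  rw [op, LinearPMap.sub_domain, LinearPMap.inverse_domain]
  constructor
  · rintro ⟨⟨v, hv⟩, -⟩
    exact ⟨v, hv⟩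
  · rintro ⟨v, hv⟩
    exact ⟨⟨⟨v, trivial⟩, hv⟩, trivial⟩

theorem op_apply (hS : Function.Injective S) (v : H) (h : S v ∈ (op S).domain) :
    op S ⟨S v, h⟩ = v - S v := by
  have hk : LinearMap.ker ((S : H →ₗ[ℂ] H).toPMap ⊤).toFun = ⊥ := by
    rw [LinearMap.ker_eq_bot]
    intro x y h
    exact Subtype.ext (hS h)
  have h' : S v ∈ ((S : H →ₗ[ℂ] H).toPMap ⊤).inverse.domain := by
    rw [op, LinearPMap.sub_domain] at h
    exact h.1
  have := LinearPMap.inverse_apply_eq hk (y := ⟨S v, h'⟩)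
    (x := (⟨v, trivial⟩ : ((S : H →ₗ[ℂ] H).toPMap ⊤).domain)) rfl
  simp only [op, LinearPMap.sub_apply]
  rw [this]
  rfl

theorem eq_op (hS : Function.Injective S) {A : H →ₗ.[ℂ] H}
    (h1 : ∀ v, ∃ h : S v ∈ A.domain, A ⟨S v, h⟩ = v - S v)
    (h2 : ∀ x ∈ A.domain, ∃ v, S v = x) : A = op S := by
  refine LinearPMap.ext (Submodule.ext fun x => ?_) ?_
  · rw [mem_op_domain]
    refine ⟨h2 x, ?_⟩
    rintro ⟨v, rfl⟩
    exact (h1 v).1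
  · intro x hx hx'
    obtain ⟨v, rfl⟩ := h2 x hx
    rw [op_apply hS]
    exact (h1 v).2

theorem isInvOneAdd_op (hS : Function.Injective S) : IsInvOneAdd (op S) S := by
  refine ⟨fun y => ⟨mem_op_domain.2 ⟨y, rfl⟩, ?_⟩, fun x => ?_⟩
  · rw [op_apply hS, add_sub_cancel]
  · obtain ⟨x, hx⟩ := x
    obtain ⟨v, rfl⟩ := mem_op_domain.1 hx
    rw [op_apply hS, add_sub_cancel]

theorem IsInvOneAdd.unique {A : H →ₗ.[ℂ] H} (hS : IsInvOneAdd A S) (hT : IsInvOneAdd A T) :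
    S = T := by
  ext y
  obtain ⟨h, hy⟩ := hS.1 y
  have := hT.2 ⟨S y, h⟩
  rw [hy] at this
  exact this.symm

theorem IsInvOneAdd.invOneAdd_eq {A : H →ₗ.[ℂ] H} (hS : IsInvOneAdd A S) : invOneAdd A = S := by
  have h : ∃ R : H →L[ℂ] H, IsInvOneAdd A R := ⟨S, hS⟩
  rw [invOneAdd, dif_pos h]
  exact h.choose_spec.unique hS

theorem IsInvOneAdd.injective {A : H →ₗ.[ℂ] H} (hS : IsInvOneAdd A S) :
    Function.Injective S := by
  rw [injective_iff_map_eq_zero]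
  intro y hy
  obtain ⟨h, hy'⟩ := hS.1 y
  have : (⟨S y, h⟩ : A.domain) = 0 := Subtype.ext hy
  rw [this, hy, LinearPMap.map_zero, add_zero] at hy'
  exact hy'.symm

theorem IsInvOneAdd.eq_op {A : H →ₗ.[ℂ] H} (hS : IsInvOneAdd A S) : A = op S := by
  refine UnboundedOperator.eq_op hS.injective (fun v => ?_) fun x hx => ⟨_, hS.2 ⟨x, hx⟩⟩
  obtain ⟨h, hv⟩ := hS.1 v
  exact ⟨h, by rw [eq_sub_iff_add_eq']; exact hv⟩

theorem invOneAdd_op (hS : Function.Injective S) : invOneAdd (op S) = S :=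
  (isInvOneAdd_op hS).invOneAdd_eq

/-- A symmetric nonnegative operator `A` for which `1 + A` is invertible has a resolvent between
`0` and `1`. -/
theorem IsInvOneAdd.isRes {A : H →ₗ.[ℂ] H} (hS : IsInvOneAdd A S)
    (hsymm : ∀ x y : A.domain, ⟪A x, (y : H)⟫_ℂ = ⟪(x : H), A y⟫_ℂ)
    (hnn : ∀ x : A.domain, 0 ≤ (⟪(x : H), A x⟫_ℂ).re) : IsRes S := by
  have key : ∀ v, ∃ h : S v ∈ A.domain, S v + A ⟨S v, h⟩ = v := hS.1
  have hsym : ∀ v w, ⟪S v, w⟫_ℂ = ⟪v, S w⟫_ℂ := fun v w => by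
    obtain ⟨hv, hv'⟩ := key v
    obtain ⟨hw, hw'⟩ := key w
    calc ⟪S v, w⟫_ℂ = ⟪S v, S w + A ⟨S w, hw⟩⟫_ℂ := by rw [hw']
      _ = ⟪S v + A ⟨S v, hv⟩, S w⟫_ℂ := by
        rw [inner_add_right, inner_add_left, hsymm ⟨S v, hv⟩ ⟨S w, hw⟩]
      _ = _ := by rw [hv']
  have hsa : IsSelfAdjoint S := by
    rw [ContinuousLinearMap.isSelfAdjoint_iff_isSymmetric]
    exact hsym
  have hre : ∀ v, (⟪S v, S v⟫_ℂ).re ≤ (⟪S v, v⟫_ℂ).re := fun v => by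
    obtain ⟨hv, hv'⟩ := key v
    have h0 := hnn ⟨S v, hv⟩
    have h1 : (⟪S v, v⟫_ℂ).re = (⟪S v, S v + A ⟨S v, hv⟩⟫_ℂ).re := by rw [hv']
    rw [h1, inner_add_right, Complex.add_re]
    exact le_add_of_nonneg_right h0
  have hn : ∀ v, (⟪S v, S v⟫_ℂ).re = ‖S v‖ ^ 2 := fun v => inner_self_eq_norm_sq (𝕜 := ℂ) _
  refine ⟨?_, ?_, hS.injective⟩
  · rw [ContinuousLinearMap.nonneg_iff_isPositive, ContinuousLinearMap.isPositive_def']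
    refine ⟨hsa, fun v => ?_⟩
    rw [ContinuousLinearMap.reApplyInnerSelf_apply]
    exact (sq_nonneg _).trans ((hn v).symm.le.trans (hre v))
  · rw [ContinuousLinearMap.le_def, ContinuousLinearMap.isPositive_def']
    refine ⟨(IsSelfAdjoint.one _).sub hsa, fun v => ?_⟩
    rw [ContinuousLinearMap.reApplyInnerSelf_apply]
    have h1 : ‖S v‖ ≤ ‖v‖ := by
      have := (hn v).symm.le.trans ((hre v).trans (re_inner_le_norm (𝕜 := ℂ) (S v) v))
      nlinarith [norm_nonneg (S v), norm_nonneg v]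
    have h2 : (⟪S v, v⟫_ℂ).re ≤ ‖v‖ ^ 2 := by
      have := re_inner_le_norm (𝕜 := ℂ) (S v) v
      refine this.trans ?_
      rw [sq]
      exact mul_le_mul_of_nonneg_right h1 (norm_nonneg _)
    have h3 : (⟪v, v⟫_ℂ).re = ‖v‖ ^ 2 := inner_self_eq_norm_sq (𝕜 := ℂ) _
    change 0 ≤ (⟪v - S v, v⟫_ℂ).re
    rw [inner_sub_left, Complex.sub_re]
    linarith

/-- Symmetry and density of the range of S put the operator below its adjoint. Conversely, pairing a
vector y of the adjoint domain with the range of S gives S(y + A*y) = y, so y lies in that range.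
Positivity is ⟨v, S(1-S)v⟩ ≥ 0. -/
theorem IsRes.isNonnegSelfAdjoint_op (hS : IsRes S) : IsNonnegSelfAdjoint (op S) := by
  have hi := hS.injective
  have hsa := hS.isSelfAdjoint
  have hsym : ∀ v w, ⟪S v, w⟫_ℂ = ⟪v, S w⟫_ℂ := hsa.isSymmetric
  have hd : Dense ((op S).domain : Set H) := by
    have : ((op S).domain : Set H) = Set.range S := by
      ext u
      exact mem_op_domain
    rw [this]
    exact dense_range_of_injective hsa hi
  have hfa : (op S).IsFormalAdjoint (op S) := by
    rintro ⟨x, hx⟩ ⟨y, hy⟩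
    obtain ⟨v, rfl⟩ := mem_op_domain.1 hx
    obtain ⟨w, rfl⟩ := mem_op_domain.1 hy
    rw [op_apply hi, op_apply hi]
    simp only [inner_sub_left, inner_sub_right]
    rw [hsym v w]
  constructor
  · rw [LinearPMap.isSelfAdjoint_def]
    refine le_antisymm ?_ (hfa.le_adjoint hd)
    have hdom : ∀ y : (op S).adjoint.domain, S (y + (op S).adjoint y) = y := by
      intro y
      refine ext_inner_right ℂ fun w => ?_
      have hSw : S w ∈ (op S).domain := mem_op_domain.2 ⟨w, rfl⟩
      have := LinearPMap.adjoint_isFormalAdjoint hd y ⟨S w, hSw⟩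
      rw [op_apply hi, inner_sub_right] at this
      rw [hsym, inner_add_left, this]
      ring
    refine ⟨fun y hy => mem_op_domain.2 ⟨_, hdom ⟨y, hy⟩⟩, ?_⟩
    rintro ⟨x, hx⟩ ⟨y, hy⟩ (rfl : x = y)
    have h := hdom ⟨x, hx⟩
    have h2 := (isInvOneAdd_op hi).1 (x + (op S).adjoint ⟨x, hx⟩)
    obtain ⟨h3, h4⟩ := h2
    have h5 : (⟨S (x + (op S).adjoint ⟨x, hx⟩), h3⟩ : (op S).domain) = ⟨x, hy⟩ := Subtype.ext h
    rw [h5, h] at h4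
    exact (add_left_cancel h4).symm
  · rintro ⟨x, hx⟩
    obtain ⟨v, rfl⟩ := mem_op_domain.1 hx
    rw [op_apply hi]
    have h1 : 0 ≤ (⟪v, cfc (fun x : ℝ => x * (1 - x)) S v⟫_ℂ).re :=
      re_inner_cfc_nonneg (fun x hx => mul_nonneg (hS.spectrum_subset hx).1
        (sub_nonneg.2 (hS.spectrum_subset hx).2)) v
    rw [cfc_mul (fun x => x) (fun x => 1 - x) S, cfc_sub _ _ S, cfc_const_one ℝ S,
      cfc_id' ℝ S] at h1
    change 0 ≤ (⟪v, S (v - S v)⟫_ℂ).re at h1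
    rw [← hsym] at h1
    exact h1

theorem IsNonnegSelfAdjoint.isInvOneAdd_invOneAdd {A : H →ₗ.[ℂ] H} (hA : IsNonnegSelfAdjoint A) :
    IsInvOneAdd A (invOneAdd A) := by
  obtain ⟨R, hR⟩ := exists_isInvOneAdd hA
  rwa [hR.invOneAdd_eq]

theorem symmetric_of_isSelfAdjoint {X : H →ₗ.[ℂ] H} (hX : IsSelfAdjoint X) (x y : X.domain) :
    ⟪X x, (y : H)⟫_ℂ = ⟪(x : H), X y⟫_ℂ := by
  have key : ∀ B : H →ₗ.[ℂ] H, B = X.adjoint →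
      ∀ x y : B.domain, ⟪B x, (y : H)⟫_ℂ = ⟪(x : H), B y⟫_ℂ := by
    intro B hB
    have h : B.IsFormalAdjoint X := by
      rw [hB]
      exact LinearPMap.adjoint_isFormalAdjoint hX.dense_domain
    have hBX : B = X := hB.trans hX
    subst hBX
    exact h
  exact key X hX.symm x y

theorem IsNonnegSelfAdjoint.isRes {A : H →ₗ.[ℂ] H} (hA : IsNonnegSelfAdjoint A) :
    IsRes (invOneAdd A) :=
  hA.isInvOneAdd_invOneAdd.isRes (symmetric_of_isSelfAdjoint hA.1) hA.2

theorem IsNonnegSelfAdjoint.eq_op {A : H →ₗ.[ℂ] H} (hA : IsNonnegSelfAdjoint A) :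
    A = op (invOneAdd A) := hA.isInvOneAdd_invOneAdd.eq_op

/-- If f(T)u = 0, then f² integrates to 0 against the spectral measure of u. As f ≠ 0 almost
everywhere, that measure vanishes, and its total mass is ‖u‖². -/
theorem injective_cfc (hT : IsSelfAdjoint T) {f : ℝ → ℝ} (hf : ContinuousOn f (spectrum ℝ T))
    (h : ∀ u, ∀ᵐ x ∂(specMeasure T u), f x ≠ 0) :
    Function.Injective (cfc f T : H →L[ℂ] H) := by
  rw [injective_iff_map_eq_zero]
  intro u hu
  have h1 := lintegral_specMeasure_sq hT hf u
  rw [hu, enorm_zero, zero_pow two_ne_zero, lintegral_eq_zero_iff'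
    ((aemeasurable_specMeasure hT hf u).pow_const 2).ennreal_ofReal] at h1
  have h2 : ∀ᵐ x ∂(specMeasure T u), False := by
    filter_upwards [h u, h1] with x hx hx'
    exact (ENNReal.ofReal_pos.2 (pow_pos (abs_pos.2 hx) 2)).ne' (by simpa using hx')
  rw [ae_iff] at h2
  have h3 := specMeasure_univ hT u
  simp only [not_false_eq_true] at h2
  have h4 : ‖u‖ₑ ^ 2 = 0 := by rw [← h3]; exact h2
  simpa using h4

theorem isRes_cfc (hT : IsSelfAdjoint T) {f : ℝ → ℝ} (hf : ContinuousOn f (spectrum ℝ T))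
    (h01 : ∀ x ∈ spectrum ℝ T, f x ∈ Set.Icc (0 : ℝ) 1)
    (h : ∀ u, ∀ᵐ x ∂(specMeasure T u), f x ≠ 0) : IsRes (cfc f T) :=
  ⟨cfc_nonneg fun x hx => (h01 x hx).1, cfc_le_one f T fun x hx => (h01 x hx).2,
    injective_cfc hT hf h⟩

theorem IsRes.ae_mem_Ioc (hS : IsRes S) (u : H) :
    ∀ᵐ x ∂(specMeasure S u), x ∈ Set.Ioc (0 : ℝ) 1 := by
  filter_upwards [ae_mem_spectrum hS.isSelfAdjoint u,
    ae_ne_zero_of_injective hS.isSelfAdjoint hS.injective u] with x hx hx'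
  exact ⟨lt_of_le_of_ne (hS.spectrum_subset hx).1 hx'.symm, (hS.spectrum_subset hx).2⟩

end

/-! ### Quadratic forms of powers through the spectral measure of the resolvent -/

section

variable {S T : H →L[ℂ] H}

theorem IsRes.continuousOn (hS : IsRes S) {f : ℝ → ℝ} (hf : ContinuousOn f (Set.Icc 0 1)) :
    ContinuousOn f (spectrum ℝ S) := hf.mono hS.spectrum_subset

/-- A vector `u` with `∫ r⁻² dμ_u < ∞` is in the range of `S`. -/
theorem IsRes.mem_range_of_lintegral (hS : IsRes S) {u : H}
    (hu : ∫⁻ r, ENNReal.ofReal (r⁻¹ ^ 2) ∂(specMeasure S u) ≠ ∞) : ∃ v, S v = u := by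
  have hsa := hS.isSelfAdjoint
  -- Truncations of r⁻¹, increasing in n. The preimage of u is obtained as the limit of f_n(S)u.
  let f : ℕ → ℝ → ℝ := fun n r => (max r ((n : ℝ) + 1)⁻¹)⁻¹
  have hpos : ∀ n : ℕ, (0 : ℝ) < ((n : ℝ) + 1)⁻¹ := fun n => by positivity
  have hmpos : ∀ (n : ℕ) (r : ℝ), 0 < max r ((n : ℝ) + 1)⁻¹ := fun n r =>
    lt_of_lt_of_le (hpos n) (le_max_right _ _)
  have hfc : ∀ n, Continuous (f n) := fun n =>
    Continuous.inv₀ (by fun_prop) fun r => (hmpos n r).ne'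
  have hf0 : ∀ n r, 0 < f n r := fun n r => inv_pos.2 (hmpos n r)
  have hfm : ∀ {n m : ℕ} (r : ℝ), n ≤ m → f n r ≤ f m r := fun {n m} r hnm => by
    refine inv_anti₀ (hmpos m r) (max_le_max le_rfl (inv_anti₀ (by positivity) ?_))
    exact_mod_cast Nat.succ_le_succ hnm
  have hfr : ∀ (n : ℕ) {r : ℝ}, 0 < r → f n r ≤ r⁻¹ := fun n r hr =>
    inv_anti₀ hr (le_max_left _ _)
  let v : ℕ → H := fun n => cfc (f n) S u
  have hint : ∀ n, ‖v n‖ ^ 2 = ∫ r, f n r ^ 2 ∂(specMeasure S u) := fun n => by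
    rw [integral_specMeasure hsa (f := fun r => f n r ^ 2) ((hfc n).pow 2).continuousOn,
      norm_cfc_apply_sq (hfc n).continuousOn]
  have hI : ∀ n, Integrable (fun r => f n r ^ 2) (specMeasure S u) := fun n =>
    integrable_specMeasure hsa ((hfc n).pow 2).continuousOn u
  have hmono : Monotone fun n => ‖v n‖ ^ 2 := fun n m hnm => by
    simp only [hint]
    exact integral_mono (hI n) (hI m) fun r => pow_le_pow_left₀ (hf0 n r).le (hfm r hnm) 2
  have hbdd : BddAbove (Set.range fun n => ‖v n‖ ^ 2) := by
    refine ⟨(∫⁻ r, ENNReal.ofReal (r⁻¹ ^ 2) ∂(specMeasure S u)).toReal, ?_⟩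
    rintro _ ⟨n, rfl⟩
    have h1 : ‖v n‖ₑ ^ 2 ≤ ∫⁻ r, ENNReal.ofReal (r⁻¹ ^ 2) ∂(specMeasure S u) := by
      rw [← lintegral_specMeasure_sq hsa (hfc n).continuousOn]
      refine lintegral_mono_ae ?_
      filter_upwards [hS.ae_mem_Ioc u] with r hr
      exact ENNReal.ofReal_le_ofReal (pow_le_pow_left₀ (hf0 n r).le (hfr n hr.1) 2)
    have h2 := ENNReal.toReal_mono hu h1
    rwa [ENNReal.toReal_pow, toReal_enorm] at h2
  -- From (a-b)² ≤ a² - b² for a ≥ b ≥ 0: since the increasing bounded sequence ‖v n‖² is Cauchy, so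
  -- is v itself.
  have hdiff : ∀ {n m : ℕ}, n ≤ m → ‖v m - v n‖ ^ 2 ≤ ‖v m‖ ^ 2 - ‖v n‖ ^ 2 := fun {n m} hnm => by
    have h1 : v m - v n = cfc (fun r => f m r - f n r) S u := by
      rw [cfc_sub _ _ S (hfc m).continuousOn (hfc n).continuousOn]
      rfl
    have hc : Continuous fun r => f m r - f n r := (hfc m).sub (hfc n)
    have hc2 : Continuous fun r => (f m r - f n r) ^ 2 := hc.pow 2
    rw [h1, norm_cfc_apply_sq hc.continuousOn, ← integral_specMeasure hsa hc2.continuousOn, hint, hint, ← integral_sub (hI m) (hI n)]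
    refine integral_mono (integrable_specMeasure hsa hc2.continuousOn u)
      ((hI m).sub (hI n)) fun r => ?_
    have := hfm r hnm
    have := hf0 n r
    simp only
    nlinarith
  have hcau : CauchySeq v := by
    have h1 := (tendsto_atTop_ciSup hmono hbdd).cauchySeq
    refine Metric.cauchySeq_iff'.2 fun ε hε => ?_
    obtain ⟨N, hN⟩ := Metric.cauchySeq_iff'.1 h1 (ε ^ 2) (by positivity)
    refine ⟨N, fun n hn => ?_⟩
    have h2 := hN n hn
    rw [Real.dist_eq] at h2
    rw [dist_eq_norm]
    exact lt_of_pow_lt_pow_left₀ 2 hε.le ((hdiff hn).trans_lt ((le_abs_self _).trans_lt h2))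
  obtain ⟨w, hw⟩ := cauchySeq_tendsto_of_complete hcau
  refine ⟨w, tendsto_nhds_unique ((S.continuous.tendsto w).comp hw) ?_⟩
  -- The pointwise bound is |r f_n(r) - 1| ≤ r⁻¹/(n+1). The left side is 0 for r ≥ 1/(n+1); below
  -- that it is at most 1, while the right side is at least 1.
  have hb : ∀ n, ‖S (v n) - u‖ₑ ^ 2 ≤
      ENNReal.ofReal (((n : ℝ) + 1)⁻¹ ^ 2) * ∫⁻ r, ENNReal.ofReal (r⁻¹ ^ 2) ∂(specMeasure S u) := by
    intro n
    have hc : Continuous fun r => r * f n r - 1 := (continuous_id.mul (hfc n)).sub continuous_const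
    have h1 : S (v n) - u = cfc (fun r => r * f n r - 1) S u := by
      rw [cfc_sub (fun r => r * f n r) (fun _ => 1) S (continuous_id.mul (hfc n)).continuousOn,
        cfc_const_one ℝ S,
        cfc_mul (fun r => r) _ S continuousOn_id (hfc n).continuousOn, cfc_id' ℝ S]
      rfl
    rw [h1, ← lintegral_specMeasure_sq hsa hc.continuousOn,
      ← lintegral_const_mul _ (by fun_prop)]
    refine lintegral_mono_ae ?_
    filter_upwards [hS.ae_mem_Ioc u] with r hr
    rw [← ENNReal.ofReal_mul (by positivity), ← mul_pow]
    refine ENNReal.ofReal_le_ofReal ?_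
    rw [← sq_abs]
    have hr0 := hr.1
    refine pow_le_pow_left₀ (abs_nonneg _) ?_ 2
    have h2 : r * f n r ≤ 1 := by
      calc r * f n r ≤ r * r⁻¹ := mul_le_mul_of_nonneg_left (hfr n hr0) hr0.le
        _ = 1 := mul_inv_cancel₀ hr0.ne'
    rw [abs_of_nonpos (by linarith)]
    rcases le_total r ((n : ℝ) + 1)⁻¹ with h | h
    · have h3 : 1 ≤ ((n : ℝ) + 1)⁻¹ * r⁻¹ := by
        rw [← div_eq_mul_inv, one_le_div hr0]
        exact h
      have := mul_pos hr0 (hf0 n r)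
      linarith
    · have h3 : f n r = r⁻¹ := by simp only [f, max_eq_left h]
      rw [h3, mul_inv_cancel₀ hr0.ne']
      simp only [sub_self, neg_zero]
      positivity
  have hlim : Tendsto (fun n : ℕ => ENNReal.ofReal (((n : ℝ) + 1)⁻¹ ^ 2) *
      ∫⁻ r, ENNReal.ofReal (r⁻¹ ^ 2) ∂(specMeasure S u)) atTop (𝓝 0) := by
    have h1 : Tendsto (fun n : ℕ => ((n : ℝ) + 1)⁻¹ ^ 2) atTop (𝓝 0) := by
      have := (tendsto_one_div_add_atTop_nhds_zero_nat (𝕜 := ℝ)).pow 2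
      simpa using this
    have h2 := ENNReal.Tendsto.mul_const (ENNReal.tendsto_ofReal h1) (Or.inr hu)
    simpa using h2
  have hlim2 : Tendsto (fun n => ‖S (v n) - u‖ₑ ^ 2) atTop (𝓝 0) :=
    tendsto_of_tendsto_of_tendsto_of_le_of_le tendsto_const_nhds hlim (fun _ => zero_le) hb
  rw [tendsto_iff_norm_sub_tendsto_zero]
  have h3 := (ENNReal.tendsto_toReal ENNReal.zero_ne_top).comp hlim2
  have h4 : Tendsto (fun n => ‖S (v n) - u‖ ^ 2) atTop (𝓝 0) := by
    refine h3.congr fun n => ?_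
    simp
  have h5 := (Real.continuous_sqrt.tendsto 0).comp h4
  rw [Real.sqrt_zero] at h5
  refine h5.congr fun n => ?_
  simp only [Function.comp_apply]
  exact Real.sqrt_sq (norm_nonneg _)

-- For u = Sv the spectral measure of u is r² times that of v, which turns ((1-r)/r)² into (1-r)².
-- Outside the range of S the integral must diverge: r⁻² ≤ 2((1-r)/r)² + 2, so finiteness would put
-- u into the range by `IsRes.mem_range_of_lintegral`.
open Classical in
theorem IsRes.enorm_op_sq (hS : IsRes S) (u : H) :
    (if h : u ∈ (op S).domain then ‖op S ⟨u, h⟩‖ₑ ^ 2 else ∞) =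
      ∫⁻ r, ENNReal.ofReal (((1 - r) / r) ^ 2) ∂(specMeasure S u) := by
  have hsa := hS.isSelfAdjoint
  split_ifs with h
  · obtain ⟨v, rfl⟩ := mem_op_domain.1 h
    rw [op_apply hS.injective]
    have h1 : v - S v = cfc (fun r : ℝ => 1 - r) S v := by
      rw [cfc_sub _ _ S, cfc_const_one ℝ S, cfc_id' ℝ S]
      rfl
    have h2 := lintegral_specMeasure_cfc_apply hsa (f := fun r => r) continuousOn_id v
      (h := fun r => ENNReal.ofReal (((1 - r) / r) ^ 2)) (by fun_prop)
    rw [cfc_id' ℝ S] at h2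
    rw [h1, ← lintegral_specMeasure_sq hsa (by fun_prop), h2]
    refine lintegral_congr_ae ?_
    filter_upwards [hS.ae_mem_Ioc v] with r hr
    rw [← ENNReal.ofReal_mul (sq_nonneg r), ← mul_pow, mul_div_cancel₀ _ hr.1.ne']
  · by_contra hne
    refine h (mem_op_domain.2 (hS.mem_range_of_lintegral ?_))
    have h1 : ∫⁻ r, ENNReal.ofReal (r⁻¹ ^ 2) ∂(specMeasure S u) ≤
        ∫⁻ r, (2 * ENNReal.ofReal (((1 - r) / r) ^ 2) + 2) ∂(specMeasure S u) := by
      refine lintegral_mono_ae ?_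
      filter_upwards [hS.ae_mem_Ioc u] with r hr
      have h2 : (2 : ℝ≥0∞) = ENNReal.ofReal 2 := by simp
      rw [h2, ← ENNReal.ofReal_mul zero_le_two, ← ENNReal.ofReal_add (by positivity) zero_le_two]
      refine ENNReal.ofReal_le_ofReal ?_
      have h3 : (1 - r) / r = r⁻¹ - 1 := by
        have := hr.1.ne'
        field_simp
      rw [h3]
      nlinarith [sq_nonneg (r⁻¹ - 2)]
    refine (h1.trans_lt ?_).ne
    rw [lintegral_add_right _ measurable_const, lintegral_const_mul _ (by fun_prop)]
    refine ENNReal.add_lt_top.2 ⟨ENNReal.mul_lt_top (by simp) (Ne.lt_top' hne), ?_⟩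
    rw [lintegral_const]
    exact ENNReal.mul_lt_top (by simp) (measure_lt_top _ _)

/-- The function `r ↦ (1 + a ^ p)⁻¹`, where `r = (1 + a)⁻¹`. -/
def rpowRes (p r : ℝ) : ℝ := r ^ p / (r ^ p + (1 - r) ^ p)

theorem rpowRes_denom_pos {p r : ℝ} (hr : r ∈ Set.Icc (0 : ℝ) 1) :
    0 < r ^ p + (1 - r) ^ p := by
  rcases eq_or_lt_of_le hr.1 with h | h
  · rw [← h, sub_zero, Real.one_rpow]
    linarith [Real.rpow_nonneg le_rfl p]
  · linarith [Real.rpow_pos_of_pos h p, Real.rpow_nonneg (sub_nonneg.2 hr.2) p]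

theorem continuousOn_rpowRes {p : ℝ} (hp : 0 < p) : ContinuousOn (rpowRes p) (Set.Icc 0 1) := by
  refine ContinuousOn.div ?_ ?_ fun r hr => (rpowRes_denom_pos hr).ne'
  · exact (Real.continuous_rpow_const hp.le).continuousOn
  · exact ((Real.continuous_rpow_const hp.le).add
      ((Real.continuous_rpow_const hp.le).comp (continuous_const.sub continuous_id))).continuousOn

theorem rpowRes_mem {p r : ℝ} (hr : r ∈ Set.Icc (0 : ℝ) 1) : rpowRes p r ∈ Set.Icc (0 : ℝ) 1 := by
  have h := rpowRes_denom_pos (p := p) hr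
  refine ⟨div_nonneg (Real.rpow_nonneg hr.1 p) h.le, (div_le_one h).2 ?_⟩
  exact le_add_of_nonneg_right (Real.rpow_nonneg (sub_nonneg.2 hr.2) p)

theorem rpowRes_pos {p r : ℝ} (hr : r ∈ Set.Ioc (0 : ℝ) 1) : 0 < rpowRes p r :=
  div_pos (Real.rpow_pos_of_pos hr.1 p) (rpowRes_denom_pos (Set.Ioc_subset_Icc_self hr))

theorem one_sub_rpowRes_div {p r : ℝ} (hr : r ∈ Set.Ioc (0 : ℝ) 1) :
    (1 - rpowRes p r) / rpowRes p r = ((1 - r) / r) ^ p := by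
  have h := rpowRes_denom_pos (p := p) (Set.Ioc_subset_Icc_self hr)
  have h2 := Real.rpow_pos_of_pos hr.1 p
  rw [Real.div_rpow (sub_nonneg.2 hr.2) hr.1.le, rpowRes]
  field_simp
  ring

theorem IsRes.cfc_rpowRes (hS : IsRes S) {p : ℝ} (hp : 0 < p) : IsRes (cfc (rpowRes p) S) := by
  refine isRes_cfc hS.isSelfAdjoint (hS.continuousOn (continuousOn_rpowRes hp))
    (fun r hr => rpowRes_mem (hS.spectrum_subset hr)) fun u => ?_
  filter_upwards [hS.ae_mem_Ioc u] with r hr using (rpowRes_pos hr).ne'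

theorem rpow_op (hS : IsRes S) (p : ℝ) : rpow (op S) p = op (cfc (rpowRes p) S) := by
  rw [rpow_eq_op, invOneAdd_op hS.injective]
  rfl

/-- The quadratic form of `S⁻¹ - 1` in terms of the spectral measure of `S`. -/
theorem IsRes.form_op (hS : IsRes S) (u : H) :
    form (op S) u = ∫⁻ r, ENNReal.ofReal ((1 - r) / r) ∂(specMeasure S u) := by
  have hsa := hS.isSelfAdjoint
  have h2 : (0 : ℝ) < 1 / 2 := by norm_num
  rw [form, rpow_op hS, (hS.cfc_rpowRes h2).enorm_op_sq, lintegral_specMeasure_cfc hsa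
    (hS.continuousOn (continuousOn_rpowRes h2)) u (by fun_prop)]
  refine lintegral_congr_ae ?_
  filter_upwards [hS.ae_mem_Ioc u] with r hr
  rw [one_sub_rpowRes_div hr, ← Real.sqrt_eq_rpow,
    Real.sq_sqrt (div_nonneg (sub_nonneg.2 hr.2) hr.1.le)]

theorem IsRes.form_rpow (hS : IsRes S) {p : ℝ} (hp : 0 < p) (u : H) :
    form (rpow (op S) p) u = ∫⁻ r, ENNReal.ofReal (((1 - r) / r) ^ p) ∂(specMeasure S u) := by
  rw [rpow_op hS, (hS.cfc_rpowRes hp).form_op, lintegral_specMeasure_cfc hS.isSelfAdjoint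
    (hS.continuousOn (continuousOn_rpowRes hp)) u (by fun_prop)]
  refine lintegral_congr_ae ?_
  filter_upwards [hS.ae_mem_Ioc u] with r hr
  rw [one_sub_rpowRes_div hr]

theorem mem_formDomain_iff {A : H →ₗ.[ℂ] H} {u : H} : u ∈ formDomain A ↔ form A u ≠ ∞ := by
  rw [formDomain, form]
  split_ifs with h
  · exact iff_of_true h (by simp)
  · exact iff_of_false h (by simp)

/-- The square root of the form is a seminorm on the form domain. -/
theorem form_add_le (A : H →ₗ.[ℂ] H) (u v : H) :
    form A (u + v) ^ (1 / 2 : ℝ) ≤ form A u ^ (1 / 2 : ℝ) + form A v ^ (1 / 2 : ℝ) := by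
  by_cases hu : u ∈ (rpow A (1 / 2)).domain
  · by_cases hv : v ∈ (rpow A (1 / 2)).domain
    · have huv := add_mem hu hv
      have hsq : ∀ x : ℝ≥0∞, (x ^ 2) ^ (1 / 2 : ℝ) = x := fun x => by
        rw [← ENNReal.rpow_natCast, ← ENNReal.rpow_mul]
        norm_num
      rw [form, form, form, dif_pos hu, dif_pos hv, dif_pos huv, hsq, hsq, hsq]
      have : (⟨u + v, huv⟩ : (rpow A (1 / 2)).domain) = ⟨u, hu⟩ + ⟨v, hv⟩ := rfl
      rw [this, LinearPMap.map_add]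
      exact enorm_add_le _ _
    · rw [form, form, form, dif_neg hv, ENNReal.top_rpow_of_pos (by norm_num), add_top]
      exact le_top
  · rw [form, form, form, dif_neg hu, ENNReal.top_rpow_of_pos (by norm_num), top_add]
    exact le_top

end

/-! ### Bounded transform, absolute value and positive part of a self-adjoint operator -/

theorem mem_domain_of_isSelfAdjoint {X : H →ₗ.[ℂ] H} (hX : IsSelfAdjoint X) {y w : H}
    (h : ∀ x : X.domain, ⟪w, (x : H)⟫_ℂ = ⟪y, X x⟫_ℂ) : ∃ hy : y ∈ X.domain, X ⟨y, hy⟩ = w := by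
  have hmem : y ∈ X.adjoint.domain := LinearPMap.mem_adjoint_domain_of_exists y ⟨w, h⟩
  have hval := LinearPMap.adjoint_apply_eq hX.dense_domain ⟨y, hmem⟩ h
  have key : ∀ B : H →ₗ.[ℂ] H, X.adjoint = B → ∃ hy : y ∈ B.domain, B ⟨y, hy⟩ = w := by
    rintro B rfl
    exact ⟨hmem, hval⟩
  exact key X hX

theorem mem_square_domain {X : H →ₗ.[ℂ] H} {x : H} :
    x ∈ (square X).domain ↔ ∃ h : x ∈ X.domain, X ⟨x, h⟩ ∈ X.domain := by
  constructor
  · rintro ⟨y, hy, rfl⟩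
    exact ⟨y.2, hy⟩
  · rintro ⟨h, h'⟩
    exact ⟨⟨x, h⟩, h', rfl⟩

theorem square_apply {X : H →ₗ.[ℂ] H} {x : H} (h : x ∈ (square X).domain) (h1 : x ∈ X.domain)
    (h2 : X ⟨x, h1⟩ ∈ X.domain) : square X ⟨x, h⟩ = X ⟨X ⟨x, h1⟩, h2⟩ := rfl

/-- For self-adjoint `X`, the bounded operators `R = (1 + X ^ 2)⁻¹` and `Z = X R`. They are obtained
from the orthogonal projection onto the graph of `X`. -/
theorem exists_isInvOneAdd_square {X : H →ₗ.[ℂ] H} (hX : IsSelfAdjoint X) :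
    ∃ R Z : H →L[ℂ] H, IsInvOneAdd (square X) R ∧
      ∀ y, ∃ h : R y ∈ X.domain, X ⟨R y, h⟩ = Z y := by
  let e := WithLp.prodContinuousLinearEquiv 2 ℂ H H
  -- The graph is a closed subspace of the Hilbert sum H ⊕ H, and `Q y` is the orthogonal projection
  -- of (y, 0) onto it.
  let G : Submodule ℂ (WithLp 2 (H × H)) := X.graph.comap e.toLinearMap
  have hG : IsClosed (G : Set (WithLp 2 (H × H))) := by
    have : _root_.IsClosed (X.graph : Set (H × H)) := hX.isClosed
    exact this.preimage e.continuous
  have : CompleteSpace G := hG.completeSpace_coe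
  let Q : H →L[ℂ] H × H := (e : WithLp 2 (H × H) →L[ℂ] H × H) ∘L G.starProjection ∘L
    (e.symm : H × H →L[ℂ] WithLp 2 (H × H)) ∘L ContinuousLinearMap.inl ℂ H H
  have hQ : ∀ y, Q y ∈ X.graph := fun y => G.starProjection_apply_mem (e.symm (y, 0))
  -- Orthogonality of (y, 0) - Q y to the graph. By self-adjointness, X applied to the second
  -- component of Q y is y minus the first. The second component is X of the first, so the first
  -- solves (1 + X²)x = y.
  have horth : ∀ y (x : X.domain), ⟪y - (Q y).1, (x : H)⟫_ℂ = ⟪(Q y).2, X x⟫_ℂ := by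
    intro y x
    have h1 := (Submodule.mem_orthogonal' _ _).1
      (G.sub_starProjection_mem_orthogonal (e.symm (y, 0))) (e.symm ((x : H), X x)) (X.mem_graph x)
    rw [WithLp.prod_inner_apply] at h1
    have h2 : ⟪y - (Q y).1, (x : H)⟫_ℂ + ⟪0 - (Q y).2, X x⟫_ℂ = 0 := h1
    rw [zero_sub, inner_neg_left] at h2
    linear_combination h2
  refine ⟨ContinuousLinearMap.fst ℂ H H ∘L Q, ContinuousLinearMap.snd ℂ H H ∘L Q,
    ⟨fun y => ?_, fun x => ?_⟩, fun y => ?_⟩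
  · obtain ⟨v, hv1, hv2⟩ := (LinearPMap.mem_graph_iff X).1 (hQ y)
    obtain ⟨h1, h2⟩ := mem_domain_of_isSelfAdjoint hX (horth y)
    have h3 : (Q y).1 ∈ X.domain := hv1 ▸ v.2
    have h4 : X ⟨(Q y).1, h3⟩ = (Q y).2 := by
      rw [← hv2]
      congr 1
      exact Subtype.ext hv1.symm
    have h5 : X ⟨(Q y).1, h3⟩ ∈ X.domain := h4 ▸ h1
    refine ⟨mem_square_domain.2 ⟨h3, h5⟩, ?_⟩
    change (Q y).1 + X ⟨X ⟨(Q y).1, h3⟩, h5⟩ = y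
    have h6 : (⟨X ⟨(Q y).1, h3⟩, h5⟩ : X.domain) = ⟨(Q y).2, h1⟩ := Subtype.ext h4
    rw [h6, h2, add_sub_cancel]
  · obtain ⟨x, hx⟩ := x
    obtain ⟨h1, h2⟩ := mem_square_domain.1 hx
    have key : G.starProjection (e.symm (x + square X ⟨x, hx⟩, 0)) = e.symm (x, X ⟨x, h1⟩) := by
      refine (Submodule.eq_starProjection_of_mem_orthogonal (X.mem_graph ⟨x, h1⟩) ?_)
      rw [Submodule.mem_orthogonal']
      intro g hg
      obtain ⟨v, hv1, hv2⟩ := (LinearPMap.mem_graph_iff X).1 (show e g ∈ X.graph from hg)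
      rw [WithLp.prod_inner_apply]
      change ⟪x + square X ⟨x, hx⟩ - x, (e g).1⟫_ℂ + ⟪0 - X ⟨x, h1⟩, (e g).2⟫_ℂ = 0
      rw [add_sub_cancel_left, zero_sub, inner_neg_left, square_apply hx h1 h2, ← hv1, ← hv2,
        symmetric_of_isSelfAdjoint hX, add_neg_cancel]
    change (e (G.starProjection (e.symm (x + square X ⟨x, hx⟩, 0)))).1 = x
    rw [key]
    rfl
  · obtain ⟨v, hv1, hv2⟩ := (LinearPMap.mem_graph_iff X).1 (hQ y)
    have h3 : (Q y).1 ∈ X.domain := hv1 ▸ v.2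
    refine ⟨h3, ?_⟩
    change X ⟨(Q y).1, h3⟩ = (Q y).2
    rw [← hv2]
    congr 1
    exact Subtype.ext hv1.symm

/-- The bounded self-adjoint operator `F = X (1 + |X|)⁻¹`, together with `S = (1 + |X|)⁻¹ = 1 - |F|`,
encodes the self-adjoint operator `X`. -/
structure IsTransform (X : H →ₗ.[ℂ] H) (F : H →L[ℂ] H) : Prop where
  isSelfAdjoint : IsSelfAdjoint F
  isRes : IsRes (cfc (fun f : ℝ => 1 - |f|) F)
  absOp_eq : absOp X = op (cfc (fun f : ℝ => 1 - |f|) F)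
  apply_eq : ∀ w, ∃ h : cfc (fun f : ℝ => 1 - |f|) F w ∈ X.domain, X ⟨_, h⟩ = F w
  exists_eq : ∀ x ∈ X.domain, ∃ w, cfc (fun f : ℝ => 1 - |f|) F w = x

theorem mul_right_cancel_of_dense {A B R : H →L[ℂ] H} (hR : DenseRange R) (h : A * R = B * R) :
    A = B := by
  refine DFunLike.coe_injective (hR.equalizer A.continuous B.continuous ?_)
  funext v
  exact congrArg (fun T : H →L[ℂ] H => T v) h

theorem mul_left_cancel_of_injective {A B R : H →L[ℂ] H} (hR : Function.Injective R)
    (h : R * A = R * B) : A = B := by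
  ext v
  exact hR (congrArg (fun T : H →L[ℂ] H => T v) h)

/-- With R = (1+X²)⁻¹, Z = XR and S = (1+|X|)⁻¹, a continuous function of R, the operator sought is
F = ZSR⁻¹. It is defined on the dense range of R and extends because ‖ZSv‖ ≤ ‖Rv‖. Identities for F
are checked after multiplication by R, which is injective with dense range. -/
theorem exists_isTransform {X : H →ₗ.[ℂ] H} (hX : IsSelfAdjoint X) :
    ∃ F : H →L[ℂ] H, IsTransform X F := by
  obtain ⟨R, Z, hR, hZ⟩ := exists_isInvOneAdd_square hX
  have hsym := symmetric_of_isSelfAdjoint hX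
  have hRes : IsRes R := by
    refine hR.isRes ?_ ?_
    · rintro ⟨x, hx⟩ ⟨y, hy⟩
      obtain ⟨h1, h2⟩ := mem_square_domain.1 hx
      obtain ⟨h3, h4⟩ := mem_square_domain.1 hy
      rw [square_apply hx h1 h2, square_apply hy h3 h4]
      exact (hsym ⟨_, h2⟩ ⟨y, h3⟩).trans (hsym ⟨x, h1⟩ ⟨_, h4⟩)
    · rintro ⟨x, hx⟩
      obtain ⟨h1, h2⟩ := mem_square_domain.1 hx
      rw [square_apply hx h1 h2, ← hsym ⟨x, h1⟩ ⟨_, h2⟩]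
      exact inner_self_nonneg (𝕜 := ℂ)
  have hRsa := hRes.isSelfAdjoint
  have hRd := dense_range_of_injective hRsa hRes.injective
  -- `Z y` is again in the domain of `X`
  have hXZ : ∀ y, ∃ h : Z y ∈ X.domain, X ⟨Z y, h⟩ = y - R y := by
    intro y
    obtain ⟨h, hy⟩ := hR.1 y
    obtain ⟨h1, h2⟩ := mem_square_domain.1 h
    obtain ⟨h3, h4⟩ := hZ y
    have h5 : Z y ∈ X.domain := h4 ▸ h2
    refine ⟨h5, ?_⟩
    rw [eq_sub_iff_add_eq']
    refine Eq.trans ?_ hy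
    rw [square_apply h h1 h2]
    congr 2
    exact Subtype.ext h4.symm
  have hZsa : IsSelfAdjoint Z := by
    rw [ContinuousLinearMap.isSelfAdjoint_iff_isSymmetric]
    intro v w
    change ⟪Z v, w⟫_ℂ = ⟪v, Z w⟫_ℂ
    obtain ⟨h1, h2⟩ := hXZ v
    obtain ⟨h3, h4⟩ := hXZ w
    obtain ⟨h5, h6⟩ := hZ v
    obtain ⟨h7, h8⟩ := hZ w
    have e1 := hsym ⟨Z v, h1⟩ ⟨Z w, h3⟩
    have e2 := hsym ⟨R v, h5⟩ ⟨R w, h7⟩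
    simp only [h2, h4, h6, h8, inner_sub_left, inner_sub_right] at e1 e2
    linear_combination e2 - e1
  have hXR : ∀ u (hu : u ∈ X.domain), R (X ⟨u, hu⟩) = Z u := by
    intro u hu
    obtain ⟨h1, h2⟩ := hZ u
    obtain ⟨h3, h4⟩ := hXZ u
    have h5 : X ⟨Z u, h3⟩ ∈ X.domain := by
      rw [h4]
      exact sub_mem hu h1
    have h6 := hR.2 ⟨Z u, mem_square_domain.2 ⟨h3, h5⟩⟩
    rw [square_apply _ h3 h5] at h6
    have h7 : (⟨X ⟨Z u, h3⟩, h5⟩ : X.domain) = ⟨u, hu⟩ - ⟨R u, h1⟩ := Subtype.ext h4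
    rw [h7, LinearPMap.map_sub, h2, add_sub_cancel] at h6
    exact h6
  have hcomm : Commute R Z := by
    ext y
    change R (Z y) = Z (R y)
    obtain ⟨h1, h2⟩ := hZ y
    rw [← h2]
    exact hXR _ h1
  have hZZ : Z * Z = R - R * R := by
    ext y
    change Z (Z y) = R y - R (R y)
    obtain ⟨h1, h2⟩ := hXZ y
    rw [← hXR _ h1, h2, map_sub]
  have hhalf : (0 : ℝ) < 1 / 2 := by norm_num
  set s : ℝ → ℝ := rpowRes (1 / 2) with hs
  have hsc : ContinuousOn s (spectrum ℝ R) := hRes.continuousOn (continuousOn_rpowRes hhalf)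
  set S : H →L[ℂ] H := cfc s R with hS
  have hSRes : IsRes S := hRes.cfc_rpowRes hhalf
  have hSR : Commute S R := by
    have := cfc_commute_cfc s id R
    rwa [cfc_id ℝ R] at this
  have hSZ : Commute S Z := (Commute.cfc_real hcomm s)
  have hid : cfc (fun r : ℝ => r) R = R := cfc_id' ℝ R
  -- This is F² = (1-S)² multiplied by R². With a = √r and b = √(1-r) one has s = a/(a+b), and both
  -- sides equal a⁴b²/(a+b)².
  have hrel : ∀ r ∈ Set.Icc (0 : ℝ) 1, (r - r * r) * (s r * s r) = (1 - s r) * (1 - s r) * (r * r) := by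
    intro r hr
    have h1 := rpowRes_denom_pos (p := 1 / 2) hr
    simp only [hs, rpowRes]
    simp only [← Real.sqrt_eq_rpow] at h1 ⊢
    have h2 := Real.sq_sqrt hr.1
    have h3 := Real.sq_sqrt (sub_nonneg.2 hr.2)
    set a := √r
    set b := √(1 - r)
    have h4 : r = a ^ 2 := h2.symm
    have h5 : 1 - r = b ^ 2 := h3.symm
    have h6 : 1 - a / (a + b) = b / (a + b) := by field_simp; ring
    have h7 : r - r * r = a ^ 2 * b ^ 2 := by rw [← h5, ← h4]; ring
    rw [h6, h7, h4]
    field_simp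
  have hrelop : (R - R * R) * (S * S) = (1 - S) * (1 - S) * (R * R) := by
    have e1 : (R - R * R) * (S * S) = cfc (fun r => (r - r * r) * (s r * s r)) R := by
      rw [cfc_mul (fun r => r - r * r) (fun r => s r * s r) R, cfc_sub (fun r => r) (fun r => r * r) R,
        cfc_mul (fun r => r) (fun r => r) R, cfc_mul s s R, hid]
    have e2 : (1 - S) * (1 - S) * (R * R) = cfc (fun r => (1 - s r) * (1 - s r) * (r * r)) R := by
      rw [cfc_mul (fun r => (1 - s r) * (1 - s r)) (fun r => r * r) R,
        cfc_mul (fun r => (1 - s r)) (fun r => (1 - s r)) R,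
        cfc_mul (fun r => r) (fun r => r) R, cfc_sub (fun _ => 1) s R, cfc_const_one ℝ R, hid]
    rw [e1, e2]
    exact cfc_congr fun r hr => hrel r (hRes.spectrum_subset hr)
  have hZSZS : Z * S * (Z * S) = (R - R * R) * (S * S) := by
    rw [← hZZ, mul_assoc, ← mul_assoc S, hSZ.eq]
    simp only [mul_assoc]
  have hbound : ∀ v, ‖(Z * S) v‖ ≤ 1 * ‖R v‖ := by
    intro v
    have h1 : ‖(Z * S) v‖ ^ 2 = (⟪v, cfc (fun r => (r - r * r) * (s r * s r)) R v⟫_ℂ).re := by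
      have hsa : IsSelfAdjoint (Z * S) :=
        (hZsa.commute_iff hSRes.isSelfAdjoint).1 hSZ.symm
      have e1 : (R - R * R) * (S * S) = cfc (fun r => (r - r * r) * (s r * s r)) R := by
        rw [cfc_mul (fun r => r - r * r) (fun r => s r * s r) R,
          cfc_sub (fun r => r) (fun r => r * r) R, cfc_mul (fun r => r) (fun r => r) R,
          cfc_mul s s R, hid]
      rw [← e1, ← hZSZS]
      change _ = (⟪v, (Z * S) ((Z * S) v)⟫_ℂ).re
      have := hsa.isSymmetric v ((Z * S) v)
      change ⟪(Z * S) v, (Z * S) v⟫_ℂ = ⟪v, (Z * S) ((Z * S) v)⟫_ℂ at this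
      rw [← this]
      exact (inner_self_eq_norm_sq (𝕜 := ℂ) _).symm
    have h2 : ‖R v‖ ^ 2 = (⟪v, cfc (fun r : ℝ => r ^ 2) R v⟫_ℂ).re := by
      rw [← norm_cfc_apply_sq (T := R) (f := fun r => r) continuousOn_id v, hid]
    rw [one_mul]
    refine le_of_sq_le_sq ?_ (norm_nonneg _)
    rw [h1, h2, ← integral_specMeasure hRsa (by fun_prop), ← integral_specMeasure hRsa (by fun_prop)]
    refine integral_mono_ae (integrable_specMeasure hRsa (by fun_prop) v)
      (integrable_specMeasure hRsa (by fun_prop) v) ?_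
    filter_upwards [ae_mem_spectrum hRsa v] with r hr
    have hr' := hRes.spectrum_subset hr
    rw [hrel r hr', sq]
    have h3 : s r ∈ Set.Icc (0 : ℝ) 1 := rpowRes_mem hr'
    have h4 : (1 - s r) * (1 - s r) ≤ 1 := by nlinarith [h3.1, h3.2]
    exact mul_le_of_le_one_left (mul_self_nonneg r) h4
  let F : H →L[ℂ] H := ((Z * S : H →L[ℂ] H) : H →ₗ[ℂ] H).extendOfNorm (R : H →ₗ[ℂ] H)
  have hFR : F * R = Z * S := by
    ext v
    exact LinearMap.extendOfNorm_eq hRd ⟨1, hbound⟩ v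
  have hRF : R * F = Z * S := by
    refine mul_right_cancel_of_dense hRd ?_
    rw [mul_assoc, hFR, ← mul_assoc, hcomm.eq, mul_assoc, ← hSR.eq, ← mul_assoc]
  have hFsa : IsSelfAdjoint F := by
    refine mul_left_cancel_of_injective hRes.injective ?_
    have h1 : star (F * R) = F * R := by
      rw [hFR]
      exact (hZsa.commute_iff hSRes.isSelfAdjoint).1 hSZ.symm
    rw [star_mul, hRsa.star_eq] at h1
    rw [h1, hFR, hRF]
  have hFF : F * F = (1 - S) * (1 - S) := by
    refine mul_left_cancel_of_injective hRes.injective (mul_left_cancel_of_injective hRes.injective ?_)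
    have c1 : Commute (1 - S) R := (Commute.one_left R).sub_left hSR
    calc R * (R * (F * F)) = R * ((R * F) * F) := by simp only [mul_assoc]
      _ = (R * F) * (R * F) := by
        have : R * F = F * R := hRF.trans hFR.symm
        calc R * (R * F * F) = R * (F * R * F) := by rw [this]
          _ = R * F * (R * F) := by simp only [mul_assoc]
      _ = (1 - S) * (1 - S) * (R * R) := by rw [hRF, hZSZS, hrelop]
      _ = R * (R * ((1 - S) * (1 - S))) := by
        have := (c1.mul_left c1).mul_right (c1.mul_left c1)
        rw [this.eq, mul_assoc]
  -- Both |F| and 1 - S are nonnegative square roots of F², hence equal.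
  have habs : cfc (fun f : ℝ => |f|) F = 1 - S := by
    have h1 : cfc (fun f : ℝ => |f|) F * cfc (fun f : ℝ => |f|) F = F * F := by
      rw [← cfc_mul (fun f : ℝ => |f|) (fun f : ℝ => |f|) F]
      simp only [abs_mul_abs_self]
      rw [cfc_mul (fun f : ℝ => f) (fun f : ℝ => f) F, cfc_id' ℝ F]
    have h2 := CFC.sqrt_unique h1 (cfc_nonneg fun x _ => abs_nonneg x)
    rw [← h2]
    exact CFC.sqrt_unique hFF.symm (sub_nonneg.2 hSRes.le_one)
  have hSF : cfc (fun f : ℝ => 1 - |f|) F = S := by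
    rw [cfc_sub (fun _ => 1) (fun f : ℝ => |f|) F, cfc_const_one ℝ F, habs, sub_sub_cancel]
  have happ : ∀ w, ∃ h : S w ∈ X.domain, X ⟨S w, h⟩ = F w := by
    -- On the range of R this holds because FRv = ZSv = X(RSv). The closed graph carries it over to
    -- all w by density.
    have h1 : ∀ w, (S w, F w) ∈ X.graph := by
      intro w
      refine hRd.induction_on (p := fun w => (S w, F w) ∈ X.graph) w ?_ fun v => ?_
      · have : _root_.IsClosed (X.graph : Set (H × H)) := hX.isClosed
        exact this.preimage (S.continuous.prodMk F.continuous)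
      · have e1 : S (R v) = R (S v) := congrArg (fun T : H →L[ℂ] H => T v) hSR.eq
        have e2 : F (R v) = Z (S v) := congrArg (fun T : H →L[ℂ] H => T v) hFR
        obtain ⟨h2, h3⟩ := hZ (S v)
        rw [e1, e2, ← h3]
        exact X.mem_graph ⟨_, h2⟩
    intro w
    obtain ⟨v, hv1, hv2⟩ := (LinearPMap.mem_graph_iff X).1 (h1 w)
    replace hv1 : (v : H) = S w := hv1
    have h3 : S w ∈ X.domain := hv1 ▸ v.2
    refine ⟨h3, ?_⟩
    have h4 : v = ⟨S w, h3⟩ := Subtype.ext hv1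
    rw [← h4]
    exact hv2
  refine ⟨F, hFsa, ?_, ?_, ?_, ?_⟩
  · rw [hSF]; exact hSRes
  · rw [hSF, absOp, hR.eq_op, rpow_op hRes]
  · rw [hSF]; exact happ
  · rw [hSF]
    intro x hx
    have h1 : F x = S (X ⟨x, hx⟩) := by
      refine ext_inner_right ℂ fun v => ?_
      obtain ⟨h2, h3⟩ := happ v
      have e1 : ⟪F x, v⟫_ℂ = ⟪x, F v⟫_ℂ := hFsa.isSymmetric x v
      have e2 : ⟪S (X ⟨x, hx⟩), v⟫_ℂ = ⟪X ⟨x, hx⟩, S v⟫_ℂ := hSRes.isSelfAdjoint.isSymmetric _ v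
      rw [e1, e2, ← h3]
      exact (hsym ⟨x, hx⟩ ⟨S v, h2⟩).symm
    have hcF : Continuous fun f : ℝ => (1 - |f|) * (1 - |f|) + f * f := by fun_prop
    have hsum : S * S + F * F = cfc (fun f : ℝ => (1 - |f|) * (1 - |f|) + f * f) F := by
      rw [cfc_add (a := F) (fun f : ℝ => (1 - |f|) * (1 - |f|)) (fun f => f * f),
        cfc_mul (fun f : ℝ => 1 - |f|) (fun f : ℝ => 1 - |f|) F, hSF,
        cfc_mul (fun f : ℝ => f) (fun f : ℝ => f) F, cfc_id' ℝ F]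
    have hpos : ∀ f : ℝ, (1 - |f|) * (1 - |f|) + f * f ≠ 0 := fun f => by
      have := abs_mul_abs_self f
      nlinarith [sq_nonneg (2 * |f| - 1)]
    have hcinv : Continuous fun f : ℝ => ((1 - |f|) * (1 - |f|) + f * f)⁻¹ := hcF.inv₀ hpos
    -- S² + F² is invertible since (1-t)² + t² ≥ 1/2. Because Fx = SXx, the vector w = (S²+F²)⁻¹(Sx
    -- + FXx) satisfies Sw = x; this recovers x without inverting S.
    let W : H →L[ℂ] H := cfc (fun f : ℝ => ((1 - |f|) * (1 - |f|) + f * f)⁻¹) F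
    have hW : W * (S * S + F * F) = 1 := by
      rw [hsum, ← cfc_mul _ _ F hcinv.continuousOn hcF.continuousOn, ← cfc_const_one ℝ F]
      exact cfc_congr fun f _ => inv_mul_cancel₀ (hpos f)
    have hWS : Commute S W := by
      rw [← hSF]
      exact cfc_commute_cfc _ _ F
    have hSFc : S * F = F * S := by
      have := cfc_commute_cfc (fun f : ℝ => 1 - |f|) id F
      rw [cfc_id ℝ F, hSF] at this
      exact this
    refine ⟨W (S x + F (X ⟨x, hx⟩)), ?_⟩
    calc S (W (S x + F (X ⟨x, hx⟩))) = W (S (S x + F (X ⟨x, hx⟩))) :=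
          congrArg (fun T : H →L[ℂ] H => T _) hWS.eq
      _ = W ((S * S + F * F) x) := by
        congr 1
        change S (S x + F (X ⟨x, hx⟩)) = S (S x) + F (F x)
        rw [map_add, h1]
        congr 1
        exact congrArg (fun T : H →L[ℂ] H => T _) hSFc
      _ = x := congrArg (fun T : H →L[ℂ] H => T x) hW

section

variable {X : H →ₗ.[ℂ] H} {F : H →L[ℂ] H}

theorem IsTransform.abs_le_one (h : IsTransform X F) {f : ℝ} (hf : f ∈ spectrum ℝ F) : |f| ≤ 1 := by
  have h1 : 1 - |f| ∈ spectrum ℝ (cfc (fun f : ℝ => 1 - |f|) F) := by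
    rw [cfc_map_spectrum (fun f : ℝ => 1 - |f|) F h.isSelfAdjoint]
    exact Set.mem_image_of_mem _ hf
  have := (h.isRes.spectrum_subset h1).1
  linarith

theorem IsTransform.ae_abs_lt_one (h : IsTransform X F) (u : H) :
    ∀ᵐ f ∂(specMeasure F u), |f| < 1 := by
  filter_upwards [ae_mem_spectrum h.isSelfAdjoint u,
    ae_cfc_ne_zero h.isSelfAdjoint (f := fun f : ℝ => 1 - |f|) (by fun_prop)
      h.isRes.injective u] with f h1 h2
  exact lt_of_le_of_ne (h.abs_le_one h1) fun h3 => h2 (by rw [h3, sub_self])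

theorem IsTransform.isRes_pos (h : IsTransform X F) : IsRes (cfc (fun f : ℝ => 1 - max f 0) F) := by
  refine isRes_cfc h.isSelfAdjoint (by fun_prop) (fun f hf => ?_) fun u => ?_
  · have := h.abs_le_one hf
    exact ⟨sub_nonneg.2 (max_le ((le_abs_self f).trans this) zero_le_one),
      sub_le_self _ (le_max_right _ _)⟩
  · filter_upwards [h.ae_abs_lt_one u] with f hf
    exact (sub_pos.2 (max_lt ((le_abs_self f).trans_lt hf) zero_lt_one)).ne'

theorem square_neg (X : H →ₗ.[ℂ] H) : square (-X) = square X := by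
  have key : ∀ x, x ∈ (square (-X)).domain ↔ x ∈ (square X).domain := fun x => by
    rw [mem_square_domain, mem_square_domain]
    refine exists_congr fun h => ?_
    rw [LinearPMap.neg_apply]
    exact neg_mem_iff
  refine LinearPMap.ext (Submodule.ext key) fun x hx hx' => ?_
  obtain ⟨h1, h2⟩ := mem_square_domain.1 hx'
  have h3 : (-X) ⟨x, h1⟩ ∈ (-X).domain := by
    rw [LinearPMap.neg_apply]
    exact neg_mem h2
  rw [square_apply hx' h1 h2, square_apply hx h1 h3, LinearPMap.neg_apply]
  have : (⟨(-X) ⟨x, h1⟩, h3⟩ : X.domain) = -⟨X ⟨x, h1⟩, h2⟩ := Subtype.ext (LinearPMap.neg_apply _ _)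
  rw [this, LinearPMap.map_neg, neg_neg]

theorem IsTransform.neg (h : IsTransform X F) : IsTransform (-X) (-F) := by
  have hS : cfc (fun f : ℝ => 1 - |f|) (-F) = cfc (fun f : ℝ => 1 - |f|) F := by
    rw [← cfc_comp_neg (fun f : ℝ => 1 - |f|) F (ha := h.isSelfAdjoint)]
    simp only [abs_neg]
  refine ⟨h.isSelfAdjoint.neg, ?_, ?_, ?_, ?_⟩
  · rw [hS]; exact h.isRes
  · rw [hS, ← h.absOp_eq, absOp, absOp, square_neg]
  · rw [hS]
    intro w
    obtain ⟨h1, h2⟩ := h.apply_eq w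
    exact ⟨h1, by rw [LinearPMap.neg_apply, h2]; rfl⟩
  · rw [hS]; exact h.exists_eq

/-- The resolvent of |X| factors as S = S₊S₋, and (1 - S + F)/2 = (1 - S₊)S₋. So (|X|+X)/2 maps
S₊(S₋w) to (1 - S₊)S₋w: it is the restriction of S₊⁻¹ - 1 to S₊(ran S₋). As ran S₋ is dense, its
closure is all of S₊⁻¹ - 1. -/
theorem IsTransform.positivePart_eq (h : IsTransform X F) :
    positivePart X = op (cfc (fun f : ℝ => 1 - max f 0) F) := by
  have hsa := h.isSelfAdjoint
  set S : H →L[ℂ] H := cfc (fun f : ℝ => 1 - |f|) F with hS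
  set Sp : H →L[ℂ] H := cfc (fun f : ℝ => 1 - max f 0) F with hSp
  set Sm : H →L[ℂ] H := cfc (fun f : ℝ => 1 - max (-f) 0) F with hSm
  have hinj := h.isRes.injective
  have hpinj := h.isRes_pos.injective
  have hmul : S = Sp * Sm := by
    rw [hSp, hSm, ← cfc_mul (fun f : ℝ => 1 - max f 0) (fun f : ℝ => 1 - max (-f) 0) F]
    refine cfc_congr fun f _ => ?_
    rcases le_total 0 f with hf | hf
    · simp [abs_of_nonneg hf, hf]
    · simp [abs_of_nonpos hf, hf]
  have hhalf : (1 / 2 : ℝ) • ((1 - S) + F) = (1 - Sp) * Sm := by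
    have e1 : (1 / 2 : ℝ) • ((1 - S) + F) = cfc (fun f : ℝ => 1 / 2 * ((1 - (1 - |f|)) + f)) F := by
      rw [cfc_const_mul (1 / 2 : ℝ) (fun f : ℝ => (1 - (1 - |f|)) + f) F,
        cfc_add (a := F) (fun f : ℝ => 1 - (1 - |f|)) (fun f => f), cfc_id' ℝ F,
        cfc_sub (fun _ => 1) (fun f : ℝ => 1 - |f|) F, cfc_const_one ℝ F]
    have e2 : (1 - Sp) * Sm = cfc (fun f : ℝ => (1 - (1 - max f 0)) * (1 - max (-f) 0)) F := by
      rw [cfc_mul (fun f : ℝ => 1 - (1 - max f 0)) (fun f : ℝ => 1 - max (-f) 0) F,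
        cfc_sub (fun _ => 1) (fun f : ℝ => 1 - max f 0) F, cfc_const_one ℝ F]
    rw [e1, e2]
    refine cfc_congr fun f _ => ?_
    rcases le_total 0 f with hf | hf
    · simp only [abs_of_nonneg hf, max_eq_left hf, max_eq_right (neg_nonpos.2 hf)]
      ring
    · simp only [abs_of_nonpos hf, max_eq_right hf, max_eq_left (neg_nonneg.2 hf)]
      ring
  have hSmd : DenseRange Sm := by
    refine dense_range_of_injective (isSelfAdjoint_cfc _ _) fun v w hvw => hinj ?_
    rw [← hS, hmul]
    exact congrArg Sp hvw
  let L : H →ₗ.[ℂ] H := (1 / 2 : ℂ) • (absOp X + X)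
  have hLdom : ∀ x, x ∈ L.domain ↔ ∃ w, S w = x := fun x => by
    change x ∈ (absOp X).domain ⊓ X.domain ↔ _
    rw [Submodule.mem_inf, h.absOp_eq, mem_op_domain]
    refine ⟨fun h => h.1, fun hx => ⟨hx, ?_⟩⟩
    obtain ⟨w, rfl⟩ := hx
    exact (h.apply_eq w).1
  have hLapp : ∀ w (hw : S w ∈ L.domain), L ⟨S w, hw⟩ = Sm w - Sp (Sm w) := fun w hw => by
    obtain ⟨h1, h2⟩ := h.apply_eq w
    have h3 : S w ∈ (absOp X).domain := hw.1
    have h4 : absOp X ⟨S w, h3⟩ = w - S w := by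
      have key : ∀ B : H →ₗ.[ℂ] H, B = op S → ∀ hB : S w ∈ B.domain, B ⟨S w, hB⟩ = w - S w := by
        rintro B rfl hB
        exact op_apply hinj w hB
      exact key _ h.absOp_eq h3
    have h5 : L ⟨S w, hw⟩ = (1 / 2 : ℂ) • (absOp X ⟨S w, h3⟩ + X ⟨S w, h1⟩) := rfl
    rw [h5, h4, h2]
    have h6 := congrArg (fun T : H →L[ℂ] H => T w) hhalf
    change (1 / 2 : ℝ) • ((w - S w) + F w) = Sm w - Sp (Sm w) at h6
    rw [← h6, RCLike.real_smul_eq_coe_smul (K := ℂ)]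
    norm_num
  have hclosed : _root_.IsClosed ((op Sp).graph : Set (H × H)) :=
    (h.isRes_pos.isNonnegSelfAdjoint_op.1).isClosed
  have hmemop : ∀ v, (Sp v, v - Sp v) ∈ (op Sp).graph := fun v => by
    have hv : Sp v ∈ (op Sp).domain := mem_op_domain.2 ⟨v, rfl⟩
    rw [← op_apply hpinj v hv]
    exact (op Sp).mem_graph ⟨_, hv⟩
  have hgraph : L.graph.topologicalClosure = (op Sp).graph := by
    refine le_antisymm (Submodule.topologicalClosure_minimal _ ?_ hclosed) ?_
    · rintro ⟨a, b⟩ hab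
      obtain ⟨⟨x, hx⟩, hx1, hx2⟩ := (LinearPMap.mem_graph_iff L).1 hab
      obtain ⟨w, rfl⟩ := (hLdom x).1 hx
      rw [hLapp] at hx2
      simp only at hx1 hx2
      rw [← hx1, ← hx2, show S w = Sp (Sm w) from congrArg (fun T : H →L[ℂ] H => T w) hmul]
      exact hmemop _
    · rintro ⟨a, b⟩ hab
      obtain ⟨⟨x, hx⟩, hx1, hx2⟩ := (LinearPMap.mem_graph_iff (op Sp)).1 hab
      obtain ⟨v, rfl⟩ := mem_op_domain.1 hx
      rw [op_apply hpinj] at hx2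
      simp only at hx1 hx2
      rw [← hx1, ← hx2]
      refine hSmd.induction_on (p := fun v => (Sp v, v - Sp v) ∈ L.graph.topologicalClosure) v ?_
        fun w => ?_
      · exact L.graph.isClosed_topologicalClosure.preimage
          (Sp.continuous.prodMk (continuous_id.sub Sp.continuous))
      · refine L.graph.le_topologicalClosure ?_
        have hw : S w ∈ L.domain := (hLdom _).2 ⟨w, rfl⟩
        rw [← hLapp w hw, show Sp (Sm w) = S w from
          (congrArg (fun T : H →L[ℂ] H => T w) hmul).symm]
        exact L.mem_graph ⟨_, hw⟩
  have hcl : L.IsClosable := ⟨_, hgraph⟩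
  exact LinearPMap.eq_of_eq_graph (hcl.graph_closure_eq_closure_graph.symm.trans hgraph)

theorem IsTransform.negativePart_eq (h : IsTransform X F) :
    negativePart X = op (cfc (fun f : ℝ => 1 - max (-f) 0) F) := by
  rw [negativePart, h.neg.positivePart_eq,
    ← cfc_comp_neg (fun f : ℝ => 1 - max f 0) F (ha := h.isSelfAdjoint)]

theorem IsTransform.isRes_neg (h : IsTransform X F) :
    IsRes (cfc (fun f : ℝ => 1 - max (-f) 0) F) := by
  have := h.neg.isRes_pos
  rwa [← cfc_comp_neg (fun f : ℝ => 1 - max f 0) F (ha := h.isSelfAdjoint)] at this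

theorem isNonnegSelfAdjoint_positivePart (hX : IsSelfAdjoint X) :
    IsNonnegSelfAdjoint (positivePart X) := by
  obtain ⟨F, hF⟩ := exists_isTransform hX
  rw [hF.positivePart_eq]
  exact hF.isRes_pos.isNonnegSelfAdjoint_op

theorem IsTransform.form_positivePart (h : IsTransform X F) (u : H) :
    form (positivePart X) u = ∫⁻ f, ENNReal.ofReal (max f 0 / (1 - max f 0)) ∂(specMeasure F u) := by
  rw [h.positivePart_eq, h.isRes_pos.form_op, lintegral_specMeasure_cfc h.isSelfAdjoint (by fun_prop) u
    (by fun_prop)]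
  simp only [sub_sub_cancel]

theorem IsTransform.form_negativePart (h : IsTransform X F) (u : H) :
    form (negativePart X) u =
      ∫⁻ f, ENNReal.ofReal (max (-f) 0 / (1 - max (-f) 0)) ∂(specMeasure F u) := by
  rw [h.negativePart_eq, h.isRes_neg.form_op, lintegral_specMeasure_cfc h.isSelfAdjoint (by fun_prop) u
    (by fun_prop)]
  simp only [sub_sub_cancel]

theorem IsTransform.form_absOp (h : IsTransform X F) (u : H) :
    form (absOp X) u = ∫⁻ f, ENNReal.ofReal (|f| / (1 - |f|)) ∂(specMeasure F u) := by
  rw [h.absOp_eq, h.isRes.form_op, lintegral_specMeasure_cfc h.isSelfAdjoint (by fun_prop) u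
    (by fun_prop)]
  simp only [sub_sub_cancel]

end

/-! ### Hilbert–Schmidt norm and trace with values in [0, ∞] -/

section

variable {T : H →L[ℂ] H}

/-- The square of the Hilbert-Schmidt norm, with values in `[0, ∞]`. -/
def hsNormSq (T : H →L[ℂ] H) : ℝ≥0∞ := ∑' i, ‖T (basis H i)‖ₑ ^ 2

/-- The trace of a nonnegative bounded operator, with values in `[0, ∞]`. -/
def etrace (T : H →L[ℂ] H) : ℝ≥0∞ := ∑' i, ENNReal.ofReal (⟪basis H i, T (basis H i)⟫_ℂ).re

theorem enorm_sq_eq_tsum (x : H) : ‖x‖ₑ ^ 2 = ∑' i, ‖⟪basis H i, x⟫_ℂ‖ₑ ^ 2 := by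
  have h1 := (basis H).hasSum_inner_mul_inner x x
  have h2 : ∀ i, ⟪x, basis H i⟫_ℂ * ⟪basis H i, x⟫_ℂ = ((‖⟪basis H i, x⟫_ℂ‖ ^ 2 : ℝ) : ℂ) := fun i => by
    rw [← inner_conj_symm, Complex.conj_mul']
    norm_cast
  have h5 : ⟪x, x⟫_ℂ = ((‖x‖ ^ 2 : ℝ) : ℂ) := by
    rw [inner_self_eq_norm_sq_to_K]
    simp
  simp only [h2] at h1
  rw [h5, Complex.hasSum_ofReal] at h1
  have h4 := ENNReal.ofReal_tsum_of_nonneg (fun i => sq_nonneg ‖⟪basis H i, x⟫_ℂ‖) h1.summable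
  rw [h1.tsum_eq] at h4
  simpa only [ENNReal.ofReal_pow (norm_nonneg _), ofReal_norm] using h4

/-- Both sides sum the squared moduli of all matrix entries, in either order. Here this serves as
the cyclicity of the trace, tr(T*T) = tr(TT*). -/
theorem hsNormSq_star (T : H →L[ℂ] H) : hsNormSq (star T) = hsNormSq T := by
  have h1 : ∀ i j, ‖⟪basis H j, star T (basis H i)⟫_ℂ‖ₑ = ‖⟪basis H i, T (basis H j)⟫_ℂ‖ₑ := by
    intro i j
    rw [ContinuousLinearMap.star_eq_adjoint, ContinuousLinearMap.adjoint_inner_right,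
      ← inner_conj_symm]
    simp only [enorm_eq_nnnorm, RCLike.nnnorm_conj]
  unfold hsNormSq
  simp only [enorm_sq_eq_tsum (_ : H), h1]
  rw [ENNReal.tsum_comm]

theorem enorm_apply_sq_le (T : H →L[ℂ] H) (x : H) : ‖T x‖ₑ ^ 2 ≤ hsNormSq T * ‖x‖ₑ ^ 2 := by
  rw [← hsNormSq_star T, enorm_sq_eq_tsum (T x), hsNormSq, ← ENNReal.tsum_mul_right]
  refine ENNReal.tsum_le_tsum fun i => ?_
  rw [← mul_pow, ← ContinuousLinearMap.adjoint_inner_left]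
  exact pow_le_pow_left₀ zero_le (by
    simp only [← ofReal_norm, ← ENNReal.ofReal_mul (norm_nonneg _)]
    exact ENNReal.ofReal_le_ofReal (norm_inner_le_norm _ _)) 2

theorem re_inner_star_mul_self (T : H →L[ℂ] H) (x : H) : (⟪x, (star T * T) x⟫_ℂ).re = ‖T x‖ ^ 2 := by
  rw [mul_apply_eq_comp, ContinuousLinearMap.star_eq_adjoint, ContinuousLinearMap.adjoint_inner_right]
  exact inner_self_eq_norm_sq (𝕜 := ℂ) _

theorem etrace_star_mul_self (T : H →L[ℂ] H) : etrace (star T * T) = hsNormSq T := by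
  simp only [etrace, hsNormSq, re_inner_star_mul_self, ENNReal.ofReal_pow (norm_nonneg _), ofReal_norm]

theorem exists_sq_eq_of_nonneg (hT : 0 ≤ T) : ∃ V : H →L[ℂ] H, IsSelfAdjoint V ∧ V * V = T :=
  ⟨CFC.sqrt T, (CFC.sqrt_nonneg T).isSelfAdjoint, CFC.sqrt_mul_sqrt_self T hT⟩

/-- For T = V² with V self-adjoint, ‖T‖ ≤ ‖V‖², and ‖V‖² is at most the squared Hilbert–Schmidt norm
of V, which is tr T. -/
theorem enorm_le_etrace (hT : 0 ≤ T) : ‖T‖ₑ ≤ etrace T := by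
  obtain ⟨V, hV, rfl⟩ := exists_sq_eq_of_nonneg hT
  have h1 : etrace (V * V) = hsNormSq V := by
    rw [← etrace_star_mul_self, hV.star_eq]
  rw [h1]
  rcases eq_or_ne (hsNormSq V) ∞ with h | h
  · rw [h]; exact le_top
  have h2 : ‖V‖ ≤ √(hsNormSq V).toReal := by
    refine V.opNorm_le_bound (Real.sqrt_nonneg _) fun x => ?_
    refine le_of_sq_le_sq ?_ (by positivity)
    rw [mul_pow, Real.sq_sqrt ENNReal.toReal_nonneg]
    have h3 := ENNReal.toReal_mono (ENNReal.mul_ne_top h (by simp)) (enorm_apply_sq_le V x)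
    simpa using h3
  have h3 : ‖V * V‖ ≤ (hsNormSq V).toReal := by
    calc ‖V * V‖ ≤ ‖V‖ * ‖V‖ := norm_mul_le _ _
      _ ≤ √(hsNormSq V).toReal * √(hsNormSq V).toReal := by gcongr
      _ = _ := Real.mul_self_sqrt ENNReal.toReal_nonneg
  rw [← ofReal_norm]
  exact ENNReal.ofReal_le_of_le_toReal h3

/-- Compression by a contraction does not increase the trace. -/
theorem etrace_conj_le {C : H →L[ℂ] H} (hT : 0 ≤ T) (hC : ∀ x, ‖C x‖ ≤ ‖x‖) :
    etrace (C * T * star C) ≤ etrace T := by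
  obtain ⟨V, hV, rfl⟩ := exists_sq_eq_of_nonneg hT
  have h1 : C * (V * V) * star C = star (V * star C) * (V * star C) := by
    rw [star_mul, star_star, hV.star_eq]
    simp only [mul_assoc]
  have h2 : V * V = star V * V := by rw [hV.star_eq]
  rw [h1, etrace_star_mul_self, ← hsNormSq_star, h2, etrace_star_mul_self, star_mul, star_star,
    hV.star_eq]
  refine ENNReal.tsum_le_tsum fun i => pow_le_pow_left₀ zero_le ?_ 2
  rw [← ofReal_norm, ← ofReal_norm]
  exact ENNReal.ofReal_le_ofReal (hC _)

theorem re_inner_nonneg (hT : 0 ≤ T) (x : H) : 0 ≤ (⟪x, T x⟫_ℂ).re :=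
  ((ContinuousLinearMap.nonneg_iff_isPositive T).1 hT).re_inner_nonneg_right x

theorem isTraceClassBounded_iff (hT : 0 ≤ T) : IsTraceClassBounded T ↔ etrace T ≠ ∞ := by
  rw [IsTraceClassBounded, CFC.abs_of_nonneg T hT, etrace]
  refine ⟨fun h => ?_, fun h => ?_⟩
  · rw [← ENNReal.ofReal_tsum_of_nonneg (fun i => re_inner_nonneg hT _) h]
    exact ENNReal.ofReal_ne_top
  · refine (ENNReal.summable_toReal h).congr fun i => ?_
    rw [ENNReal.toReal_ofReal (re_inner_nonneg hT _)]

theorem re_traceBounded_eq (hT : 0 ≤ T) :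
    (traceBounded T).re = ∑' i, (⟪basis H i, T (basis H i)⟫_ℂ).re := by
  have h0 : ∀ i, ⟪basis H i, T (basis H i)⟫_ℂ = (((⟪basis H i, T (basis H i)⟫_ℂ).re : ℝ) : ℂ) := by
    intro i
    have := ((ContinuousLinearMap.nonneg_iff_isPositive T).1 hT).inner_nonneg_right (basis H i)
    exact (Complex.eq_re_of_ofReal_le (r := 0) (by simpa using this))
  rw [traceBounded, tsum_congr h0, ← Complex.ofReal_tsum, Complex.ofReal_re]

theorem ofReal_re_traceBounded (hT : 0 ≤ T) (h : IsTraceClassBounded T) :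
    ENNReal.ofReal (traceBounded T).re = etrace T := by
  rw [IsTraceClassBounded, CFC.abs_of_nonneg T hT] at h
  rw [re_traceBounded_eq hT, etrace, ENNReal.ofReal_tsum_of_nonneg (fun i => re_inner_nonneg hT _) h]

theorem toPMap_injective {S T : H →L[ℂ] H}
    (h : (S : H →ₗ[ℂ] H).toPMap ⊤ = (T : H →ₗ[ℂ] H).toPMap ⊤) : S = T := by
  ext x
  have key : ∀ A : H →ₗ.[ℂ] H, A = (T : H →ₗ[ℂ] H).toPMap ⊤ → ∀ hx : x ∈ A.domain, A ⟨x, hx⟩ = T x := by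
    rintro A rfl hx
    rfl
  exact key _ h trivial

theorem isTraceClass_toPMap (h : IsTraceClassBounded T) :
    IsTraceClass ((T : H →ₗ[ℂ] H).toPMap ⊤) := ⟨T, rfl, h⟩

theorem trace_toPMap (h : IsTraceClassBounded T) :
    trace ((T : H →ₗ[ℂ] H).toPMap ⊤) = traceBounded T := by
  have h1 := isTraceClass_toPMap h
  rw [trace, dif_pos h1, ← toPMap_injective h1.choose_spec.1]

/-- Needed to exchange sums over the basis with integrals over l. Basis vectors are at distance √2,
so the balls of radius 1/2 around them are disjoint. -/
theorem countable_basisIndex [TopologicalSpace.SeparableSpace H] : Countable (basisIndex H) := by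
  have h := (basis H).orthonormal
  refine Pairwise.countable_of_isOpen_disjoint (s := fun i => Metric.ball (basis H i) (1 / 2)) ?_
    (fun _ => Metric.isOpen_ball) fun i => Metric.nonempty_ball.2 (by norm_num)
  intro i j hij
  refine Metric.ball_disjoint_ball ?_
  have h1 : dist (basis H i) (basis H j) ^ 2 = 2 := by
    rw [dist_eq_norm, @norm_sub_sq ℂ, h.1 i, h.1 j, h.2 hij]
    norm_num
  nlinarith [dist_nonneg (x := basis H i) (y := basis H j)]

end

/-! ### Resolvents under a bounded nonnegative perturbation -/

section

variable {R S V W : H →L[ℂ] H} {l : ℝ}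

/-- For `r = (1 + a)⁻¹`, this is `(a + l)⁻¹`. -/
def resFun (l r : ℝ) : ℝ := r / (1 - r + l * r)

theorem resFun_denom_pos (hl : 0 < l) {r : ℝ} (hr : r ∈ Set.Icc (0 : ℝ) 1) :
    0 < 1 - r + l * r := by
  rcases eq_or_lt_of_le hr.1 with h | h
  · rw [← h]; norm_num
  · have := mul_pos hl h
    linarith [hr.2]

theorem continuousOn_resFun (hl : 0 < l) : ContinuousOn (resFun l) (Set.Icc 0 1) := by
  refine ContinuousOn.div (by fun_prop) (by fun_prop) fun r hr => (resFun_denom_pos hl hr).ne'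

theorem resFun_nonneg (hl : 0 < l) {r : ℝ} (hr : r ∈ Set.Icc (0 : ℝ) 1) : 0 ≤ resFun l r :=
  div_nonneg hr.1 (resFun_denom_pos hl hr).le

theorem mul_resFun_le_one (hl : 0 < l) {r : ℝ} (hr : r ∈ Set.Icc (0 : ℝ) 1) :
    l * resFun l r ≤ 1 := by
  rw [resFun, ← mul_div_assoc, div_le_one (resFun_denom_pos hl hr)]
  linarith [hr.2]

/-- The operator `(A + l)⁻¹` in terms of `R = (1 + A)⁻¹`. -/
def resolvAt (R : H →L[ℂ] H) (l : ℝ) : H →L[ℂ] H := cfc (resFun l) R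

theorem isSelfAdjoint_resolvAt : IsSelfAdjoint (resolvAt R l) := isSelfAdjoint_cfc _ _

theorem IsRes.resolvAt_nonneg (hR : IsRes R) (hl : 0 < l) : 0 ≤ resolvAt R l :=
  cfc_nonneg fun _ hr => resFun_nonneg hl (hR.spectrum_subset hr)

theorem inner_resolvAt_left (v w : H) : ⟪resolvAt R l v, w⟫_ℂ = ⟪v, resolvAt R l w⟫_ℂ :=
  inner_cfc_left _ _ _ _

theorem re_inner_apply_eq {T : H →L[ℂ] H} (hT : IsSelfAdjoint T) (v w : H) :
    (⟪T v, w⟫_ℂ).re = (⟪v, T w⟫_ℂ).re := congrArg Complex.re (hT.isSymmetric v w)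

/-- `l (A + l)⁻² ≤ (A + l)⁻¹`. -/
theorem IsRes.mul_norm_resolvAt_sq_le (hR : IsRes R) (hl : 0 < l) (x : H) :
    l * ‖resolvAt R l x‖ ^ 2 ≤ (⟪x, resolvAt R l x⟫_ℂ).re := by
  have hc := hR.continuousOn (continuousOn_resFun hl)
  have hsa := hR.isSelfAdjoint
  rw [resolvAt, norm_cfc_apply_sq hc, ← integral_specMeasure hsa (f := fun r => resFun l r ^ 2)
    (hc.pow 2), ← integral_specMeasure hsa hc, ← integral_const_mul]
  refine integral_mono_ae ((integrable_specMeasure hsa (f := fun r => resFun l r ^ 2)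
    (hc.pow 2) x).const_mul l) (integrable_specMeasure hsa hc x) ?_
  filter_upwards [ae_mem_spectrum hsa x] with r hr
  have h1 := mul_resFun_le_one hl (hR.spectrum_subset hr)
  have h2 := resFun_nonneg hl (hR.spectrum_subset hr)
  calc l * resFun l r ^ 2 = (l * resFun l r) * resFun l r := by ring
    _ ≤ resFun l r := mul_le_of_le_one_left h2 h1

/-- `(A + l)⁻¹ ≤ l⁻¹`. -/
theorem IsRes.re_inner_resolvAt_le (hR : IsRes R) (hl : 0 < l) (x : H) :
    (⟪x, resolvAt R l x⟫_ℂ).re ≤ l⁻¹ * ‖x‖ ^ 2 := by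
  have hc := hR.continuousOn (continuousOn_resFun hl)
  have hsa := hR.isSelfAdjoint
  have h1 : ‖x‖ ^ 2 = (⟪x, cfc (fun _ : ℝ => (1 : ℝ)) R x⟫_ℂ).re := by
    rw [cfc_const_one ℝ R]
    exact (inner_self_eq_norm_sq (𝕜 := ℂ) x).symm
  rw [h1, resolvAt, ← integral_specMeasure hsa hc, ← integral_specMeasure hsa continuousOn_const,
    ← integral_const_mul]
  refine integral_mono_ae (integrable_specMeasure hsa hc x)
    ((integrable_specMeasure hsa continuousOn_const x).const_mul _) ?_
  filter_upwards [ae_mem_spectrum hsa x] with r hr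
  rw [mul_one, ← one_div, le_div_iff₀' hl]
  exact mul_resFun_le_one hl (hR.spectrum_subset hr)

/-- The operator `(1 + W)⁻¹`. -/
def invOneAddBdd (W : H →L[ℂ] H) : H →L[ℂ] H := cfc (fun w : ℝ => (1 + w)⁻¹) W

theorem continuousOn_inv_one_add (hW : 0 ≤ W) :
    ContinuousOn (fun w : ℝ => (1 + w)⁻¹) (spectrum ℝ W) := by
  refine ContinuousOn.inv₀ (by fun_prop) fun w hw => ?_
  have := spectrum_nonneg_of_nonneg hW hw
  positivity

theorem invOneAddBdd_mul (hW : 0 ≤ W) : invOneAddBdd W * (1 + W) = 1 := by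
  have hsa := IsSelfAdjoint.of_nonneg hW
  have h1 : 1 + W = cfc (fun w : ℝ => 1 + w) W := by
    rw [cfc_add (a := W) (fun _ => (1 : ℝ)) (fun w => w), cfc_const_one ℝ W, cfc_id' ℝ W]
  rw [h1, invOneAddBdd, ← cfc_mul _ _ W (continuousOn_inv_one_add hW), ← cfc_const_one ℝ W]
  refine cfc_congr fun w hw => inv_mul_cancel₀ ?_
  have := spectrum_nonneg_of_nonneg hW hw
  positivity

theorem mul_invOneAddBdd (hW : 0 ≤ W) : (1 + W) * invOneAddBdd W = 1 := by
  have hsa := IsSelfAdjoint.of_nonneg hW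
  have h1 := congrArg star (invOneAddBdd_mul hW)
  rwa [star_mul, star_one, star_add, star_one, hsa.star_eq, invOneAddBdd,
    (isSelfAdjoint_cfc _ _).star_eq] at h1

theorem invOneAddBdd_nonneg (hW : 0 ≤ W) : 0 ≤ invOneAddBdd W :=
  cfc_nonneg fun w hw => by
    have := spectrum_nonneg_of_nonneg hW hw
    positivity

theorem invOneAddBdd_anti {U : H →L[ℂ] H} (hW : 0 ≤ W) (hWU : W ≤ U) :
    invOneAddBdd U ≤ invOneAddBdd W := by
  have hU := hW.trans hWU
  let a : (H →L[ℂ] H)ˣ := ⟨1 + W, invOneAddBdd W, mul_invOneAddBdd hW, invOneAddBdd_mul hW⟩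
  let b : (H →L[ℂ] H)ˣ := ⟨1 + U, invOneAddBdd U, mul_invOneAddBdd hU, invOneAddBdd_mul hU⟩
  exact CStarAlgebra.inv_le_inv (a := a) (b := b) (add_nonneg zero_le_one hW)
    (add_le_add_right hWU 1)

theorem invOneAddBdd_smul (hW : 0 ≤ W) {c : ℝ} (hc : 0 ≤ c) :
    invOneAddBdd (c • W) = cfc (fun y : ℝ => (1 + c * y)⁻¹) W := by
  have hsa := IsSelfAdjoint.of_nonneg hW
  have h1 : c • W = cfc (fun y : ℝ => c * y) W := (cfc_const_mul_id c W hsa).symm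
  rw [invOneAddBdd, h1]
  refine (cfc_comp' (fun w : ℝ => (1 + w)⁻¹) (fun y : ℝ => c * y) W ?_ (by fun_prop) hsa).symm
  refine ContinuousOn.inv₀ (by fun_prop) ?_
  rintro _ ⟨y, hy, rfl⟩
  have := spectrum_nonneg_of_nonneg hW hy
  positivity

/-- The operator `V (A + l)⁻¹ V`. -/
def sandwich (R V : H →L[ℂ] H) (l : ℝ) : H →L[ℂ] H := V * resolvAt R l * V

/-- The difference `(A + l)⁻¹ - (A + V ^ 2 + l)⁻¹`. -/
def resDiff (R V : H →L[ℂ] H) (l : ℝ) : H →L[ℂ] H :=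
  resolvAt R l * V * invOneAddBdd (sandwich R V l) * V * resolvAt R l

theorem IsRes.sandwich_nonneg (hR : IsRes R) (hV : IsSelfAdjoint V) (hl : 0 < l) :
    0 ≤ sandwich R V l := by
  have := star_left_conjugate_nonneg (hR.resolvAt_nonneg hl) V
  rwa [hV.star_eq] at this

theorem IsRes.resDiff_nonneg (hR : IsRes R) (hV : IsSelfAdjoint V) (hl : 0 < l) :
    0 ≤ resDiff R V l := by
  have := star_left_conjugate_nonneg (invOneAddBdd_nonneg (hR.sandwich_nonneg hV hl))
    (V * resolvAt R l)
  rw [star_mul, hV.star_eq, isSelfAdjoint_resolvAt.star_eq] at this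
  simpa only [resDiff, mul_assoc] using this

/-- With G = (A+l)⁻¹, W = VGV and N = (1+W)^(-1/2), the operator is CC* for C = GVN, so its trace
equals that of C*C. Using lG² ≤ G, l C*C ≤ NWN = 1 - (1+W)⁻¹. Since W ≤ V²/l and inversion is
antitone, this is at most 1 - (1+V²/l)⁻¹ = V²/(l+V²). -/
theorem IsRes.etrace_resDiff_le (hR : IsRes R) (hV : IsSelfAdjoint V) (hl : 0 < l) :
    ENNReal.ofReal l * etrace (resDiff R V l) ≤
      etrace (cfc (fun y : ℝ => y / (l + y)) (V * V)) := by
  have hW := hR.sandwich_nonneg hV hl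
  have hVV : 0 ≤ V * V := by
    have := star_mul_self_nonneg V
    rwa [hV.star_eq] at this
  set W := sandwich R V l with hWdef
  have hWsa := IsSelfAdjoint.of_nonneg hW
  have hNc : ContinuousOn (fun w : ℝ => √((1 + w)⁻¹)) (spectrum ℝ W) :=
    (continuousOn_inv_one_add hW).sqrt
  set N : H →L[ℂ] H := cfc (fun w : ℝ => √((1 + w)⁻¹)) W with hNdef
  have hN : IsSelfAdjoint N := isSelfAdjoint_cfc _ _
  have hNN : N * N = invOneAddBdd W := by
    rw [hNdef, ← cfc_mul _ _ W hNc hNc]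
    refine cfc_congr fun w hw => Real.mul_self_sqrt ?_
    have := spectrum_nonneg_of_nonneg hW hw
    positivity
  have hNW : Commute N W := by
    have := cfc_commute_cfc (fun w : ℝ => √((1 + w)⁻¹)) id W
    rwa [cfc_id ℝ W] at this
  set A : H →L[ℂ] H := resolvAt R l * V * N with hA
  have hAs : star A = N * V * resolvAt R l := by
    rw [hA, star_mul, star_mul, hN.star_eq, hV.star_eq, isSelfAdjoint_resolvAt.star_eq, mul_assoc]
  have h1 : resDiff R V l = star (star A) * star A := by
    rw [star_star, hAs, hA, resDiff, ← hWdef, ← hNN]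
    simp only [mul_assoc]
  have h2 : ∀ x, l * ‖A x‖ ^ 2 ≤ (⟪x, (1 - invOneAddBdd W) x⟫_ℂ).re := by
    intro x
    refine (hR.mul_norm_resolvAt_sq_le hl (V (N x))).trans (le_of_eq ?_)
    have h3 : 1 - invOneAddBdd W = N * (W * N) := by
      rw [← hNW.eq, ← mul_assoc, hNN, ← invOneAddBdd_mul hW, mul_add, mul_one, add_sub_cancel_left]
    rw [h3]
    change _ = (⟪x, N (W (N x))⟫_ℂ).re
    rw [← re_inner_apply_eq hN, hWdef]
    change _ = (⟪N x, V (resolvAt R l (V (N x)))⟫_ℂ).re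
    rw [← re_inner_apply_eq hV]
  have h4 : ∀ x, (⟪x, (1 - invOneAddBdd W) x⟫_ℂ).re ≤
      (⟪x, cfc (fun y : ℝ => y / (l + y)) (V * V) x⟫_ℂ).re := by
    intro x
    have hle : W ≤ l⁻¹ • (V * V) := by
      rw [ContinuousLinearMap.le_def, ContinuousLinearMap.isPositive_def']
      refine ⟨(IsSelfAdjoint.smul (IsSelfAdjoint.all _) (IsSelfAdjoint.of_nonneg hVV)).sub hWsa,
        fun x => ?_⟩
      have h5 := hR.re_inner_resolvAt_le hl (V x)
      rw [ContinuousLinearMap.reApplyInnerSelf_apply]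
      change 0 ≤ (⟪l⁻¹ • V (V x) - V (resolvAt R l (V x)), x⟫_ℂ).re
      rw [inner_sub_left, Complex.sub_re, re_inner_apply_eq hV, inner_smul_left_eq_smul,
        Complex.smul_re, re_inner_apply_eq hV, inner_resolvAt_left]
      have h6 : (⟪V x, V x⟫_ℂ).re = ‖V x‖ ^ 2 := inner_self_eq_norm_sq (𝕜 := ℂ) _
      rw [h6, smul_eq_mul]
      linarith
    have h5 := invOneAddBdd_anti hW hle
    have h6 : cfc (fun y : ℝ => y / (l + y)) (V * V) = 1 - invOneAddBdd (l⁻¹ • (V * V)) := by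
      have hsa := IsSelfAdjoint.of_nonneg hVV
      have hnn : ∀ y ∈ spectrum ℝ (V * V), 1 + l⁻¹ * y ≠ 0 := fun y hy => by
        have := spectrum_nonneg_of_nonneg hVV hy
        positivity
      have hc : ContinuousOn (fun y : ℝ => (1 + l⁻¹ * y)⁻¹) (spectrum ℝ (V * V)) :=
        ContinuousOn.inv₀ (by fun_prop) hnn
      rw [invOneAddBdd_smul hVV (inv_nonneg.2 hl.le), ← cfc_const_one ℝ (V * V),
        ← cfc_sub (fun _ => (1 : ℝ)) _ (V * V) continuousOn_const hc]
      refine cfc_congr fun y hy => ?_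
      have h7 := spectrum_nonneg_of_nonneg hVV hy
      have h8 := hnn y hy
      have h9 : l + y ≠ 0 := by positivity
      have h10 : 1 + l⁻¹ * y = (l + y) / l := by field_simp
      simp only [h10]
      field_simp
      ring
    rw [h6]
    have h7 : 0 ≤ (1 - invOneAddBdd (l⁻¹ • (V * V))) - (1 - invOneAddBdd W) := by
      rw [sub_sub_sub_cancel_left]
      exact sub_nonneg.2 h5
    have h8 := re_inner_nonneg h7 x
    rw [sub_apply, inner_sub_right, Complex.sub_re] at h8
    linarith
  rw [h1, etrace_star_mul_self, hsNormSq_star, hsNormSq, ← ENNReal.tsum_mul_left, etrace]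
  refine ENNReal.tsum_le_tsum fun i => ?_
  rw [← ofReal_norm, ← ENNReal.ofReal_pow (norm_nonneg _), ← ENNReal.ofReal_mul hl.le]
  exact ENNReal.ofReal_le_ofReal ((h2 _).trans (h4 _))

/-- The form of `A` on the range of `(A + l)⁻¹`. -/
theorem IsRes.form_op_resolvAt (hR : IsRes R) (hl : 0 < l) (w : H) :
    form (op R) (resolvAt R l w) =
      ENNReal.ofReal ((⟪w, resolvAt R l w⟫_ℂ).re - l * ‖resolvAt R l w‖ ^ 2) := by
  have hc := hR.continuousOn (continuousOn_resFun hl)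
  have hc2 : ContinuousOn (fun r => resFun l r ^ 2) (spectrum ℝ R) := hc.pow 2
  have hsa := hR.isSelfAdjoint
  have h1 : (⟪w, resolvAt R l w⟫_ℂ).re - l * ‖resolvAt R l w‖ ^ 2 =
      ∫ r, (resFun l r - l * resFun l r ^ 2) ∂(specMeasure R w) := by
    rw [integral_sub (integrable_specMeasure hsa hc w)
      ((integrable_specMeasure hsa hc2 w).const_mul l), integral_const_mul,
      integral_specMeasure hsa hc, integral_specMeasure hsa hc2, resolvAt, norm_cfc_apply_sq hc]
  have h2 : Integrable (fun r => resFun l r - l * resFun l r ^ 2) (specMeasure R w) :=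
    (integrable_specMeasure hsa hc w).sub ((integrable_specMeasure hsa hc2 w).const_mul l)
  rw [h1, ofReal_integral_eq_lintegral_ofReal h2, hR.form_op, resolvAt,
    lintegral_specMeasure_cfc_apply hsa hc w (by fun_prop)]
  · refine lintegral_congr_ae ?_
    filter_upwards [hR.ae_mem_Ioc w] with r hr
    rw [← ENNReal.ofReal_mul (sq_nonneg _)]
    congr 1
    have h2 := resFun_denom_pos hl (Set.Ioc_subset_Icc_self hr)
    have h3 := hr.1.ne'
    rw [resFun]
    field_simp
    ring
  · filter_upwards [ae_mem_spectrum hsa w] with r hr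
    have h2 := mul_resFun_le_one hl (hR.spectrum_subset hr)
    have h3 := resFun_nonneg hl (hR.spectrum_subset hr)
    simp only [Pi.zero_apply]
    nlinarith

/-- Variational characterization of the resolvent. -/
theorem IsRes.two_mul_re_inner_le (hR : IsRes R) (hl : 0 < l) (u v : H) :
    ENNReal.ofReal (2 * (⟪u, v⟫_ℂ).re) ≤
      form (op R) u + ENNReal.ofReal (l * ‖u‖ ^ 2) + ENNReal.ofReal (⟪v, resolvAt R l v⟫_ℂ).re := by
  have hsa := hR.isSelfAdjoint
  have hc := hR.continuousOn (continuousOn_resFun hl)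
  -- (A+l)⁻¹ need not be boundedly invertible, so it is replaced by (A+l)⁻¹ + e with square root g.
  -- Then ⟨u,v⟩ = ⟨g⁻¹u, gv⟩ and the arithmetic-geometric inequality applies; finally e → 0.
  have key : ∀ e : ℝ, 0 < e → ENNReal.ofReal (2 * (⟪u, v⟫_ℂ).re) ≤
      form (op R) u + ENNReal.ofReal (l * ‖u‖ ^ 2) + ENNReal.ofReal (⟪v, resolvAt R l v⟫_ℂ).re +
        ENNReal.ofReal (e * ‖v‖ ^ 2) := by
    intro e he
    let g : ℝ → ℝ := fun r => √(resFun l r + e)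
    have hpos : ∀ r ∈ spectrum ℝ R, 0 < resFun l r + e := fun r hr =>
      add_pos_of_nonneg_of_pos (resFun_nonneg hl (hR.spectrum_subset hr)) he
    have hgpos : ∀ r ∈ spectrum ℝ R, 0 < g r := fun r hr => Real.sqrt_pos.2 (hpos r hr)
    have hg : ContinuousOn g (spectrum ℝ R) := (hc.add continuousOn_const).sqrt
    have hgi : ContinuousOn (fun r => (g r)⁻¹) (spectrum ℝ R) := hg.inv₀ fun r hr => (hgpos r hr).ne'
    have h1 : cfc (fun r => (g r)⁻¹) R * cfc g R = 1 := by
      rw [← cfc_mul _ _ R hgi hg, ← cfc_const_one ℝ R]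
      exact cfc_congr fun r hr => inv_mul_cancel₀ (hgpos r hr).ne'
    have h2 : 2 * (⟪u, v⟫_ℂ).re ≤ ‖cfc (fun r => (g r)⁻¹) R u‖ ^ 2 + ‖cfc g R v‖ ^ 2 := by
      have h3 : ⟪u, v⟫_ℂ = ⟪cfc (fun r => (g r)⁻¹) R u, cfc g R v⟫_ℂ := by
        rw [inner_cfc_left, ← mul_apply_eq_comp, h1]
        rfl
      rw [h3]
      have h4 := re_inner_le_norm (𝕜 := ℂ) (cfc (fun r => (g r)⁻¹) R u) (cfc g R v)
      simp only [RCLike.re_to_complex] at h4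
      nlinarith [sq_nonneg (‖cfc (fun r => (g r)⁻¹) R u‖ - ‖cfc g R v‖)]
    refine (ENNReal.ofReal_le_ofReal h2).trans ?_
    rw [ENNReal.ofReal_add (sq_nonneg _) (sq_nonneg _), add_assoc]
    refine add_le_add ?_ ?_
    · rw [ENNReal.ofReal_pow (norm_nonneg _), ofReal_norm, ← lintegral_specMeasure_sq hsa hgi,
        hR.form_op]
      have h3 : ENNReal.ofReal (l * ‖u‖ ^ 2) = ∫⁻ _, ENNReal.ofReal l ∂(specMeasure R u) := by
        rw [lintegral_const, specMeasure_univ hsa, ENNReal.ofReal_mul hl.le,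
          ENNReal.ofReal_pow (norm_nonneg _), ofReal_norm]
      rw [h3, ← lintegral_add_right _ measurable_const]
      refine lintegral_mono_ae ?_
      filter_upwards [ae_mem_spectrum hsa u, hR.ae_mem_Ioc u] with r hr hr'
      have h4 := resFun_denom_pos hl (Set.Ioc_subset_Icc_self hr')
      rw [← ENNReal.ofReal_add (div_nonneg (sub_nonneg.2 hr'.2) hr'.1.le) hl.le]
      refine ENNReal.ofReal_le_ofReal ?_
      rw [inv_pow, Real.sq_sqrt (hpos r hr).le]
      have h5 : (1 - r) / r + l = (resFun l r)⁻¹ := by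
        rw [resFun, inv_div]
        have := hr'.1.ne'
        field_simp
      rw [h5]
      exact inv_anti₀ (div_pos hr'.1 h4) (by linarith)
    · rw [ENNReal.ofReal_pow (norm_nonneg _), ofReal_norm, ← lintegral_specMeasure_sq hsa hg,
        resolvAt, ← lintegral_specMeasure hsa hc fun r hr => resFun_nonneg hl (hR.spectrum_subset hr)]
      have h3 : ENNReal.ofReal (e * ‖v‖ ^ 2) = ∫⁻ _, ENNReal.ofReal e ∂(specMeasure R v) := by
        rw [lintegral_const, specMeasure_univ hsa, ENNReal.ofReal_mul he.le,
          ENNReal.ofReal_pow (norm_nonneg _), ofReal_norm]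
      rw [h3, ← lintegral_add_right _ measurable_const]
      refine lintegral_mono_ae ?_
      filter_upwards [ae_mem_spectrum hsa v] with r hr
      rw [Real.sq_sqrt (hpos r hr).le, ENNReal.ofReal_add
        (resFun_nonneg hl (hR.spectrum_subset hr)) he.le]
  have ht : Tendsto (fun n : ℕ => form (op R) u + ENNReal.ofReal (l * ‖u‖ ^ 2) +
      ENNReal.ofReal (⟪v, resolvAt R l v⟫_ℂ).re + ENNReal.ofReal (1 / ((n : ℝ) + 1) * ‖v‖ ^ 2)) atTop
      (𝓝 (form (op R) u + ENNReal.ofReal (l * ‖u‖ ^ 2) +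
        ENNReal.ofReal (⟪v, resolvAt R l v⟫_ℂ).re + 0)) := by
    refine tendsto_const_nhds.add ?_
    have h1 := (tendsto_one_div_add_atTop_nhds_zero_nat (𝕜 := ℝ)).mul_const (‖v‖ ^ 2)
    have h2 := ENNReal.tendsto_ofReal h1
    rwa [zero_mul, ENNReal.ofReal_zero] at h2
  rw [add_zero] at ht
  exact ge_of_tendsto' ht fun n => key _ (by positivity)

/-- With A, B the operators encoded by R, S, the vector u = (A+V²+l)⁻¹v satisfies a[u] + ‖Vu‖² +
l‖u‖² = Re⟨v,u⟩. The variational bound for B gives 2 Re⟨u,v⟩ ≤ b[u] + l‖u‖² + ⟨v,(B+l)⁻¹v⟩, and the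
form hypothesis bounds the first two terms by Re⟨v,u⟩. So Re⟨v,u⟩ ≤ ⟨v,(B+l)⁻¹v⟩. -/
theorem IsRes.le_resolvAt (hR : IsRes R) (hS : IsRes S) (hV : IsSelfAdjoint V) (hl : 0 < l)
    (h : ∀ u, form (op S) u ≤ form (op R) u + ENNReal.ofReal (‖V u‖ ^ 2)) (v : H) :
    (⟪v, resolvAt R l v⟫_ℂ).re - (⟪v, resDiff R V l v⟫_ℂ).re ≤ (⟪v, resolvAt S l v⟫_ℂ).re := by
  set W := sandwich R V l with hWdef
  have hW : 0 ≤ W := hR.sandwich_nonneg hV hl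
  set M := invOneAddBdd W with hM
  -- Chosen so that w = v - V²u = (A+l)u. The identity Vu = (1+W)⁻¹VGv, with G = (A+l)⁻¹, follows
  -- from (1+W)(1+W)⁻¹ = 1.
  set w := v - V (M (V (resolvAt R l v))) with hw
  set u := resolvAt R l w with hu
  have hu1 : u = resolvAt R l v - resDiff R V l v := by
    rw [hu, hw, map_sub]
    rfl
  have hVu : V u = M (V (resolvAt R l v)) := by
    have h1 := congrArg (fun T : H →L[ℂ] H => T (V (resolvAt R l v))) (mul_invOneAddBdd hW)
    change M (V (resolvAt R l v)) + W (M (V (resolvAt R l v))) = V (resolvAt R l v) at h1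
    rw [hu, hw, map_sub, map_sub, sub_eq_iff_eq_add]
    exact h1.symm
  have hwu : (⟪w, u⟫_ℂ).re = (⟪v, u⟫_ℂ).re - ‖V u‖ ^ 2 := by
    rw [hw, ← hVu, inner_sub_left, Complex.sub_re, re_inner_apply_eq hV]
    congr 1
    exact inner_self_eq_norm_sq (𝕜 := ℂ) _
  have h0 := hR.mul_norm_resolvAt_sq_le hl w
  have h1 := hS.two_mul_re_inner_le hl u v
  have h2 := h u
  rw [hu, hR.form_op_resolvAt hl w, ← hu, hwu, ← ENNReal.ofReal_add (by rw [← hwu]; linarith)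
    (sq_nonneg _)] at h2
  have h3 := h1.trans (add_le_add_left (add_le_add_left h2 _) _)
  rw [← hu, hwu] at h0
  have h4 : 0 ≤ (⟪v, resolvAt S l v⟫_ℂ).re := re_inner_nonneg (hS.resolvAt_nonneg hl) v
  have h5 : 0 ≤ l * ‖u‖ ^ 2 := by positivity
  rw [← ENNReal.ofReal_add (by nlinarith [sq_nonneg ‖V u‖]) h5,
    ← ENNReal.ofReal_add (by nlinarith [sq_nonneg ‖V u‖]) h4,
    ENNReal.ofReal_le_ofReal_iff (by nlinarith [sq_nonneg ‖V u‖])] at h3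
  have h6 : (⟪v, u⟫_ℂ).re = (⟪u, v⟫_ℂ).re := by
    rw [← inner_conj_symm, Complex.conj_re]
  have h7 : (⟪v, u⟫_ℂ).re = (⟪v, resolvAt R l v⟫_ℂ).re - (⟪v, resDiff R V l v⟫_ℂ).re := by
    rw [hu1, inner_sub_right, Complex.sub_re]
  linarith

end

/-! ### Fractional powers as integrals over resolvents -/

section

variable {R S V W Y : H →L[ℂ] H} {s : ℝ}

/-- The normalization constant in `c t ^ s = ∫ l ^ (s - 1) t / (l + t) dl`. -/
def rpowConst (s : ℝ) : ℝ := ∫ l in Set.Ioi 0, Real.rpowIntegrand₀₁ s l 1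

theorem rpowConst_pos (hs : s ∈ Set.Ioo (0 : ℝ) 1) : 0 < rpowConst s :=
  Real.integral_rpowIntegrand₀₁_one_pos hs

theorem lintegral_rpow_kernel (hs : s ∈ Set.Ioo (0 : ℝ) 1) {x : ℝ} (hx : 0 ≤ x) :
    ∫⁻ l in Set.Ioi 0, ENNReal.ofReal (l ^ (s - 1)) * ENNReal.ofReal (x / (l + x)) =
      ENNReal.ofReal (rpowConst s) * ENNReal.ofReal (x ^ s) := by
  rw [← ENNReal.ofReal_mul (rpowConst_pos hs).le, mul_comm, rpowConst,
    ← Real.integral_rpowIntegrand₀₁_eq_rpow_mul_const hs hx,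
    ofReal_integral_eq_lintegral_ofReal (Real.integrableOn_rpowIntegrand₀₁_Ioi hs hx)]
  · refine setLIntegral_congr_fun measurableSet_Ioi fun l hl => ?_
    have hl0 : 0 < l := hl
    rw [Real.rpowIntegrand₀₁_eq_pow_div hs hl0.le hx, mul_div_assoc,
      ENNReal.ofReal_mul (Real.rpow_nonneg hl0.le _)]
  · exact ae_restrict_of_forall_mem measurableSet_Ioi fun l hl =>
      Real.rpowIntegrand₀₁_nonneg hs.1 (le_of_lt hl) hx

theorem lintegral_lintegral_rpow_kernel (hs : s ∈ Set.Ioo (0 : ℝ) 1) {μ : Measure ℝ} [SFinite μ]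
    {x : ℝ → ℝ} (hx : Measurable x) (h0 : ∀ᵐ y ∂μ, 0 ≤ x y) :
    ∫⁻ l in Set.Ioi 0, ENNReal.ofReal (l ^ (s - 1)) * ∫⁻ y, ENNReal.ofReal (x y / (l + x y)) ∂μ =
      ENNReal.ofReal (rpowConst s) * ∫⁻ y, ENNReal.ofReal (x y ^ s) ∂μ := by
  have h1 : ∀ l, ENNReal.ofReal (l ^ (s - 1)) * ∫⁻ y, ENNReal.ofReal (x y / (l + x y)) ∂μ =
      ∫⁻ y, ENNReal.ofReal (l ^ (s - 1)) * ENNReal.ofReal (x y / (l + x y)) ∂μ := fun l =>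
    (lintegral_const_mul _ (by fun_prop)).symm
  simp only [h1]
  rw [lintegral_lintegral_swap, ← lintegral_const_mul _ (by fun_prop)]
  · refine lintegral_congr_ae ?_
    filter_upwards [h0] with y hy using lintegral_rpow_kernel hs hy
  · refine Measurable.aemeasurable ?_
    simp only [Function.uncurry_def]
    fun_prop

theorem div_add_eq_one_sub_resFun {l r : ℝ} (hl : 0 < l) (hr : r ∈ Set.Ioc (0 : ℝ) 1) :
    (1 - r) / r / (l + (1 - r) / r) = 1 - l * resFun l r := by
  have h1 := resFun_denom_pos hl (Set.Ioc_subset_Icc_self hr)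
  have h2 := hr.1.ne'
  have h3 : l + (1 - r) / r = (1 - r + l * r) / r := by
    field_simp
    ring
  have h4 := h1.ne'
  rw [h3, resFun, div_div_div_cancel_right₀ h2, ← mul_div_assoc, one_sub_div h4]
  congr 1
  ring

theorem IsRes.lintegral_one_sub (hR : IsRes R) {l : ℝ} (hl : 0 < l) (u : H) :
    ∫⁻ r, ENNReal.ofReal ((1 - r) / r / (l + (1 - r) / r)) ∂(specMeasure R u) =
      ENNReal.ofReal (‖u‖ ^ 2 - l * (⟪u, resolvAt R l u⟫_ℂ).re) := by
  have hsa := hR.isSelfAdjoint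
  have hc := hR.continuousOn (continuousOn_resFun hl)
  have hc2 : ContinuousOn (fun r => 1 - l * resFun l r) (spectrum ℝ R) :=
    continuousOn_const.sub (continuousOn_const.mul hc)
  have h1 : ∫⁻ r, ENNReal.ofReal ((1 - r) / r / (l + (1 - r) / r)) ∂(specMeasure R u) =
      ∫⁻ r, ENNReal.ofReal (1 - l * resFun l r) ∂(specMeasure R u) := by
    refine lintegral_congr_ae ?_
    filter_upwards [hR.ae_mem_Ioc u] with r hr
    rw [div_add_eq_one_sub_resFun hl hr]
  rw [h1, lintegral_specMeasure hsa hc2 fun r hr =>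
    sub_nonneg.2 (mul_resFun_le_one hl (hR.spectrum_subset hr)),
    cfc_sub (fun _ => (1 : ℝ)) (fun r => l * resFun l r) R continuousOn_const
      (continuousOn_const.mul hc), cfc_const_one ℝ R, cfc_const_mul l (resFun l) R hc]
  congr 1
  rw [sub_apply, inner_sub_right, Complex.sub_re]
  congr 1
  · exact inner_self_eq_norm_sq (𝕜 := ℂ) u
  · rw [smul_apply, RCLike.real_smul_eq_coe_smul (K := ℂ), inner_smul_right]
    exact Complex.re_ofReal_mul _ _

/-- The form of `A ^ s` as an integral over resolvents of `A`. -/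
theorem IsRes.form_rpow_eq_lintegral (hR : IsRes R) (hs : s ∈ Set.Ioo (0 : ℝ) 1) (u : H) :
    ENNReal.ofReal (rpowConst s) * form (rpow (op R) s) u =
      ∫⁻ l in Set.Ioi 0, ENNReal.ofReal (l ^ (s - 1)) *
        ENNReal.ofReal (‖u‖ ^ 2 - l * (⟪u, resolvAt R l u⟫_ℂ).re) := by
  rw [hR.form_rpow hs.1, ← lintegral_lintegral_rpow_kernel hs (by fun_prop)]
  · refine setLIntegral_congr_fun measurableSet_Ioi fun l hl => ?_
    rw [hR.lintegral_one_sub hl]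
  · filter_upwards [hR.ae_mem_Ioc u] with r hr
    exact div_nonneg (sub_nonneg.2 hr.2) hr.1.le

theorem re_inner_cfc_div (hY : 0 ≤ Y) {l : ℝ} (hl : 0 < l) (u : H) :
    ENNReal.ofReal (⟪u, cfc (fun y : ℝ => y / (l + y)) Y u⟫_ℂ).re =
      ∫⁻ y, ENNReal.ofReal (y / (l + y)) ∂(specMeasure Y u) := by
  have hpos : ∀ y ∈ spectrum ℝ Y, 0 < l + y := fun y hy => by
    have := spectrum_nonneg_of_nonneg hY hy
    positivity
  rw [lintegral_specMeasure (IsSelfAdjoint.of_nonneg hY)]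
  · exact ContinuousOn.div (by fun_prop) (by fun_prop) fun y hy => (hpos y hy).ne'
  · exact fun y hy => div_nonneg (spectrum_nonneg_of_nonneg hY hy) (hpos y hy).le

theorem lintegral_etrace_eq [TopologicalSpace.SeparableSpace H] (hY : 0 ≤ Y)
    (hs : s ∈ Set.Ioo (0 : ℝ) 1) :
    ∫⁻ l in Set.Ioi 0, ENNReal.ofReal (l ^ (s - 1)) * etrace (cfc (fun y : ℝ => y / (l + y)) Y) =
      ENNReal.ofReal (rpowConst s) * etrace (cfc (fun y : ℝ => y ^ s) Y) := by
  have hsa := IsSelfAdjoint.of_nonneg hY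
  have := countable_basisIndex (H := H)
  have h1 : ∫⁻ l in Set.Ioi 0, ENNReal.ofReal (l ^ (s - 1)) *
        etrace (cfc (fun y : ℝ => y / (l + y)) Y) =
      ∫⁻ l in Set.Ioi 0, ∑' i, ENNReal.ofReal (l ^ (s - 1)) *
        ∫⁻ y, ENNReal.ofReal (y / (l + y)) ∂(specMeasure Y (basis H i)) := by
    refine setLIntegral_congr_fun measurableSet_Ioi fun l hl => ?_
    simp only [etrace]
    rw [ENNReal.tsum_mul_left]
    simp only [re_inner_cfc_div hY hl]
  rw [h1, lintegral_tsum, etrace, ← ENNReal.tsum_mul_left]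
  · refine tsum_congr fun i => ?_
    rw [lintegral_lintegral_rpow_kernel hs (x := fun y => y) measurable_id,
      lintegral_specMeasure hsa (f := fun y => y ^ s)]
    · exact (Real.continuous_rpow_const hs.1.le).continuousOn
    · exact fun y hy => Real.rpow_nonneg (spectrum_nonneg_of_nonneg hY hy) _
    · filter_upwards [ae_mem_spectrum hsa (basis H i)] with y hy
      exact spectrum_nonneg_of_nonneg hY hy
  · intro i
    refine Measurable.aemeasurable (Measurable.mul (by fun_prop) ?_)
    refine Measurable.lintegral_prod_right' (f := fun z : ℝ × ℝ => ENNReal.ofReal (z.2 / (z.1 + z.2))) ?_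
    fun_prop

/-- Expressing the resolvent through ring inversion makes its norm continuity in l visible, which
provides the measurability for the operator-valued integral defining K. -/
theorem IsRes.resolvAt_eq (hR : IsRes R) {l : ℝ} (hl : 0 < l) :
    IsUnit (1 - R + l • R) ∧ resolvAt R l = R * Ring.inverse (1 - R + l • R) := by
  have hsa := hR.isSelfAdjoint
  have h1 : 1 - R + l • R = cfc (fun r : ℝ => 1 - r + l * r) R := by
    rw [cfc_add (a := R) (fun r => 1 - r) (fun r => l * r), cfc_sub (fun _ => (1 : ℝ)) (fun r => r) R,
      cfc_const_mul l (fun r => r) R, cfc_const_one ℝ R, cfc_id' ℝ R]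
  have h2 : ∀ r ∈ spectrum ℝ R, 1 - r + l * r ≠ 0 := fun r hr =>
    (resFun_denom_pos hl (hR.spectrum_subset hr)).ne'
  refine ⟨?_, ?_⟩
  · rw [h1, isUnit_cfc_iff (fun r : ℝ => 1 - r + l * r) R]
    exact h2
  · rw [h1, ← cfc_inv (fun r : ℝ => 1 - r + l * r) R h2]
    nth_rw 2 [← cfc_id' ℝ R]
    rw [← cfc_mul (fun r => r) (fun r : ℝ => (1 - r + l * r)⁻¹) R continuousOn_id
      (ContinuousOn.inv₀ (by fun_prop) h2)]
    rfl

theorem IsRes.continuousOn_resolvAt (hR : IsRes R) :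
    ContinuousOn (fun l => resolvAt R l) (Set.Ioi 0) := by
  have h1 : ContinuousOn (fun l : ℝ => R * Ring.inverse (1 - R + l • R)) (Set.Ioi 0) := by
    intro l hl
    obtain ⟨a, ha⟩ := (hR.resolvAt_eq hl).1
    have h2 : ContinuousAt Ring.inverse (1 - R + l • R) := by
      rw [← ha]
      exact NormedRing.inverse_continuousAt a
    have h3 : ContinuousAt (fun l : ℝ => 1 - R + l • R) l := by fun_prop
    exact (continuousAt_const.mul (ContinuousAt.comp (f := fun l : ℝ => 1 - R + l • R) h2 h3)).continuousWithinAt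
  exact h1.congr fun l hl => (hR.resolvAt_eq hl).2

theorem invOneAddBdd_eq (hW : 0 ≤ W) : IsUnit (1 + W) ∧ invOneAddBdd W = Ring.inverse (1 + W) := by
  let a : (H →L[ℂ] H)ˣ := ⟨1 + W, invOneAddBdd W, mul_invOneAddBdd hW, invOneAddBdd_mul hW⟩
  exact ⟨⟨a, rfl⟩, (Ring.inverse_unit a).symm⟩

theorem IsRes.continuousOn_resDiff (hR : IsRes R) (hV : IsSelfAdjoint V) :
    ContinuousOn (fun l => resDiff R V l) (Set.Ioi 0) := by
  have h1 := hR.continuousOn_resolvAt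
  have h2 : ContinuousOn (fun l => sandwich R V l) (Set.Ioi 0) :=
    (continuousOn_const.mul h1).mul continuousOn_const
  have h3 : ContinuousOn (fun l => Ring.inverse (1 + sandwich R V l)) (Set.Ioi 0) := by
    intro l hl
    obtain ⟨a, ha⟩ := (invOneAddBdd_eq (hR.sandwich_nonneg hV hl)).1
    have h4 : ContinuousAt Ring.inverse (1 + sandwich R V l) := by
      rw [← ha]
      exact NormedRing.inverse_continuousAt a
    exact ContinuousAt.comp_continuousWithinAt (f := fun l => 1 + sandwich R V l) h4
      (continuousWithinAt_const.add (h2 l hl))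
  have h4 : ContinuousOn (fun l => invOneAddBdd (sandwich R V l)) (Set.Ioi 0) :=
    h3.congr fun l hl => (invOneAddBdd_eq (hR.sandwich_nonneg hV hl)).2
  exact (((h1.mul continuousOn_const).mul h4).mul continuousOn_const).mul h1

/-- The real-linear functional `T ↦ Re ⟨u, T u⟩`. -/
def reInnerCLM (u : H) : (H →L[ℂ] H) →L[ℝ] ℝ :=
  Complex.reCLM ∘L ((innerSL ℂ u).restrictScalars ℝ) ∘L
    ((ContinuousLinearMap.apply ℂ H u).restrictScalars ℝ)

theorem reInnerCLM_apply (u : H) (T : H →L[ℂ] H) : reInnerCLM u T = (⟪u, T u⟫_ℂ).re := rfl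

theorem re_inner_smul (c : ℝ) (T : H →L[ℂ] H) (u : H) :
    (⟪u, (c • T) u⟫_ℂ).re = c * (⟪u, T u⟫_ℂ).re := by
  rw [← reInnerCLM_apply, map_smul, reInnerCLM_apply, smul_eq_mul]

theorem nonneg_of_re_inner {T : H →L[ℂ] H} (h : ∀ u, 0 ≤ (⟪u, T u⟫_ℂ).re) (hT : IsSelfAdjoint T) :
    0 ≤ T := by
  rw [ContinuousLinearMap.nonneg_iff_isPositive, ContinuousLinearMap.isPositive_def']
  refine ⟨hT, fun u => ?_⟩
  rw [ContinuousLinearMap.reApplyInnerSelf_apply]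
  change 0 ≤ (⟪T u, u⟫_ℂ).re
  rw [re_inner_apply_eq hT]
  exact h u

/-- If `B ≤ A + Y` as forms with a nonnegative bounded operator `Y`, and `Y ^ s` is trace class,
then `B ^ s ≤ A ^ s + K` with a trace class operator `K` such that `tr K ≤ tr Y ^ s`. -/
theorem exists_etrace_le [TopologicalSpace.SeparableSpace H] (hR : IsRes R) (hS : IsRes S)
    (hY : 0 ≤ Y) (hs : s ∈ Set.Ioo (0 : ℝ) 1)
    (h : ∀ u, form (op S) u ≤ form (op R) u + ENNReal.ofReal (⟪u, Y u⟫_ℂ).re)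
    (htr : etrace (cfc (fun y : ℝ => y ^ s) Y) ≠ ∞) :
    ∃ K : H →L[ℂ] H, 0 ≤ K ∧ etrace K ≤ etrace (cfc (fun y : ℝ => y ^ s) Y) ∧
      ∀ u, form (rpow (op S) s) u ≤ form (rpow (op R) s) u + ENNReal.ofReal (⟪u, K u⟫_ℂ).re := by
  have := countable_basisIndex (H := H)
  obtain ⟨V, hV, rfl⟩ := exists_sq_eq_of_nonneg hY
  have hVu : ∀ u, (⟪u, (V * V) u⟫_ℂ).re = ‖V u‖ ^ 2 := fun u => by
    have := re_inner_star_mul_self V u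
    rwa [hV.star_eq] at this
  simp only [hVu] at h
  have hc0 := rpowConst_pos hs
  set c := rpowConst s with hc
  have hofc : ENNReal.ofReal c ≠ 0 := (ENNReal.ofReal_pos.2 hc0).ne'
  have hG0 : ∀ l ∈ Set.Ioi (0 : ℝ), 0 ≤ resDiff R V l := fun l hl => hR.resDiff_nonneg hV hl
  have hpow : ∀ l ∈ Set.Ioi (0 : ℝ), ENNReal.ofReal (l ^ s) =
      ENNReal.ofReal (l ^ (s - 1)) * ENNReal.ofReal l := fun l hl => by
    have hl0 : 0 < l := hl
    rw [← ENNReal.ofReal_mul (Real.rpow_nonneg hl0.le _), ← Real.rpow_add_one hl0.ne',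
      sub_add_cancel]
  have hbound : ∀ l ∈ Set.Ioi (0 : ℝ), ENNReal.ofReal (l ^ s) * etrace (resDiff R V l) ≤
      ENNReal.ofReal (l ^ (s - 1)) * etrace (cfc (fun y : ℝ => y / (l + y)) (V * V)) := fun l hl => by
    rw [hpow l hl, mul_assoc]
    exact mul_le_mul_right (hR.etrace_resDiff_le hV hl) _
  have hcont : ContinuousOn (fun l : ℝ => l ^ s • resDiff R V l) (Set.Ioi 0) := by
    have h1 : ContinuousOn (fun l : ℝ => l ^ s) (Set.Ioi 0) :=
      (Real.continuous_rpow_const hs.1.le).continuousOn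
    exact h1.smul (hR.continuousOn_resDiff hV)
  -- The integral converges in operator norm: ‖D_l‖ ≤ tr D_l for the nonnegative D_l, and the trace
  -- bound integrates to c tr Y^s < ∞.
  have hint : IntegrableOn (fun l : ℝ => l ^ s • resDiff R V l) (Set.Ioi 0) := by
    refine ⟨hcont.aestronglyMeasurable measurableSet_Ioi, ?_⟩
    rw [HasFiniteIntegral]
    refine lt_of_le_of_lt (setLIntegral_mono' measurableSet_Ioi fun l hl => ?_)
      (lt_of_eq_of_lt (lintegral_etrace_eq hY hs) (ENNReal.mul_lt_top (by simp) htr.lt_top))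
    rw [enorm_smul, Real.enorm_eq_ofReal (Real.rpow_nonneg (le_of_lt hl) _)]
    exact (mul_le_mul_right (enorm_le_etrace (hG0 l hl)) _).trans (hbound l hl)
  let K : H →L[ℂ] H := c⁻¹ • ∫ l in Set.Ioi 0, l ^ s • resDiff R V l
  have hK : ∀ u, (⟪u, K u⟫_ℂ).re =
      c⁻¹ * ∫ l in Set.Ioi 0, l ^ s * (⟪u, resDiff R V l u⟫_ℂ).re := fun u => by
    rw [re_inner_smul, ← reInnerCLM_apply, ← (reInnerCLM u).integral_comp_comm hint]
    simp only [reInnerCLM_apply, re_inner_smul]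
  have hintu : ∀ u, IntegrableOn (fun l : ℝ => l ^ s * (⟪u, resDiff R V l u⟫_ℂ).re) (Set.Ioi 0) :=
    fun u => by
      have := (reInnerCLM u).integrable_comp hint
      simpa only [IntegrableOn, reInnerCLM_apply, re_inner_smul] using this
  have hnnu : ∀ u, ∀ l ∈ Set.Ioi (0 : ℝ), 0 ≤ l ^ s * (⟪u, resDiff R V l u⟫_ℂ).re := fun u l hl =>
    mul_nonneg (Real.rpow_nonneg (le_of_lt hl) _) (re_inner_nonneg (hG0 l hl) u)
  have hKl : ∀ u, ENNReal.ofReal c * ENNReal.ofReal (⟪u, K u⟫_ℂ).re =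
      ∫⁻ l in Set.Ioi 0, ENNReal.ofReal (l ^ s * (⟪u, resDiff R V l u⟫_ℂ).re) := fun u => by
    rw [hK, ← ENNReal.ofReal_mul hc0.le, mul_inv_cancel_left₀ hc0.ne',
      ofReal_integral_eq_lintegral_ofReal (hintu u)
        (ae_restrict_of_forall_mem measurableSet_Ioi (hnnu u))]
  have hKsa : IsSelfAdjoint K := by
    refine IsSelfAdjoint.smul (IsSelfAdjoint.all _) ?_
    have h1 := ((starL' ℝ : (H →L[ℂ] H) ≃L[ℝ] (H →L[ℂ] H)) :
      (H →L[ℂ] H) →L[ℝ] (H →L[ℂ] H)).integral_comp_comm hint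
    refine Eq.trans h1.symm (setIntegral_congr_fun measurableSet_Ioi fun l hl => ?_)
    exact (IsSelfAdjoint.smul (IsSelfAdjoint.all _) (IsSelfAdjoint.of_nonneg (hG0 l hl))).star_eq
  refine ⟨K, nonneg_of_re_inner (fun u => ?_) hKsa, ?_, fun u => ?_⟩
  · rw [hK]
    exact mul_nonneg (inv_nonneg.2 hc0.le) (setIntegral_nonneg measurableSet_Ioi (hnnu u))
  · have h1 : ENNReal.ofReal c * etrace K ≤
        ENNReal.ofReal c * etrace (cfc (fun y : ℝ => y ^ s) (V * V)) := by
      rw [← lintegral_etrace_eq hY hs, etrace, ← ENNReal.tsum_mul_left]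
      simp only [hKl]
      rw [← lintegral_tsum]
      · refine setLIntegral_mono' measurableSet_Ioi fun l hl => ?_
        refine le_trans (le_of_eq ?_) (hbound l hl)
        rw [etrace, ← ENNReal.tsum_mul_left]
        exact tsum_congr fun i => ENNReal.ofReal_mul (Real.rpow_nonneg (le_of_lt hl) _)
      · exact fun i => (hintu (basis H i)).1.aemeasurable.ennreal_ofReal
    exact (ENNReal.mul_le_mul_iff_right hofc ENNReal.ofReal_ne_top).1 h1
  -- After multiplication by c all three terms are integrals over l. The integrands compare
  -- pointwise: ‖u‖² - l⟨u,(B+l)⁻¹u⟩ ≤ ‖u‖² - l⟨u,(A+l)⁻¹u⟩ + l⟨u,D_l u⟩.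
  · refine (ENNReal.mul_le_mul_iff_right hofc ENNReal.ofReal_ne_top).1 ?_
    rw [mul_add, hKl, hS.form_rpow_eq_lintegral hs, hR.form_rpow_eq_lintegral hs,
      ← lintegral_add_right' _ (hintu u).1.aemeasurable.ennreal_ofReal]
    refine setLIntegral_mono' measurableSet_Ioi fun l hl => ?_
    have hl0 : 0 < l := hl
    have h1 := hR.le_resolvAt hS hV hl h u
    have h2 := re_inner_nonneg (hG0 l hl) u
    rw [ENNReal.ofReal_mul (Real.rpow_nonneg hl0.le _), hpow l hl, mul_assoc, ← mul_add]
    refine mul_le_mul_right ?_ _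
    rw [← ENNReal.ofReal_mul hl0.le]
    refine le_trans (ENNReal.ofReal_le_ofReal ?_) ENNReal.ofReal_add_le
    nlinarith [mul_le_mul_of_nonneg_left h1 hl0.le]

end

/-! ### From a form bound to the trace of the positive part -/

section

variable {R S K T : H →L[ℂ] H} {X : H →ₗ.[ℂ] H} {F : H →L[ℂ] H}

theorem form_neg_apply (A : H →ₗ.[ℂ] H) (u : H) : form A (-u) = form A u := by
  rw [form, form]
  by_cases h : u ∈ (rpow A (1 / 2)).domain
  · rw [dif_pos h, dif_pos (neg_mem h)]
    have : (⟨-u, neg_mem h⟩ : (rpow A (1 / 2)).domain) = -⟨u, h⟩ := rfl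
    rw [this, LinearPMap.map_neg, enorm_neg]
  · rw [dif_neg h, dif_neg fun h' => h (by simpa using neg_mem h')]

theorem IsTransform.form_positivePart_le (h : IsTransform X F) (u : H) :
    form (positivePart X) u ≤ form (absOp X) u := by
  rw [h.form_positivePart, h.form_absOp]
  refine lintegral_mono_ae ?_
  filter_upwards [h.ae_abs_lt_one u] with f hf
  refine ENNReal.ofReal_le_ofReal ?_
  have h1 : max f 0 ≤ |f| := max_le (le_abs_self f) (abs_nonneg f)
  exact div_le_div₀ (abs_nonneg f) h1 (sub_pos.2 hf) (by linarith)

theorem IsTransform.form_negativePart_le (h : IsTransform X F) (u : H) :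
    form (negativePart X) u ≤ form (absOp X) u := by
  rw [h.form_negativePart, h.form_absOp]
  refine lintegral_mono_ae ?_
  filter_upwards [h.ae_abs_lt_one u] with f hf
  refine ENNReal.ofReal_le_ofReal ?_
  have h1 : max (-f) 0 ≤ |f| := max_le (neg_le_abs f) (abs_nonneg f)
  exact div_le_div₀ (abs_nonneg f) h1 (sub_pos.2 hf) (by linarith)

/-- A form inequality on a form core extends to the whole form domain. -/
theorem IsTransform.form_le_of_isFormCore (h : IsTransform X F) {D : Submodule ℂ H}
    (hD : IsFormCore X D) (hK : 0 ≤ K)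
    (hle : ∀ u ∈ D, form (positivePart X) u ≤
      form (negativePart X) u + ENNReal.ofReal (⟪u, K u⟫_ℂ).re) {u : H}
    (hu : u ∈ formDomain (absOp X)) :
    form (positivePart X) u ≤ form (negativePart X) u + ENNReal.ofReal (⟪u, K u⟫_ℂ).re := by
  obtain ⟨V, hV, rfl⟩ := exists_sq_eq_of_nonneg hK
  have hVu : ∀ u, ENNReal.ofReal (⟪u, (V * V) u⟫_ℂ).re = ‖V u‖ₑ ^ 2 := fun u => by
    have := re_inner_star_mul_self V u
    rw [hV.star_eq] at this
    rw [this, ENNReal.ofReal_pow (norm_nonneg _), ofReal_norm]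
  simp only [hVu] at hle ⊢
  have hsq : ∀ x : ℝ≥0∞, (x ^ 2) ^ (1 / 2 : ℝ) = x := fun x => by
    rw [← ENNReal.rpow_natCast, ← ENNReal.rpow_mul]
    norm_num
  have hsq' : ∀ x : ℝ≥0∞, (x ^ (1 / 2 : ℝ)) ^ 2 = x := fun x => by
    rw [← ENNReal.rpow_natCast, ← ENNReal.rpow_mul]
    norm_num
  have hhalf : (0 : ℝ) ≤ 1 / 2 := by norm_num
  set N := form (negativePart X) u ^ (1 / 2 : ℝ) with hN
  let g : ℝ≥0∞ → ℝ≥0∞ := fun e => e + ((N + e) ^ 2 + (‖V u‖ₑ + ‖V‖ₑ * e) ^ 2) ^ (1 / 2 : ℝ)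
  -- Approximate u by v in the core within form distance e. The square roots of the forms of X₊ and
  -- X₋ are seminorms dominated by that of |X|, so they change by at most e, while ‖V·‖ changes by
  -- at most ‖V‖e. Then e → 0.
  have key : ∀ e : ℝ≥0∞, 0 < e → form (positivePart X) u ^ (1 / 2 : ℝ) ≤ g e := by
    intro e he
    obtain ⟨v, hv, hv'⟩ := hD.2 u hu (e ^ 2) (ENNReal.pow_pos he 2)
    have h1 : ‖u - v‖ₑ ≤ e := by
      have := ENNReal.rpow_le_rpow (le_self_add.trans hv'.le) hhalf
      rwa [hsq, hsq] at this
    have h2 : form (absOp X) (u - v) ^ (1 / 2 : ℝ) ≤ e := by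
      have := ENNReal.rpow_le_rpow (le_add_self.trans hv'.le) hhalf
      rwa [hsq] at this
    have h3 : form (positivePart X) (u - v) ^ (1 / 2 : ℝ) ≤ e :=
      (ENNReal.rpow_le_rpow (h.form_positivePart_le _) hhalf).trans h2
    have h4 : form (negativePart X) (v - u) ^ (1 / 2 : ℝ) ≤ e := by
      rw [← neg_sub, form_neg_apply]
      exact (ENNReal.rpow_le_rpow (h.form_negativePart_le _) hhalf).trans h2
    have h5 : form (negativePart X) v ^ (1 / 2 : ℝ) ≤ N + e := by
      have := form_add_le (negativePart X) u (v - u)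
      rw [add_sub_cancel] at this
      exact this.trans (add_le_add_right h4 _)
    have h6 : ‖V v‖ₑ ≤ ‖V u‖ₑ + ‖V‖ₑ * e := by
      have h7 : V v = V u - V (u - v) := by rw [map_sub, sub_sub_cancel]
      rw [h7]
      refine enorm_sub_le.trans (add_le_add_right ?_ _)
      exact (V.le_opENorm _).trans (mul_le_mul_right h1 _)
    have h7 : form (positivePart X) v ≤ (N + e) ^ 2 + (‖V u‖ₑ + ‖V‖ₑ * e) ^ 2 := by
      refine (hle v hv).trans (add_le_add ?_ (pow_le_pow_left₀ zero_le h6 2))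
      rw [← hsq' (form (negativePart X) v)]
      exact pow_le_pow_left₀ zero_le h5 2
    have h8 := form_add_le (positivePart X) (u - v) v
    rw [sub_add_cancel] at h8
    exact h8.trans (add_le_add h3 (ENNReal.rpow_le_rpow h7 hhalf))
  have hg : Tendsto (fun n : ℕ => g (ENNReal.ofReal (1 / ((n : ℝ) + 1)))) atTop (𝓝 (g 0)) := by
    have h1 : Continuous g := by
      have h2 : Continuous fun e : ℝ≥0∞ => ‖V‖ₑ * e := ENNReal.continuous_const_mul (by simp)
      have h3 : Continuous fun e : ℝ≥0∞ => (N + e) ^ 2 + (‖V u‖ₑ + ‖V‖ₑ * e) ^ 2 :=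
        ((ENNReal.continuous_pow 2).comp (continuous_const.add continuous_id)).add
          ((ENNReal.continuous_pow 2).comp (continuous_const.add h2))
      exact continuous_id.add (ENNReal.continuous_rpow_const.comp h3)
    have h2 := ENNReal.tendsto_ofReal (tendsto_one_div_add_atTop_nhds_zero_nat (𝕜 := ℝ))
    rw [ENNReal.ofReal_zero] at h2
    exact (h1.tendsto 0).comp h2
  have h1 := ge_of_tendsto' hg fun n => key _ (ENNReal.ofReal_pos.2 (by positivity))
  have h2 := pow_le_pow_left₀ zero_le h1 2
  simpa only [g, zero_add, add_zero, mul_zero, hsq', hN] using h2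

/-- A continuous approximation of the indicator function of `(0, 1)`. -/
def bump (n : ℕ) (f : ℝ) : ℝ := max 0 (min 1 (min (n * f) (n * (1 - f))))

theorem continuous_bump (n : ℕ) : Continuous (bump n) := by
  unfold bump
  fun_prop

theorem bump_nonneg (n : ℕ) (f : ℝ) : 0 ≤ bump n f := le_max_left _ _

theorem bump_le_one (n : ℕ) (f : ℝ) : bump n f ≤ 1 := max_le zero_le_one (min_le_left _ _)

theorem bump_of_nonpos (n : ℕ) {f : ℝ} (hf : f ≤ 0) : bump n f = 0 := by
  refine max_eq_left ((min_le_right _ _).trans ((min_le_left _ _).trans ?_))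
  exact mul_nonpos_of_nonneg_of_nonpos (Nat.cast_nonneg n) hf

theorem bump_le (n : ℕ) {f : ℝ} (hf : f ≤ 1) : bump n f ≤ n * (1 - f) :=
  max_le (mul_nonneg (Nat.cast_nonneg n) (sub_nonneg.2 hf))
    ((min_le_right _ _).trans (min_le_right _ _))

theorem tendsto_bump {f : ℝ} (h0 : 0 < f) (h1 : f < 1) :
    Tendsto (fun n => bump n f) atTop (𝓝 1) := by
  refine tendsto_const_nhds.congr' ?_
  obtain ⟨N, hN⟩ := exists_nat_ge (max f⁻¹ (1 - f)⁻¹)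
  filter_upwards [eventually_ge_atTop N] with n hn
  have h2 : max f⁻¹ (1 - f)⁻¹ ≤ n := hN.trans (by exact_mod_cast hn)
  have h3 : 1 ≤ n * f := by
    rw [← inv_le_iff_one_le_mul₀ h0]
    exact (le_max_left _ _).trans h2
  have h4 : 1 ≤ n * (1 - f) := by
    rw [← inv_le_iff_one_le_mul₀ (sub_pos.2 h1)]
    exact (le_max_right _ _).trans h2
  rw [bump, min_eq_left (le_min h3 h4), max_eq_right zero_le_one]

theorem bump_mono {f : ℝ} (h0 : 0 ≤ f) (h1 : f ≤ 1) : Monotone fun n => bump n f := by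
  intro n m hnm
  have h2 : (n : ℝ) ≤ m := by exact_mod_cast hnm
  have h3 := sub_nonneg.2 h1
  simp only [bump]
  gcongr

/-- The cut-off vector is a legitimate test vector in the form domain of |X| on which the form of X₋
vanishes, so the hypothesis bounds the form of X₊ there by that of K alone. -/
theorem IsTransform.form_positivePart_cfc_bump_le (h : IsTransform X F)
    (hle : ∀ u ∈ formDomain (absOp X), form (positivePart X) u ≤
      form (negativePart X) u + ENNReal.ofReal (⟪u, K u⟫_ℂ).re) (n : ℕ) (w : H) :
    ∫⁻ f, ENNReal.ofReal (bump n f ^ 2) * ENNReal.ofReal (max f 0 / (1 - max f 0))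
        ∂(specMeasure F w) ≤
      ENNReal.ofReal (⟪w, (cfc (bump n) F * K * star (cfc (bump n) F)) w⟫_ℂ).re := by
  have hsa := h.isSelfAdjoint
  have hc := (continuous_bump n).continuousOn (s := spectrum ℝ F)
  -- The cutoff vanishes for f ≤ 0 and is at most n(1-f), which cancels the pole of |f|/(1-|f|) at f
  -- = 1. The form is thus at most n‖w‖².
  have hdom : cfc (bump n) F w ∈ formDomain (absOp X) := by
    rw [mem_formDomain_iff, h.form_absOp, lintegral_specMeasure_cfc_apply hsa hc w (by fun_prop)]
    refine ne_top_of_le_ne_top (ENNReal.mul_ne_top ENNReal.ofReal_ne_top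
      (measure_ne_top (specMeasure F w) Set.univ)) (b := ENNReal.ofReal n * _) ?_
    rw [← lintegral_const]
    refine lintegral_mono_ae ?_
    filter_upwards [h.ae_abs_lt_one w] with f hf
    rw [← ENNReal.ofReal_mul (sq_nonneg _)]
    refine ENNReal.ofReal_le_ofReal ?_
    rcases le_total f 0 with hf0 | hf0
    · rw [bump_of_nonpos n hf0]
      simp
    · rw [abs_of_nonneg hf0] at hf ⊢
      have h1 : 0 < 1 - f := sub_pos.2 hf
      calc bump n f ^ 2 * (f / (1 - f)) ≤ n * (1 - f) * (f / (1 - f)) := by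
            gcongr
            calc bump n f ^ 2 = bump n f * bump n f := sq _
              _ ≤ 1 * (n * (1 - f)) := mul_le_mul (bump_le_one n f) (bump_le n hf.le)
                (bump_nonneg n f) zero_le_one
              _ = _ := one_mul _
        _ = n * f := by field_simp
        _ ≤ n := mul_le_of_le_one_right (Nat.cast_nonneg n) hf.le
  have h1 := hle _ hdom
  have h2 : form (negativePart X) (cfc (bump n) F w) = 0 := by
    rw [h.form_negativePart, lintegral_specMeasure_cfc_apply hsa hc w (by fun_prop)]
    refine (lintegral_congr fun f => ?_).trans lintegral_zero
    rcases le_total f 0 with hf0 | hf0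
    · rw [bump_of_nonpos n hf0]
      simp
    · rw [max_eq_right (neg_nonpos.2 hf0)]
      simp
  rw [h2, zero_add, h.form_positivePart,
    lintegral_specMeasure_cfc_apply hsa hc w (by fun_prop)] at h1
  rw [(isSelfAdjoint_cfc _ _).star_eq]
  change _ ≤ ENNReal.ofReal (⟪w, cfc (bump n) F (K (cfc (bump n) F w))⟫_ℂ).re
  rwa [← inner_cfc_left]

theorem IsTransform.tendsto_lintegral_bump (h : IsTransform X F) (w : H) :
    Tendsto (fun n => ∫⁻ f, ENNReal.ofReal (bump n f ^ 2) *
      ENNReal.ofReal (max f 0 / (1 - max f 0)) ∂(specMeasure F w)) atTop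
      (𝓝 (form (positivePart X) w)) := by
  rw [h.form_positivePart]
  have hm : ∀ n, Measurable (bump n) := fun n => (continuous_bump n).measurable
  refine lintegral_tendsto_of_tendsto_of_monotone (fun n => ?_) ?_ ?_
  · have := hm n
    exact Measurable.aemeasurable (by fun_prop)
  · filter_upwards [h.ae_abs_lt_one w] with f hf n m hnm
    rcases le_total f 0 with hf0 | hf0
    · simp [bump_of_nonpos _ hf0]
    · rw [abs_of_nonneg hf0] at hf
      refine mul_le_mul_left (ENNReal.ofReal_le_ofReal ?_) _
      exact pow_le_pow_left₀ (bump_nonneg n f) (bump_mono hf0 hf.le hnm) 2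
  · filter_upwards [h.ae_abs_lt_one w] with f hf
    rcases le_or_gt f 0 with hf0 | hf0
    · simp [max_eq_right hf0]
    · rw [abs_of_pos hf0] at hf
      have h1 := ENNReal.tendsto_ofReal ((tendsto_bump hf0 hf).pow 2)
      have h2 := ENNReal.Tendsto.mul_const (b := ENNReal.ofReal (max f 0 / (1 - max f 0))) h1
        (Or.inr ENNReal.ofReal_ne_top)
      simpa using h2

/-- For a finite set of basis vectors and fixed n, the sum is at most the trace of K compressed by
the contraction `cfc (bump n) F`, hence at most tr K. First n → ∞, then the finite sets exhaust the
basis. -/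
theorem IsTransform.tsum_form_positivePart_le (h : IsTransform X F) (hK : 0 ≤ K)
    (hle : ∀ u ∈ formDomain (absOp X), form (positivePart X) u ≤
      form (negativePart X) u + ENNReal.ofReal (⟪u, K u⟫_ℂ).re) :
    ∑' i, form (positivePart X) (basis H i) ≤ etrace K := by
  rw [ENNReal.tsum_eq_iSup_sum]
  refine iSup_le fun s => ?_
  refine le_of_tendsto' (tendsto_finsetSum s fun i _ => h.tendsto_lintegral_bump (basis H i))
    fun n => ?_
  calc _ ≤ ∑ i ∈ s, ENNReal.ofReal
        (⟪basis H i, (cfc (bump n) F * K * star (cfc (bump n) F)) (basis H i)⟫_ℂ).re :=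
        Finset.sum_le_sum fun i _ => h.form_positivePart_cfc_bump_le hle n _
    _ ≤ etrace (cfc (bump n) F * K * star (cfc (bump n) F)) := ENNReal.sum_le_tsum s
    _ ≤ etrace K := etrace_conj_le hK fun x => by
        have := norm_cfc_apply_le (T := F) zero_le_one (fun f _ => by
          rw [abs_of_nonneg (bump_nonneg n f)]
          exact bump_le_one n f) x
        rwa [one_mul] at this

theorem IsTransform.form_positivePart_le_norm (h : IsTransform X F)
    (hle : ∀ u ∈ formDomain (absOp X), form (positivePart X) u ≤
      form (negativePart X) u + ENNReal.ofReal (⟪u, K u⟫_ℂ).re) (w : H) :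
    form (positivePart X) w ≤ ENNReal.ofReal (‖K‖ * ‖w‖ ^ 2) := by
  refine le_of_tendsto' (h.tendsto_lintegral_bump w) fun n =>
    (h.form_positivePart_cfc_bump_le hle n w).trans (ENNReal.ofReal_le_ofReal ?_)
  have h1 : ‖cfc (bump n) F w‖ ≤ 1 * ‖w‖ := norm_cfc_apply_le zero_le_one (fun f _ => by
    rw [abs_of_nonneg (bump_nonneg n f)]
    exact bump_le_one n f) w
  rw [one_mul] at h1
  rw [(isSelfAdjoint_cfc _ _).star_eq]
  change (⟪w, cfc (bump n) F (K (cfc (bump n) F w))⟫_ℂ).re ≤ _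
  rw [← inner_cfc_left]
  calc _ ≤ ‖cfc (bump n) F w‖ * ‖K (cfc (bump n) F w)‖ := re_inner_le_norm (𝕜 := ℂ) _ _
    _ ≤ ‖w‖ * (‖K‖ * ‖w‖) := by
        gcongr
        exact (K.le_opNorm _).trans (by gcongr)
    _ = _ := by ring

/-- If the spectrum of `R` stays away from `0`, then `R⁻¹ - 1` is bounded. -/
theorem IsRes.op_eq_toPMap (hR : IsRes R) (h0 : (0 : ℝ) ∉ spectrum ℝ R) :
    op R = ((cfc (fun r : ℝ => (1 - r) / r) R : H →L[ℂ] H) : H →ₗ[ℂ] H).toPMap ⊤ := by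
  have hsa := hR.isSelfAdjoint
  have hne : ∀ r ∈ spectrum ℝ R, r ≠ 0 := fun r hr h => h0 (h ▸ hr)
  have hinv : ContinuousOn (fun r : ℝ => r⁻¹) (spectrum ℝ R) := continuousOn_id.inv₀ hne
  have hc : ContinuousOn (fun r : ℝ => (1 - r) / r) (spectrum ℝ R) :=
    ContinuousOn.div (by fun_prop) continuousOn_id hne
  symm
  refine eq_op hR.injective (fun v => ⟨trivial, ?_⟩) fun x _ => ?_
  · change cfc (fun r : ℝ => (1 - r) / r) R (R v) = v - R v
    have h1 : cfc (fun r : ℝ => (1 - r) / r) R * R = 1 - R := by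
      nth_rw 2 [← cfc_id' ℝ R]
      rw [← cfc_mul _ (fun r => r) R hc continuousOn_id]
      have h2 : (1 - R : H →L[ℂ] H) = cfc (fun r : ℝ => 1 - r) R := by
        rw [cfc_sub (fun _ => (1 : ℝ)) (fun r => r) R, cfc_const_one ℝ R, cfc_id' ℝ R]
      rw [h2]
      exact cfc_congr fun r hr => div_mul_cancel₀ _ (hne r hr)
    exact congrArg (fun T : H →L[ℂ] H => T v) h1
  · refine ⟨cfc (fun r : ℝ => r⁻¹) R x, ?_⟩
    have h1 : R * cfc (fun r : ℝ => r⁻¹) R = 1 := by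
      nth_rw 1 [← cfc_id' ℝ R]
      rw [← cfc_mul (fun r => r) _ R continuousOn_id hinv, ← cfc_const_one ℝ R]
      exact cfc_congr fun r hr => mul_inv_cancel₀ (hne r hr)
    exact congrArg (fun T : H →L[ℂ] H => T x) h1

theorem IsRes.cfc_div_nonneg (hR : IsRes R) : 0 ≤ cfc (fun r : ℝ => (1 - r) / r) R :=
  cfc_nonneg fun _ hr =>
    div_nonneg (sub_nonneg.2 (hR.spectrum_subset hr).2) (hR.spectrum_subset hr).1

theorem IsRes.ofReal_re_inner_cfc_div (hR : IsRes R) (h0 : (0 : ℝ) ∉ spectrum ℝ R) (u : H) :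
    ENNReal.ofReal (⟪u, cfc (fun r : ℝ => (1 - r) / r) R u⟫_ℂ).re = form (op R) u := by
  rw [hR.form_op, lintegral_specMeasure hR.isSelfAdjoint]
  · exact ContinuousOn.div (by fun_prop) continuousOn_id fun r hr h => h0 (h ▸ hr)
  · exact fun r hr => div_nonneg (sub_nonneg.2 (hR.spectrum_subset hr).2) (hR.spectrum_subset hr).1

/-- Evaluated at √R v, the form is ⟨v,(1-R)v⟩ and the bound is k⟨v,Rv⟩. Hence R ≥ (1+k)⁻¹, and the
spectrum stays away from 0. -/
theorem IsRes.zero_notMem_spectrum_of_form_le (hR : IsRes R) {k : ℝ} (hk : 0 ≤ k)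
    (h : ∀ w, form (op R) w ≤ ENNReal.ofReal (k * ‖w‖ ^ 2)) : (0 : ℝ) ∉ spectrum ℝ R := by
  have hsa := hR.isSelfAdjoint
  have hsqrt : ContinuousOn Real.sqrt (spectrum ℝ R) := Real.continuous_sqrt.continuousOn
  have key : ∀ v, ‖v‖ ^ 2 ≤ (1 + k) * (⟪v, R v⟫_ℂ).re := by
    intro v
    have h1 := h (cfc Real.sqrt R v)
    have h2 : ‖cfc Real.sqrt R v‖ ^ 2 = (⟪v, R v⟫_ℂ).re := by
      rw [norm_cfc_apply_sq hsqrt]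
      have : cfc (fun x => √x ^ 2) R = R := by
        nth_rw 2 [← cfc_id' ℝ R]
        exact cfc_congr fun r hr => Real.sq_sqrt (hR.spectrum_subset hr).1
      rw [this]
    have h3 : form (op R) (cfc Real.sqrt R v) = ENNReal.ofReal (‖v‖ ^ 2 - (⟪v, R v⟫_ℂ).re) := by
      have h4 : ‖v‖ ^ 2 - (⟪v, R v⟫_ℂ).re = (⟪v, cfc (fun r : ℝ => 1 - r) R v⟫_ℂ).re := by
        rw [cfc_sub (fun _ => (1 : ℝ)) (fun r => r) R, cfc_const_one ℝ R, cfc_id' ℝ R, sub_apply,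
          inner_sub_right, Complex.sub_re]
        congr 1
        exact (inner_self_eq_norm_sq (𝕜 := ℂ) v).symm
      rw [hR.form_op, lintegral_specMeasure_cfc_apply hsa hsqrt v (by fun_prop), h4,
        ← lintegral_specMeasure hsa (by fun_prop) fun r hr => sub_nonneg.2 (hR.spectrum_subset hr).2]
      refine lintegral_congr_ae ?_
      filter_upwards [hR.ae_mem_Ioc v] with r hr
      rw [← ENNReal.ofReal_mul (sq_nonneg _), Real.sq_sqrt hr.1.le, mul_div_cancel₀ _ hr.1.ne']
    rw [h2, h3, ENNReal.ofReal_le_ofReal_iff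
      (mul_nonneg hk (re_inner_nonneg hR.nonneg v))] at h1
    linarith
  have h1 : algebraMap ℝ (H →L[ℂ] H) (1 + k)⁻¹ ≤ R := by
    rw [← sub_nonneg]
    refine nonneg_of_re_inner (fun u => ?_) (hsa.sub (IsSelfAdjoint.algebraMap _ (IsSelfAdjoint.all _)))
    rw [Algebra.algebraMap_eq_smul_one, sub_apply, inner_sub_right, Complex.sub_re, re_inner_smul]
    have h2 : (⟪u, (1 : H →L[ℂ] H) u⟫_ℂ).re = ‖u‖ ^ 2 := inner_self_eq_norm_sq (𝕜 := ℂ) u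
    rw [h2, sub_nonneg, inv_mul_le_iff₀ (by positivity)]
    exact key u
  intro h2
  have h3 := (algebraMap_le_iff_le_spectrum hsa).1 h1 0 h2
  have : 0 < (1 + k)⁻¹ := by positivity
  linarith

/-- If the form inequality `x₊ ≤ x₋ + k` holds on a form core of `X`, with a trace class operator
`K`, then `X₊` is trace class and `tr X₊ ≤ tr K`. -/
theorem exists_positivePart_eq_toPMap (hX : IsSelfAdjoint X) {D : Submodule ℂ H}
    (hD : IsFormCore X D) (hK : 0 ≤ K)
    (hle : ∀ u ∈ D, form (positivePart X) u ≤
      form (negativePart X) u + ENNReal.ofReal (⟪u, K u⟫_ℂ).re) :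
    ∃ T : H →L[ℂ] H, 0 ≤ T ∧ positivePart X = (T : H →ₗ[ℂ] H).toPMap ⊤ ∧ etrace T ≤ etrace K := by
  obtain ⟨F, hF⟩ := exists_isTransform hX
  have hle' : ∀ u ∈ formDomain (absOp X), form (positivePart X) u ≤
      form (negativePart X) u + ENNReal.ofReal (⟪u, K u⟫_ℂ).re := fun u hu =>
    hF.form_le_of_isFormCore hD hK hle hu
  have h1 := hF.form_positivePart_le_norm hle'
  have h2 := hF.tsum_form_positivePart_le hK hle'
  have hR := hF.isRes_pos
  rw [hF.positivePart_eq] at h1 h2 ⊢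
  have h0 := hR.zero_notMem_spectrum_of_form_le (norm_nonneg K) h1
  refine ⟨_, hR.cfc_div_nonneg, hR.op_eq_toPMap h0, ?_⟩
  simpa only [etrace, hR.ofReal_re_inner_cfc_div h0] using h2

theorem re_traceBounded_nonneg (hT : 0 ≤ T) :
    0 ≤ (traceBounded T).re := by
  rw [re_traceBounded_eq hT]
  exact tsum_nonneg fun i => re_inner_nonneg hT _

theorem re_traceBounded_le (hS : 0 ≤ S) (hT : 0 ≤ T) (hS' : IsTraceClassBounded S)
    (hT' : IsTraceClassBounded T) (h : etrace S ≤ etrace T) :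
    (traceBounded S).re ≤ (traceBounded T).re := by
  rw [← ofReal_re_traceBounded hS hS', ← ofReal_re_traceBounded hT hT'] at h
  exact (ENNReal.ofReal_le_ofReal_iff (re_traceBounded_nonneg hT)).1 h

/-- If `A ^ s` is bounded and everywhere defined, then so is `A`. -/
theorem IsRes.exists_bounded_of_rpow (hR : IsRes R) {s : ℝ} (hs : 0 < s)
    (hT : rpow (op R) s = (T : H →ₗ[ℂ] H).toPMap ⊤) :
    ∃ Y : H →L[ℂ] H, 0 ≤ Y ∧ cfc (fun y : ℝ => y ^ s) Y = T ∧
      ∀ u, ENNReal.ofReal (⟪u, Y u⟫_ℂ).re = form (op R) u := by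
  have hsa := hR.isSelfAdjoint
  rw [rpow_op hR] at hT
  have hR' := hR.cfc_rpowRes hs
  have hc := hR.continuousOn (continuousOn_rpowRes hs)
  -- An everywhere defined power means that its resolvent is onto, hence invertible. As `rpowRes s`
  -- vanishes at 0, the point 0 is then outside the spectrum of R as well.
  have hsurj : Function.Surjective (cfc (rpowRes s) R : H →L[ℂ] H) := fun x => by
    rw [← mem_op_domain, hT]
    trivial
  have hunit : IsUnit (cfc (rpowRes s) R) :=
    ContinuousLinearMap.isUnit_iff_bijective.2 ⟨hR'.injective, hsurj⟩
  have h0' : (0 : ℝ) ∉ spectrum ℝ (cfc (rpowRes s) R) := (spectrum.zero_notMem_iff ℝ).2 hunit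
  have h0 : (0 : ℝ) ∉ spectrum ℝ R := fun h => by
    refine (isUnit_cfc_iff (rpowRes s) R hc hsa).1 hunit 0 h ?_
    rw [rpowRes, Real.zero_rpow hs.ne', zero_div]
  have hpos : ∀ r ∈ spectrum ℝ R, r ∈ Set.Ioc (0 : ℝ) 1 := fun r hr =>
    ⟨lt_of_le_of_ne (hR.spectrum_subset hr).1 fun h => h0 (h ▸ hr), (hR.spectrum_subset hr).2⟩
  have hdiv : ContinuousOn (fun r : ℝ => (1 - r) / r) (spectrum ℝ R) :=
    ContinuousOn.div (by fun_prop) continuousOn_id fun r hr => (hpos r hr).1.ne'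
  refine ⟨_, hR.cfc_div_nonneg, ?_, hR.ofReal_re_inner_cfc_div h0⟩
  have h1 : cfc (fun r : ℝ => (1 - r) / r) (cfc (rpowRes s) R) = T :=
    toPMap_injective ((hR'.op_eq_toPMap h0').symm.trans hT)
  rw [← h1, ← cfc_comp' (fun y : ℝ => y ^ s) (fun r : ℝ => (1 - r) / r) R
    (Real.continuous_rpow_const hs.le).continuousOn hdiv hsa,
    ← cfc_comp' (fun r : ℝ => (1 - r) / r) (rpowRes s) R ?_ hc hsa]
  · exact cfc_congr fun r hr => (one_sub_rpowRes_div (hpos r hr)).symm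
  · refine ContinuousOn.div (by fun_prop) continuousOn_id ?_
    rintro _ ⟨r, hr, rfl⟩
    exact (rpowRes_pos (hpos r hr)).ne'

theorem IsRes.form_rpow_rpow (hR : IsRes R) {p s : ℝ} (hp : 0 < p) (hs : 0 < s) (hps : p * s = 1)
    (u : H) : form (rpow (op (cfc (rpowRes p) R)) s) u = form (op R) u := by
  rw [(hR.cfc_rpowRes hp).form_rpow hs, hR.form_op, lintegral_specMeasure_cfc hR.isSelfAdjoint
    (hR.continuousOn (continuousOn_rpowRes hp)) u (by fun_prop)]
  refine lintegral_congr_ae ?_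
  filter_upwards [hR.ae_mem_Ioc u] with r hr
  rw [one_sub_rpowRes_div hr, ← Real.rpow_mul (div_nonneg (sub_nonneg.2 hr.2) hr.1.le), hps,
    Real.rpow_one]

/-- The integral representation requires s < 1; the endpoint s = 1, that is p = 1, needs no integral
and takes K = Y. -/
theorem exists_etrace_le_of_le_one [TopologicalSpace.SeparableSpace H] {Y : H →L[ℂ] H} {s : ℝ}
    (hR : IsRes R) (hS : IsRes S) (hY : 0 ≤ Y) (hs0 : 0 < s) (hs1 : s ≤ 1)
    (h : ∀ u, form (op S) u ≤ form (op R) u + ENNReal.ofReal (⟪u, Y u⟫_ℂ).re)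
    (htr : etrace (cfc (fun y : ℝ => y ^ s) Y) ≠ ∞) :
    ∃ K : H →L[ℂ] H, 0 ≤ K ∧ etrace K ≤ etrace (cfc (fun y : ℝ => y ^ s) Y) ∧
      ∀ u, form (rpow (op S) s) u ≤ form (rpow (op R) s) u + ENNReal.ofReal (⟪u, K u⟫_ℂ).re := by
  rcases lt_or_eq_of_le hs1 with hs | rfl
  · exact exists_etrace_le hR hS hY ⟨hs0, hs⟩ h htr
  · have h1 : cfc (fun y : ℝ => y ^ (1 : ℝ)) Y = Y := by
      simp only [Real.rpow_one]
      exact cfc_id' ℝ Y (IsSelfAdjoint.of_nonneg hY)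
    refine ⟨Y, hY, by rw [h1], fun u => ?_⟩
    rw [hS.form_rpow one_pos, hR.form_rpow one_pos]
    simp only [Real.rpow_one]
    rw [← hS.form_op, ← hR.form_op]
    exact h u

end

end UnboundedOperator

end

/-! ### The BKS inequality -/

open UnboundedOperator in
theorem theoremA1 {H : Type*} [NormedAddCommGroup H] [InnerProductSpace ℂ H] [CompleteSpace H]
    [TopologicalSpace.SeparableSpace H] (p : ℝ) (hp : 1 ≤ p) (A B : H →ₗ.[ℂ] H)
    (hA : IsNonnegSelfAdjoint A) (hB : IsNonnegSelfAdjoint B)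
    -- `D` is the self-adjoint operator `B ^ p - A ^ p`
    (D : H →ₗ.[ℂ] H) (hdom : formDomain (rpow A p) ≤ formDomain (rpow B p))
    (hD : IsFormDifference D (rpow B p) (rpow A p))
    (htr : IsTraceClass (rpow (positivePart D) (1 / p))) :
    formDomain A ≤ formDomain B ∧
    -- the bound for the positive part of every self-adjoint realization `X` of `B - A`
    (∀ X : H →ₗ.[ℂ] H, IsFormDifference X B A →
      IsTraceClass (positivePart X) ∧ (trace (positivePart X)).re ≤ (trace (rpow (positivePart D) (1 / p))).re) ∧
    -- the same bound without a self-adjoint realization: `B - A ≤ K` as quadratic forms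
    ∃ K : H →L[ℂ] H, K.IsPositive ∧ IsTraceClassBounded K ∧
      (traceBounded K).re ≤ (trace (rpow (positivePart D) (1 / p))).re ∧
      ∀ u : H, form B u ≤ form A u + ENNReal.ofReal (⟪u, K u⟫_ℂ).re := by
  have hs0 : 0 < 1 / p := by positivity
  have hp0 : 0 < p := by linarith
  have hs1 : 1 / p ≤ 1 := (div_le_one hp0).2 hp
  have hps : p * (1 / p) = 1 := mul_one_div_cancel hp0.ne'
  have hRA := hA.isRes
  have hRB := hB.isRes
  have hP := isNonnegSelfAdjoint_positivePart hD.1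
  obtain ⟨T, hT, hTtr⟩ := htr
  rw [hT, trace_toPMap hTtr]
  have hT' := hT
  rw [hP.eq_op] at hT'
  obtain ⟨Y, hY, hYT, hYform⟩ := hP.isRes.exists_bounded_of_rpow hs0 hT'
  have hT0 : 0 ≤ T := hYT ▸ cfc_nonneg fun y hy => Real.rpow_nonneg (spectrum_nonneg_of_nonneg hY hy) _
  -- On the form domain of A^p, which is the common form domain by `hdom`, this is the difference
  -- identity with the form of D₋ dropped. Elsewhere the right side is infinite.
  have hle : ∀ u, form (rpow B p) u ≤ form (rpow A p) u + ENNReal.ofReal (⟪u, Y u⟫_ℂ).re := by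
    intro u
    rw [hYform u, ← hP.eq_op]
    by_cases hu : u ∈ formDomain (rpow A p)
    · rw [add_comm, hD.2.2 u ⟨hu, hdom hu⟩]
      exact le_add_self
    · rw [mem_formDomain_iff, not_not] at hu
      rw [hu, top_add]
      exact le_top
  rw [hA.eq_op, hB.eq_op, rpow_op hRA, rpow_op hRB] at hle
  have hetr : etrace T ≠ ∞ := (isTraceClassBounded_iff hT0).1 hTtr
  obtain ⟨K, hK, hKtr, hKle⟩ := exists_etrace_le_of_le_one (hRA.cfc_rpowRes hp0)
    (hRB.cfc_rpowRes hp0) hY hs0 hs1 hle (hYT.symm ▸ hetr)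
  rw [hYT] at hKtr
  simp only [hRA.form_rpow_rpow hp0 hs0 hps, hRB.form_rpow_rpow hp0 hs0 hps] at hKle
  rw [← hA.eq_op, ← hB.eq_op] at hKle
  have hbdd : ∀ S : H →L[ℂ] H, 0 ≤ S → etrace S ≤ etrace K →
      IsTraceClassBounded S ∧ (traceBounded S).re ≤ (traceBounded T).re := by
    intro S hS hSK
    have h1 : IsTraceClassBounded S :=
      (isTraceClassBounded_iff hS).2 (ne_top_of_le_ne_top hetr (hSK.trans hKtr))
    exact ⟨h1, re_traceBounded_le hS hT0 h1 hTtr (hSK.trans hKtr)⟩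
  refine ⟨fun u hu => ?_, fun X hX => ?_, K, (ContinuousLinearMap.nonneg_iff_isPositive K).1 hK,
    (hbdd K hK le_rfl).1, (hbdd K hK le_rfl).2, hKle⟩
  · rw [mem_formDomain_iff] at hu ⊢
    exact ne_top_of_le_ne_top (ENNReal.add_ne_top.2 ⟨hu, ENNReal.ofReal_ne_top⟩) (hKle u)
  · obtain ⟨S, hS, hXS, hSK⟩ := exists_positivePart_eq_toPMap hX.1 hX.2.1 hK fun u hu => by
      have hfin : form A u ≠ ∞ := (mem_formDomain_iff ..).1 hu.1
      -- Adding the finite value a[u] to both sides lets the difference identity be used without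
      -- subtraction: x₊ + a becomes x₋ + b, and b ≤ a + k finishes.
      rw [← ENNReal.add_le_add_iff_right hfin, hX.2.2 u hu, add_assoc,
        add_comm (ENNReal.ofReal _)]
      exact add_le_add_right (hKle u) _
    obtain ⟨h1, h2⟩ := hbdd S hS hSK
    rw [hXS, trace_toPMap h1]
    exact ⟨isTraceClass_toPMap h1, h2⟩
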